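/- Let $\mathcal O$ be a local principal ideal domain (possibly a field) with maximal ideal $\mathfrak p$ and residue field $k$, and let $\alpha,\beta\in\mathcal O$ satisfy $\alpha\beta=2$. Let $G=G_{\alpha,\beta}=\operatorname{Spec}\mathcal O[X]/(X^2-\alpha X)$ be the group scheme of length $2$ with comultiplication $X\mapsto X\otimes 1+1\otimes X-\beta\,X\otimes X$. An action of $G$ on $\operatorname{Spec}S$ has a coaction of the form $s\mapsto 1\otimes s+X\otimes\delta(s)$ with $\delta\colon S\to S$ an $\mathcal O$-linear map; an element $s$ is $G$-invariant if $\delta(s)=0$, and the fixed locus $\operatorname{Fix}(G)$ is the closed subscheme of $\operatorname{Spec}S$ defined by the ideal generated by the image of $\delta$. If the base is a field, $\deg\operatorname{Fix}(G)$ is the dimension over that field of the coordinate ring of $\operatorname{Fix}(G)$. The Tyurina number of $k[[x,y,z]]/(f)$ is $\dim_k k[[x,y,z]]/(f,f_x,f_y,f_z)$. Suppose that $G$ acts on $\mathcal O[[u,v]]$, that $\operatorname{Fix}(G)\supset(u=v=0)$ as subsets of $\operatorname{Spec}\mathcal O[[u,v]]$, and that the fixed locus of the induced action of $G_k=G\otimes_{\mathcal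 O}k$ on $k[[u,v]]$ is $(u=v=0)$ as a subset of $\operatorname{Spec}k[[u,v]]$. Put $$x=u(u+\alpha\delta(u)),\quad y=v(v+\alpha\delta(v)),\quad z=\beta uv+\delta(u)v+u\delta(v),\quad a=\beta u+\delta(u),\quad b=\beta v+\delta(v).$$ 1. The elements $x,y,z,a,b$ are $G$-invariant. Substitution of $x,y,z$ for the variables is a well-defined homomorphism $\mathcal O[[x,y,z]]\to\mathcal O[[u,v]]$ whose image is the invariant subalgebra $\mathcal O[[u,v]]^G$. For any power series in $\mathcal O[[x,y,z]]$, again denoted $a,b$, that are mapped to $a,b$, it induces an isomorphism $$\mathcal O[[x,y,z]]/(F)\;\cong\;\mathcal O[[u,v]]^G,\qquad F=z^2-\alpha abz+a^2y+b^2x-\beta^2xy .$$ 2. Suppose moreover that $\operatorname{char}\operatorname{Frac}\mathcal O=0$ and $\operatorname{char}k=2$, and let $\tau$ be the Tyurina number of $k[[x,y,z]]/(\overline F)$, where $\overline F$ is the reduction of $F$ modulo $\mathfrak p$. (a) If $G_k\cong\alpha_2$, then $\tau$ and $\deg\operatorname{Fix}(G_k\curvearrowright k[[u,v]])$ are finite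 and $$\tau=2\deg\operatorname{Fix}(G_k\curvearrowright k[[u,v]]).$$ If in addition $\mathcal O$ is $\mathfrak p$-adically complete, then $\deg\operatorname{Fix}(G\curvearrowright\operatorname{Frac}\mathcal O\otimes_{\mathcal O}\mathcal O[[u,v]])$ is finite and $$\tau=2\deg\operatorname{Fix}(G\curvearrowright\operatorname{Frac}\mathcal O\otimes_{\mathcal O}\mathcal O[[u,v]]).$$ (b) If $G_k\cong\mu_2$, then $\tau=2$ and $$\deg\operatorname{Fix}(G_k\curvearrowright k[[u,v]])=\deg\operatorname{Fix}(G\curvearrowright\operatorname{Frac}\mathcal O\otimes_{\mathcal O}\mathcal O[[u,v]])=1 .$$ -/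

import Mathlib

open scoped TensorProduct

noncomputable section

/-! ## Group schemes of length two -/

/-- The coordinate ring `𝒪[X] / (X ^ 2 - α X)` of the group scheme `G_{α,β}`, where `α β = 2`.
The parameter `β` enters through the comultiplication. -/
def TateOort {O : Type*} [CommRing O] (α β : O) (_h : α * β = 2) : Type _ :=
  AdjoinRoot (Polynomial.X ^ 2 - Polynomial.C α * Polynomial.X : Polynomial O)

namespace TateOort

variable {O : Type*} [CommRing O] (α β : O) (h : α * β = 2)

instance : CommRing (TateOort α β h) :=
  inferInstanceAs (CommRing (AdjoinRoot (Polynomial.X ^ 2 - Polynomial.C α * Polynomial.X)))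

instance : Algebra O (TateOort α β h) :=
  inferInstanceAs (Algebra O (AdjoinRoot (Polynomial.X ^ 2 - Polynomial.C α * Polynomial.X)))

/-- The class of `X`. -/
def gen : TateOort α β h :=
  AdjoinRoot.root (Polynomial.X ^ 2 - Polynomial.C α * Polynomial.X)

theorem gen_mul_gen : gen α β h * gen α β h = α • gen α β h := by
  have e := AdjoinRoot.eval₂_root (Polynomial.X ^ 2 - Polynomial.C α * Polynomial.X)
  simp only [Polynomial.eval₂_sub, Polynomial.eval₂_mul, Polynomial.eval₂_pow,
    Polynomial.eval₂_X, Polynomial.eval₂_C, sub_eq_zero] at e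
  rw [Algebra.smul_def, ← sq]
  exact e

variable {α β h} in
/-- The algebra homomorphism out of `𝒪[X] / (X ^ 2 - α X)` sending `X` to `t`. -/
def lift {B : Type*} [CommRing B] [Algebra O B] (t : B) (ht : t * t = α • t) :
    TateOort α β h →ₐ[O] B :=
  AdjoinRoot.liftAlgHom _ (Algebra.ofId O B) t (by
    simp [sq, ht, Algebra.smul_def])

@[simp]
theorem lift_gen {B : Type*} [CommRing B] [Algebra O B] (t : B) (ht : t * t = α • t) :
    lift (β := β) (h := h) t ht (gen α β h) = t :=
  AdjoinRoot.liftAlgHom_root ..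

variable {α β h} in
theorem algHom_ext {B : Type*} [CommRing B] [Algebra O B] {f g : TateOort α β h →ₐ[O] B}
    (e : f (gen α β h) = g (gen α β h)) : f = g :=
  AdjoinRoot.algHom_ext e

theorem mul_self_eq {B : Type*} [CommRing B] [Algebra O B] {α β : O} (h : α * β = 2) (p q : B)
    (hp : p * p = α • p) (hq : q * q = α • q) :
    (p + q - β • (p * q)) * (p + q - β • (p * q)) = α • (p + q - β • (p * q)) := by
  have h' : algebraMap O B α * algebraMap O B β = 2 := by rw [← map_mul, h, map_ofNat]
  simp only [Algebra.smul_def] at *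
  linear_combination (1 + algebraMap O B β ^ 2 * q ^ 2 - 2 * algebraMap O B β * q) * hp
    + (1 + algebraMap O B β ^ 2 * algebraMap O B α * p - 2 * algebraMap O B β * p) * hq
    + (algebraMap O B α * algebraMap O B β - 1) * p * q * h'

/-- The comultiplication `X ↦ X ⊗ 1 + 1 ⊗ X - β X ⊗ X`. -/
def comulHom : TateOort α β h →ₐ[O] TateOort α β h ⊗[O] TateOort α β h :=
  lift (gen α β h ⊗ₜ 1 + 1 ⊗ₜ gen α β h - β • (gen α β h ⊗ₜ gen α β h)) (by
    have e : gen α β h ⊗ₜ[O] gen α β h = (gen α β h ⊗ₜ[O] 1) * (1 ⊗ₜ[O] gen α β h) := by simp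
    rw [e]
    exact mul_self_eq h _ _ (by simp [gen_mul_gen, TensorProduct.smul_tmul'])
      (by simp [gen_mul_gen]))

/-- The counit `X ↦ 0` (the neutral section). -/
def counitHom : TateOort α β h →ₐ[O] O := lift 0 (by simp)

instance : Bialgebra O (TateOort α β h) :=
  Bialgebra.ofAlgHom (comulHom α β h) (counitHom α β h)
    (algHom_ext (by
      simp [comulHom, TensorProduct.tmul_add, TensorProduct.add_tmul, TensorProduct.tmul_sub,
        TensorProduct.sub_tmul, ← TensorProduct.smul_tmul', TensorProduct.tmul_smul,
        Algebra.TensorProduct.one_def]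
      module))
    (algHom_ext (by simp [comulHom, counitHom]))
    (algHom_ext (by simp [comulHom, counitHom]))

theorem comul_gen : Coalgebra.comul (R := O) (gen α β h) =
    gen α β h ⊗ₜ[O] 1 + 1 ⊗ₜ[O] gen α β h - β • (gen α β h ⊗ₜ[O] gen α β h) := by
  change comulHom α β h (gen α β h) = _
  simp [comulHom]

theorem counit_gen : Coalgebra.counit (R := O) (gen α β h) = 0 := by
  change counitHom α β h (gen α β h) = _
  simp [counitHom]

/-- Every point of `G_{α,β}` is its own inverse. -/
instance : HopfAlgebra O (TateOort α β h) where
  antipode := LinearMap.id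
  mul_antipode_rTensor_comul := by
    have e : (Algebra.TensorProduct.lmul' O (S := TateOort α β h)).comp (comulHom α β h) =
        (Algebra.ofId O _).comp (counitHom α β h) := algHom_ext (by
      simp only [AlgHom.comp_apply, comulHom, counitHom, lift_gen, map_sub, map_add, map_smul,
        Algebra.TensorProduct.lmul'_apply_tmul, mul_one, one_mul, gen_mul_gen, smul_smul, map_zero]
      have h1 : β * α = 2 := by linear_combination h
      rw [h1, two_smul, sub_self])
    rw [LinearMap.rTensor_id, LinearMap.id_comp]
    exact congr(($e).toLinearMap)
  mul_antipode_lTensor_comul := by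
    have e : (Algebra.TensorProduct.lmul' O (S := TateOort α β h)).comp (comulHom α β h) =
        (Algebra.ofId O _).comp (counitHom α β h) := algHom_ext (by
      simp only [AlgHom.comp_apply, comulHom, counitHom, lift_gen, map_sub, map_add, map_smul,
        Algebra.TensorProduct.lmul'_apply_tmul, mul_one, one_mul, gen_mul_gen, smul_smul, map_zero]
      have h1 : β * α = 2 := by linear_combination h
      rw [h1, two_smul, sub_self])
    rw [LinearMap.lTensor_id, LinearMap.id_comp]
    exact congr(($e).toLinearMap)

theorem monic : (Polynomial.X ^ 2 - Polynomial.C α * Polynomial.X : Polynomial O).Monic := by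
  monicity!

/-- The coefficient of `X` with respect to the basis `1, X`. -/
def coordX : TateOort α β h →ₗ[O] O :=
  Polynomial.lcoeff O 1 ∘ₗ AdjoinRoot.modByMonicHom (monic α)

theorem coordX_gen : coordX α β h (gen α β h) = 1 := by
  nontriviality O
  have hm := monic α
  have hd : (Polynomial.X : Polynomial O).degree <
      (Polynomial.X ^ 2 - Polynomial.C α * Polynomial.X : Polynomial O).degree := by
    have : (Polynomial.X ^ 2 - Polynomial.C α * Polynomial.X : Polynomial O).degree = 2 := by
      compute_degree!
    rw [this, Polynomial.degree_X]
    norm_num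
  have e : AdjoinRoot.modByMonicHom hm (AdjoinRoot.mk _ Polynomial.X) = Polynomial.X := by
    rw [AdjoinRoot.modByMonicHom_mk, (Polynomial.modByMonic_eq_self_iff hm).2 hd]
  change (AdjoinRoot.modByMonicHom hm (AdjoinRoot.mk _ Polynomial.X)).coeff 1 = 1
  rw [e, Polynomial.coeff_X_one]

theorem coordX_one : coordX α β h 1 = 0 := by
  nontriviality O
  have hm := monic α
  have hd : (1 : Polynomial O).degree <
      (Polynomial.X ^ 2 - Polynomial.C α * Polynomial.X : Polynomial O).degree := by
    have : (Polynomial.X ^ 2 - Polynomial.C α * Polynomial.X : Polynomial O).degree = 2 := by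
      compute_degree!
    rw [this, Polynomial.degree_one]
    norm_num
  have e : AdjoinRoot.modByMonicHom hm (AdjoinRoot.mk _ 1) = 1 := by
    rw [AdjoinRoot.modByMonicHom_mk, (Polynomial.modByMonic_eq_self_iff hm).2 hd]
  change (AdjoinRoot.modByMonicHom hm (AdjoinRoot.mk _ 1)).coeff 1 = 0
  rw [e, Polynomial.coeff_one]
  simp

theorem eq_counit_add_coordX (r : TateOort α β h) :
    r = Coalgebra.counit (R := O) r • 1 + coordX α β h r • gen α β h := by
  cases subsingleton_or_nontrivial O
  · have := Module.subsingleton O (TateOort α β h)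
    exact Subsingleton.elim _ _
  have hm := monic α
  have hd : (Polynomial.X ^ 2 - Polynomial.C α * Polynomial.X : Polynomial O).natDegree = 2 := by
    compute_degree!
  have key : ∃ c d : O, r = c • 1 + d • gen α β h := by
    obtain ⟨p, rfl⟩ := AdjoinRoot.mk_surjective r
    set q := p %ₘ (Polynomial.X ^ 2 - Polynomial.C α * Polynomial.X) with hq
    have e : AdjoinRoot.mk (Polynomial.X ^ 2 - Polynomial.C α * Polynomial.X) p =
        AdjoinRoot.mk _ q := by
      rw [hq, AdjoinRoot.mk_eq_mk]
      exact ⟨p /ₘ _, by rw [sub_eq_iff_eq_add, add_comm, Polynomial.modByMonic_add_div]⟩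
    have hqd : q.natDegree ≤ 1 := by
      have := Polynomial.natDegree_modByMonic_lt p hm (by
        intro h1; rw [h1] at hd; simp at hd)
      rw [hd] at this
      exact Nat.lt_succ_iff.1 this
    refine ⟨q.coeff 0, q.coeff 1, ?_⟩
    refine e.trans ?_
    conv_lhs => rw [Polynomial.eq_X_add_C_of_natDegree_le_one hqd]
    rw [map_add, map_mul, add_comm, Algebra.smul_def, Algebra.smul_def, mul_one]
    rfl
  obtain ⟨c, d, rfl⟩ := key
  simp [coordX_gen, coordX_one, counit_gen]

end TateOort

/-! ## Actions on affine schemes -/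

/-- An action of the affine group (monoid) scheme `Spec H` on `Spec S` over `O`: a coaction
`ρ : S → H ⊗ S` by an algebra homomorphism, counital and coassociative. -/
structure AffineAction (O H S : Type*) [CommRing O] [CommRing H] [Bialgebra O H]
    [CommRing S] [Algebra O S] where
  /-- The coaction. -/
  coact : S →ₐ[O] H ⊗[O] S
  counit_coact : ∀ s, TensorProduct.lid O S
    (LinearMap.rTensor S (Coalgebra.counit (R := O) (A := H)) (coact s)) = s
  coassoc : ∀ s, TensorProduct.assoc O H H S
    (LinearMap.rTensor S (Coalgebra.comul (R := O) (A := H)) (coact s)) =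
      LinearMap.lTensor H coact.toLinearMap (coact s)

/-- The subalgebra of invariants: the elements `s` with `ρ s = 1 ⊗ s`. -/
def AffineAction.invariants {O H S : Type*} [CommRing O] [CommRing H] [Bialgebra O H]
    [CommRing S] [Algebra O S] (A : AffineAction O H S) : Subalgebra O S :=
  AlgHom.equalizer A.coact Algebra.TensorProduct.includeRight

/-- An action of `G_{α,β}` on `Spec S`. -/
abbrev TateOortAction {O : Type*} [CommRing O] (α β : O) (h : α * β = 2)
    (S : Type*) [CommRing S] [Algebra O S] : Type _ :=
  AffineAction O (TateOort α β h) S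

namespace TateOortAction

open TateOort

variable {O : Type*} [CommRing O] {α β : O} {h : α * β = 2}
variable {S : Type*} [CommRing S] [Algebra O S]

/-- The `O`-linear map `δ` such that the coaction is `s ↦ 1 ⊗ s + X ⊗ δ s`. -/
def δ (A : TateOortAction α β h S) : S →ₗ[O] S :=
  (TensorProduct.lid O S).toLinearMap ∘ₗ LinearMap.rTensor S (coordX α β h) ∘ₗ
    A.coact.toLinearMap

theorem tensor_eq (t : TateOort α β h ⊗[O] S) :
    t = 1 ⊗ₜ TensorProduct.lid O S
        (LinearMap.rTensor S (Coalgebra.counit (R := O) (A := TateOort α β h)) t) +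
      gen α β h ⊗ₜ TensorProduct.lid O S (LinearMap.rTensor S (coordX α β h) t) := by
  induction t with
  | zero => simp
  | add x y hx hy =>
    conv_lhs => rw [hx, hy]
    simp only [map_add, TensorProduct.tmul_add]
    abel
  | tmul r s =>
    conv_lhs => rw [eq_counit_add_coordX α β h r]
    simp [TensorProduct.add_tmul, TensorProduct.smul_tmul]

theorem coact_eq (A : TateOortAction α β h S) (s : S) :
    A.coact s = 1 ⊗ₜ s + gen α β h ⊗ₜ A.δ s := by
  conv_lhs => rw [tensor_eq (A.coact s), A.counit_coact]
  rfl

theorem δ_one (A : TateOortAction α β h S) : A.δ 1 = 0 := by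
  simp [δ, Algebra.TensorProduct.one_def, coordX_one]

theorem δ_mul (A : TateOortAction α β h S) (s t : S) :
    A.δ (s * t) = A.δ s * t + s * A.δ t + α • (A.δ s * A.δ t) := by
  conv_lhs => rw [δ]
  rw [LinearMap.comp_apply, LinearMap.comp_apply, AlgHom.toLinearMap_apply, map_mul,
    coact_eq, coact_eq]
  simp [add_mul, mul_add, gen_mul_gen, coordX_one, coordX_gen]
  abel

theorem δ_δ (A : TateOortAction α β h S) (s : S) : A.δ (A.δ s) = -(β • A.δ s) := by
  let φ : TateOort α β h ⊗[O] (TateOort α β h ⊗[O] S) →ₗ[O] S :=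
    (TensorProduct.lid O S).toLinearMap ∘ₗ LinearMap.rTensor S (coordX α β h) ∘ₗ
      (TensorProduct.lid O _).toLinearMap ∘ₗ LinearMap.rTensor _ (coordX α β h)
  have e := congrArg φ (A.coassoc s)
  simp [φ, coact_eq, comul_gen, coordX_one, coordX_gen, TensorProduct.add_tmul,
    TensorProduct.sub_tmul, Algebra.TensorProduct.one_def, TensorProduct.tmul_add,
    ← TensorProduct.smul_tmul'] at e
  exact e.symm

/-- The action with coaction `s ↦ 1 ⊗ s + X ⊗ d s`. -/
def ofDelta (d : S →ₗ[O] S) (h1 : d 1 = 0)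
    (hm : ∀ s t, d (s * t) = d s * t + s * d t + α • (d s * d t))
    (hd : ∀ s, d (d s) = -(β • d s)) : TateOortAction α β h S where
  coact := AlgHom.ofLinearMap
    (TensorProduct.mk O (TateOort α β h) S 1 + TensorProduct.mk O _ S (gen α β h) ∘ₗ d)
    (by simp [h1, Algebra.TensorProduct.one_def])
    (by
      intro s t
      simp [hm, add_mul, mul_add, gen_mul_gen, TensorProduct.tmul_add,
        ← TensorProduct.smul_tmul']
      abel)
  counit_coact s := by simp [counit_gen]
  coassoc s := by
    simp [hd, comul_gen, TensorProduct.add_tmul, TensorProduct.sub_tmul,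
      Algebra.TensorProduct.one_def, ← TensorProduct.smul_tmul', TensorProduct.tmul_neg]
    abel

@[simp]
theorem δ_ofDelta (d : S →ₗ[O] S) (h1 : d 1 = 0)
    (hm : ∀ s t, d (s * t) = d s * t + s * d t + α • (d s * d t))
    (hd : ∀ s, d (d s) = -(β • d s)) : (ofDelta (h := h) d h1 hm hd).δ = d := by
  ext s
  simp [δ, ofDelta, coordX_one, coordX_gen]

/-- Base change of an action along `O → K`: the action of `G_{α,β} ⊗ K` on `K ⊗ S` whose
coaction is `K ⊗ ρ`, so that its `δ` is `K ⊗ δ`. -/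
def baseChange (K : Type*) [CommRing K] [Algebra O K] (A : TateOortAction α β h S) :
    TateOortAction (algebraMap O K α) (algebraMap O K β)
      (by rw [← map_mul, h, map_ofNat]) (K ⊗[O] S) :=
  ofDelta (A.δ.baseChange K)
    (by simp [Algebra.TensorProduct.one_def, δ_one])
    (by
      intro s t
      induction s with
      | zero => simp
      | add s₁ s₂ h₁ h₂ => simp only [add_mul, map_add, h₁, h₂, smul_add]; abel
      | tmul c s =>
        induction t with
        | zero => simp
        | add t₁ t₂ h₁ h₂ => simp only [mul_add, map_add, h₁, h₂, smul_add]; abel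
        | tmul c' t =>
          simp [δ_mul, TensorProduct.tmul_add, TensorProduct.tmul_smul])
    (by
      intro s
      induction s with
      | zero => simp
      | add s₁ s₂ h₁ h₂ => simp only [map_add, h₁, h₂, smul_add, neg_add]
      | tmul c s =>
        simp [δ_δ, TensorProduct.tmul_neg, TensorProduct.tmul_smul])

/-- Transport of an action along an isomorphism of algebras. -/
def congr {T : Type*} [CommRing T] [Algebra O T] (e : S ≃ₐ[O] T) (A : TateOortAction α β h S) :
    TateOortAction α β h T :=
  ofDelta (e.toLinearMap ∘ₗ A.δ ∘ₗ e.symm.toLinearMap)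
    (by simp [δ_one]) (by simp [δ_mul]) (by simp [δ_δ])

/-- The ideal of the fixed locus: generated by the image of `δ`. -/
def fixedIdeal (A : TateOortAction α β h S) : Ideal S := Ideal.span (Set.range A.δ)

/-- The fixed locus as a closed subset of `Spec S`. -/
def fixedLocus (A : TateOortAction α β h S) : Set (PrimeSpectrum S) :=
  PrimeSpectrum.zeroLocus (A.fixedIdeal : Set S)

end TateOortAction

/-! ## The special fiber of an action on a ring of formal power series -/

/-- For a local PID `O` with residue field `k`, reduction of coefficients identifies
`k ⊗ O[[σ]]` with `k[[σ]]`. -/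
def residueTensorHom (O σ : Type*) [CommRing O] [IsLocalRing O] :
    IsLocalRing.ResidueField O ⊗[O] MvPowerSeries σ O →ₐ[IsLocalRing.ResidueField O]
      MvPowerSeries σ (IsLocalRing.ResidueField O) :=
  Algebra.TensorProduct.lift (Algebra.ofId _ _)
    (MvPowerSeries.mapAlgHom (Algebra.ofId O (IsLocalRing.ResidueField O)))
    (fun _ _ => Commute.all _ _)

theorem residueTensorHom_one_tmul (O σ : Type*) [CommRing O] [IsLocalRing O]
    (f : MvPowerSeries σ O) :
    residueTensorHom O σ (1 ⊗ₜ f) = MvPowerSeries.map (IsLocalRing.residue O) f := by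
  simp [residueTensorHom]
  rfl

theorem residueTensorHom_bijective (O σ : Type*) [CommRing O] [IsDomain O]
    [IsPrincipalIdealRing O] [IsLocalRing O] :
    Function.Bijective (residueTensorHom O σ) := by
  have hsurj : ∀ t : IsLocalRing.ResidueField O ⊗[O] MvPowerSeries σ O,
      ∃ f : MvPowerSeries σ O, t = 1 ⊗ₜ f := by
    intro t
    induction t with
    | zero => exact ⟨0, by simp⟩
    | add t₁ t₂ h₁ h₂ =>
      obtain ⟨f, rfl⟩ := h₁
      obtain ⟨g, rfl⟩ := h₂
      exact ⟨f + g, by rw [TensorProduct.tmul_add]⟩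
    | tmul c f =>
      obtain ⟨c, rfl⟩ := IsLocalRing.residue_surjective c
      refine ⟨c • f, ?_⟩
      rw [← TensorProduct.smul_tmul, Algebra.smul_def, mul_one]
      rfl
  constructor
  · rw [injective_iff_map_eq_zero]
    intro t ht
    obtain ⟨f, rfl⟩ := hsurj t
    rw [residueTensorHom_one_tmul] at ht
    obtain ⟨π, hπ⟩ := (IsPrincipalIdealRing.principal (IsLocalRing.maximalIdeal O)).principal
    have hc : ∀ n, ∃ c : O, MvPowerSeries.coeff n f = π * c := by
      intro n
      have hn := congrArg (MvPowerSeries.coeff n) ht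
      rw [MvPowerSeries.coeff_map, map_zero, IsLocalRing.residue_eq_zero_iff, hπ,
        Submodule.mem_span_singleton] at hn
      obtain ⟨c, hc⟩ := hn
      exact ⟨c, by rw [← hc, smul_eq_mul, mul_comm]⟩
    choose g hg using hc
    have hfg : f = π • (show MvPowerSeries σ O from g) := by
      ext n
      rw [hg n]
      rfl
    have hπ0 : π • (1 : IsLocalRing.ResidueField O) = 0 := by
      rw [Algebra.smul_def, mul_one]
      change IsLocalRing.residue O π = 0
      rw [IsLocalRing.residue_eq_zero_iff, hπ]
      exact Submodule.mem_span_singleton_self π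
    rw [hfg, ← TensorProduct.smul_tmul, hπ0, TensorProduct.zero_tmul]
  · intro f
    choose g hg using fun n => IsLocalRing.residue_surjective (MvPowerSeries.coeff n f)
    refine ⟨1 ⊗ₜ (show MvPowerSeries σ O from g), ?_⟩
    rw [residueTensorHom_one_tmul]
    ext n
    rw [MvPowerSeries.coeff_map, ← hg n]
    rfl

/-- The identification `k ⊗ O[[σ]] = k[[σ]]`. -/
def residueTensorEquiv (O σ : Type*) [CommRing O] [IsDomain O]
    [IsPrincipalIdealRing O] [IsLocalRing O] :
    IsLocalRing.ResidueField O ⊗[O] MvPowerSeries σ O ≃ₐ[IsLocalRing.ResidueField O]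
      MvPowerSeries σ (IsLocalRing.ResidueField O) :=
  AlgEquiv.ofBijective (residueTensorHom O σ) (residueTensorHom_bijective O σ)

namespace TateOortAction

variable {O : Type*} [CommRing O] [IsDomain O] [IsPrincipalIdealRing O] [IsLocalRing O]
variable {α β : O} {h : α * β = 2} {σ : Type*}

/-- The action of the special fiber `G ⊗ k` on `k[[σ]] = k ⊗ O[[σ]]`. -/
def specialFiber (A : TateOortAction α β h (MvPowerSeries σ O)) :
    TateOortAction (algebraMap O (IsLocalRing.ResidueField O) α)
      (algebraMap O (IsLocalRing.ResidueField O) β) (by rw [← map_mul, h, map_ofNat])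
      (MvPowerSeries σ (IsLocalRing.ResidueField O)) :=
  (A.baseChange (IsLocalRing.ResidueField O)).congr (residueTensorEquiv O σ)

theorem specialFiber_δ_map (A : TateOortAction α β h (MvPowerSeries σ O))
    (f : MvPowerSeries σ O) :
    A.specialFiber.δ (MvPowerSeries.map (IsLocalRing.residue O) f) =
      MvPowerSeries.map (IsLocalRing.residue O) (A.δ f) := by
  have e : (residueTensorEquiv O σ).symm (MvPowerSeries.map (IsLocalRing.residue O) f) =
      1 ⊗ₜ f := by
    rw [AlgEquiv.symm_apply_eq]
    exact (residueTensorHom_one_tmul O σ f).symm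
  simp only [specialFiber, congr, baseChange, δ_ofDelta, LinearMap.comp_apply,
    AlgEquiv.toLinearMap_apply, e, LinearMap.baseChange_tmul]
  exact residueTensorHom_one_tmul O σ (A.δ f)

/-- The action of the generic fiber `G ⊗ Frac O` on `Frac O ⊗ O[[σ]]`. -/
def genericFiber (A : TateOortAction α β h (MvPowerSeries σ O)) :
    TateOortAction (algebraMap O (FractionRing O) α) (algebraMap O (FractionRing O) β)
      (by rw [← map_mul, h, map_ofNat]) (FractionRing O ⊗[O] MvPowerSeries σ O) :=
  A.baseChange (FractionRing O)

end TateOortAction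

/-! ## The group schemes `α₂` and `μ₂` -/

/-- `Spec H` is isomorphic, as a group scheme over `k`, to `α₂`, the spectrum of `k[X] / (X ^ 2)`
with `X` primitive (this is `G_{0,0}`, which forces `2 = 0` in `k`). -/
def IsAlphaTwo (k H : Type*) [CommRing k] [CommRing H] [Bialgebra k H] : Prop :=
  ∃ h : (0 : k) * 0 = 2, Nonempty (H ≃ₐc[k] TateOort (0 : k) 0 h)

/-- `Spec H` is isomorphic, as a group scheme over `k`, to `μ₂`, the spectrum of the group
algebra of `ℤ / 2`. -/
def IsMuTwo (k H : Type*) [CommRing k] [CommRing H] [Bialgebra k H] : Prop :=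
  Nonempty (H ≃ₐc[k] MonoidAlgebra k (Multiplicative (ZMod 2)))

/-! ## Tyurina number -/

/-- The ideal generated by `f` and its partial derivatives. -/
def tyurinaIdeal {k : Type*} [Field k] {n : ℕ} (f : MvPowerSeries (Fin n) k) :
    Ideal (MvPowerSeries (Fin n) k) :=
  Ideal.span (insert f (Set.range fun i => MvPowerSeries.pderiv k i f))

/-- The Tyurina number of the hypersurface singularity `k[[x₁, …, xₙ]] / (f)`; a junk value `0`
if the Tyurina algebra is infinite-dimensional. -/
def tyurinaNumber {k : Type*} [Field k] {n : ℕ} (f : MvPowerSeries (Fin n) k) : ℕ :=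
  Module.finrank k (MvPowerSeries (Fin n) k ⧸ tyurinaIdeal f)

end

/-! Write S = O[[u,v]], V = (u,v), m for the maximal ideal of S, T = β + δ and N(s) = s·conj s. From
δ² = -βδ and αβ = 2, T and N take invariant values, δ and T are linear over the invariants, and
every s satisfies s² - αT(s)s + N(s) = 0. Here x = N(u), y = N(v), z = T(u·conj v), a = T(u), b =
T(v), and z = av + bu - βuv. The relation F(x,y,z) = 0 is then a polynomial identity modulo αβ = 2
(`TateOortAction.equation`).

Isolatedness of the fixed point enters twice. First, a and b lie in mV: if a trace had a linear term
on the special fiber, it would be an invariant coordinate, and a single equation would cut out the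
fixed point there (`trace_mem_varIdeal_sq`). So x and y are -u² and -v² up to mV², and S is free
over O[[x,y]] on 1, u, v, uv (`exists_subst_four_of_quadratic`, `eq_zero_of_sum_subst_four`).
Second, the relations between δu and δv are the Koszul ones (`FixesOrigin.koszul`). For an invariant
f = c₀ + c₁u + c₂v + c₃uv, the equation δf = 0 is such a relation, which forces f = c₀ + T(w·u·conj
v) (`exists_eq_add_trace`). Expanding w and iterating gives S^G = O[[x,y]] ⊕ O[[x,y]]z
(`exists_eq_add_mul_trace`, `eq_zero_of_add_mul_trace`); division by F, which is quadratic in z,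
gives the presentation.

In part 2, α vanishes in k, so over k one has x = u² and y = v², and the Tyurina ideal is (F, b² -
β²y, a² - β²x). For α₂ it is (F, a², b²), where a² and b² are δu and δv with Frobenius applied to
their coefficients, read as series in x, y. Since S^G has basis 1, z over k[[x,y]], τ is twice the
degree of the fixed locus. For μ₂, β is a unit, the ideal is (x, y, z²), and the fixed ideal is V.
The degree on the generic fiber comes from lifting a basis of the special fiber by π-adic
approximation, with the Koszul property giving independence (`isBasisMod_fixedIdeal`). -/

noncomputable section

/-! ### Order filtration on power series and successive approximation. -/

namespace MvPowerSeries

variable {σ R : Type*} [CommRing R]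

/-- The ideal of a power series ring generated by the variables. -/
def varIdeal (σ R : Type*) [CommRing R] : Ideal (MvPowerSeries σ R) := Ideal.span (Set.range X)

theorem X_mem_varIdeal (i : σ) : (X i : MvPowerSeries σ R) ∈ varIdeal σ R :=
  Ideal.subset_span ⟨i, rfl⟩

/-- The ideal of the power series of order at least `n`. -/
def orderIdeal (σ R : Type*) [CommRing R] (n : ℕ) : Ideal (MvPowerSeries σ R) where
  carrier := {f | ∀ d : σ →₀ ℕ, d.degree < n → coeff d f = 0}
  add_mem' hf hg d hd := by rw [map_add, hf d hd, hg d hd, add_zero]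
  zero_mem' d _ := by simp
  smul_mem' c f hf d hd := by
    classical
    rw [smul_eq_mul, coeff_mul]
    refine Finset.sum_eq_zero fun p hp => ?_
    rw [Finset.HasAntidiagonal.mem_antidiagonal] at hp
    rw [hf p.2, mul_zero]
    rw [← hp, map_add] at hd
    omega

theorem mem_orderIdeal {n : ℕ} {f : MvPowerSeries σ R} :
    f ∈ orderIdeal σ R n ↔ ∀ d : σ →₀ ℕ, d.degree < n → coeff d f = 0 := Iff.rfl

theorem mul_mem_orderIdeal {m n : ℕ} {f g : MvPowerSeries σ R} (hf : f ∈ orderIdeal σ R m)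
    (hg : g ∈ orderIdeal σ R n) : f * g ∈ orderIdeal σ R (m + n) := by
  classical
  intro d hd
  rw [coeff_mul]
  refine Finset.sum_eq_zero fun p hp => ?_
  rw [Finset.HasAntidiagonal.mem_antidiagonal] at hp
  rw [← hp, map_add] at hd
  by_cases h1 : p.1.degree < m
  · rw [hf _ h1, zero_mul]
  · rw [hg _ (by omega), mul_zero]

theorem varIdeal_pow_le_orderIdeal (n : ℕ) : varIdeal σ R ^ n ≤ orderIdeal σ R n := by
  induction n with
  | zero => intro f _ d hd; omega
  | succ n ih =>
    rw [pow_succ, Ideal.mul_le]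
    intro f hf g hg
    refine mul_mem_orderIdeal (ih hf) ?_
    refine (Ideal.span_le.2 ?_ : varIdeal σ R ≤ _) hg
    rintro _ ⟨i, rfl⟩ d hd
    have : d = 0 := by
      rw [← Finsupp.degree_eq_zero_iff]; omega
    rw [this, coeff_zero_X]

theorem coeff_X_mul' (i : σ) (f : MvPowerSeries σ R) (d : σ →₀ ℕ) [Decidable (d i = 0)] :
    coeff d (X i * f) = if d i = 0 then 0 else coeff (d - Finsupp.single i 1) f := by
  classical
  rw [X, coeff_monomial_mul]
  have : Finsupp.single i 1 ≤ d ↔ d i ≠ 0 := by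
    rw [Finsupp.single_le_iff]; omega
  by_cases h : d i = 0 <;> simp [this, h]

/-- A choice function `w` assigns to each nonzero exponent a variable occurring in it; `g i`
collects the monomials assigned to `i`, divided by `X i`. No monomial is counted twice. -/
theorem exists_eq_sum_X_mul [Fintype σ] {n : ℕ} {f : MvPowerSeries σ R}
    (hf : f ∈ orderIdeal σ R (n + 1)) :
    ∃ g : σ → MvPowerSeries σ R, (∀ i, g i ∈ orderIdeal σ R n) ∧ f = ∑ i, X i * g i := by
  classical
  have hex : ∀ d : σ →₀ ℕ, d ≠ 0 → ∃ i, d i ≠ 0 := fun d hd => by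
    by_contra! h; exact hd (Finsupp.ext h)
  rcases isEmpty_or_nonempty σ with hσ | hσ
  · refine ⟨0, by simp, ?_⟩
    ext d
    simpa [Subsingleton.elim d 0] using hf 0 (by simp)
  choose! w hw using hex
  obtain ⟨G, hG⟩ : ∃ G : σ → MvPowerSeries σ R, ∀ i e, coeff e (G i) =
      if w (e + Finsupp.single i 1) = i then coeff (e + Finsupp.single i 1) f else 0 :=
    ⟨fun i e => if w (e + Finsupp.single i 1) = i then coeff (e + Finsupp.single i 1) f else 0,
      fun _ _ => rfl⟩
  have hsub : ∀ (d : σ →₀ ℕ) i, d i ≠ 0 → d - Finsupp.single i 1 + Finsupp.single i 1 = d :=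
    fun d i h => tsub_add_cancel_of_le (by
      rw [Finsupp.single_le_iff]; exact Nat.one_le_iff_ne_zero.2 h)
  refine ⟨G, fun i d hd => ?_, ?_⟩
  · rw [hG]
    split_ifs
    · exact hf _ (by rw [map_add, Finsupp.degree_single]; omega)
    · rfl
  · ext d
    rw [map_sum]
    simp only [coeff_X_mul']
    by_cases hd : d = 0
    · subst hd
      simpa using hf 0 (by simp)
    rw [Finset.sum_eq_single (w d)]
    · rw [if_neg (hw d hd), hG, hsub d _ (hw d hd), if_pos rfl]
    · intro i _ hi
      split_ifs with h
      · rfl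
      rw [hG, hsub d i h, if_neg (Ne.symm hi)]
    · simp

theorem varIdeal_pow_eq [Finite σ] (n : ℕ) : varIdeal σ R ^ n = orderIdeal σ R n := by
  have := Fintype.ofFinite σ
  refine le_antisymm (varIdeal_pow_le_orderIdeal n) ?_
  induction n with
  | zero => simp
  | succ n ih =>
    intro f hf
    obtain ⟨g, hg, rfl⟩ := exists_eq_sum_X_mul hf
    rw [pow_succ']
    exact sum_mem fun i _ => Ideal.mul_mem_mul (X_mem_varIdeal i) (ih (hg i))

theorem mem_varIdeal_pow_iff [Finite σ] {n : ℕ} {f : MvPowerSeries σ R} :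
    f ∈ varIdeal σ R ^ n ↔ ∀ d : σ →₀ ℕ, d.degree < n → coeff d f = 0 := by
  rw [varIdeal_pow_eq, mem_orderIdeal]

theorem mem_varIdeal_iff [Finite σ] {f : MvPowerSeries σ R} :
    f ∈ varIdeal σ R ↔ constantCoeff f = 0 := by
  rw [← pow_one (varIdeal σ R), mem_varIdeal_pow_iff]
  simp [Finsupp.degree_eq_zero_iff]

theorem eq_zero_of_forall_mem_varIdeal_pow [Finite σ] {f : MvPowerSeries σ R}
    (hf : ∀ n, f ∈ varIdeal σ R ^ n) : f = 0 := by
  ext d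
  exact mem_varIdeal_pow_iff.1 (hf (d.degree + 1)) d (by omega)

theorem sub_C_mem_varIdeal [Finite σ] (f : MvPowerSeries σ R) :
    f - C (constantCoeff f) ∈ varIdeal σ R := by
  rw [mem_varIdeal_iff]; simp

theorem varIdeal_le_maximalIdeal [Finite σ] [IsLocalRing R] :
    varIdeal σ R ≤ IsLocalRing.maximalIdeal (MvPowerSeries σ R) := by
  intro f hf
  rw [mem_varIdeal_iff] at hf
  rw [IsLocalRing.mem_maximalIdeal, mem_nonunits_iff, isUnit_iff_constantCoeff, hf]
  simp

theorem varIdeal_fg [Finite σ] : (varIdeal σ R).FG := 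
  ⟨(Set.finite_range X).toFinset, by simp [varIdeal]⟩

instance varIdeal_isPrecomplete [Finite σ] :
    IsPrecomplete (varIdeal σ R) (MvPowerSeries σ R) :=
  inferInstanceAs (IsPrecomplete (Ideal.span (Set.range X)) _)

/-- Substitution maps power series of high order to power series of high order. -/
theorem subst_mem_varIdeal_pow {τ : Type*} [Finite σ] [Finite τ] {t : σ → MvPowerSeries τ R}
    (ht : ∀ i, t i ∈ varIdeal τ R) {n : ℕ} {f : MvPowerSeries σ R} (hf : f ∈ varIdeal σ R ^ n) :
    subst t f ∈ varIdeal τ R ^ n := by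
  have hs : HasSubst t := hasSubst_of_constantCoeff_zero fun i => mem_varIdeal_iff.1 (ht i)
  have h1 : Ideal.map (substAlgHom hs : MvPowerSeries σ R →ₐ[R] _) (varIdeal σ R) ≤
      varIdeal τ R := by
    rw [varIdeal, Ideal.map_span, Ideal.span_le]
    rintro _ ⟨_, ⟨i, rfl⟩, rfl⟩
    rw [substAlgHom_X]
    exact ht i
  have h2 := Ideal.mem_map_of_mem (substAlgHom hs : MvPowerSeries σ R →ₐ[R] _) hf
  rw [Ideal.map_pow] at h2
  rw [← substAlgHom_apply hs]
  exact Ideal.pow_right_mono h1 n h2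

theorem exists_series_sum [Finite σ] (c : ℕ → MvPowerSeries σ R)
    (hc : ∀ n, c n ∈ varIdeal σ R ^ n) :
    ∃ s, ∀ n, s - ∑ i ∈ Finset.range n, c i ∈ varIdeal σ R ^ n := by
  obtain ⟨L, hL⟩ := IsPrecomplete.prec (I := varIdeal σ R) inferInstance
    (f := fun n => ∑ i ∈ Finset.range n, c i) (by
      intro m n hmn
      rw [SModEq.sub_mem, ← neg_mem_iff, neg_sub, smul_eq_mul, Ideal.mul_top,
        ← Finset.sum_range_add_sum_Ico _ hmn, add_sub_cancel_left]
      exact sum_mem fun i hi => Ideal.pow_le_pow_right (Finset.mem_Ico.1 hi).1 (hc i))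
  refine ⟨L, fun n => ?_⟩
  have := hL n
  rwa [SModEq.sub_mem, ← neg_mem_iff, neg_sub, smul_eq_mul, Ideal.mul_top] at this

/-- If every element of `M` is an `R`-linear combination of the `e i` up to a combination of
topologically nilpotent elements `t j` with coefficients in `M`, then every element of `M` is a
combination of the `e i` with coefficients power series in the `t j`. -/
theorem exists_eq_sum_subst {ι κ τ : Type*} [Fintype ι] [Fintype κ] [Finite τ]
    {t : κ → MvPowerSeries τ R} (ht : ∀ j, t j ∈ varIdeal τ R) (e : ι → MvPowerSeries τ R)
    (M : Set (MvPowerSeries τ R))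
    (hM : ∀ f ∈ M, ∃ (c : ι → R) (g : κ → MvPowerSeries τ R), (∀ j, g j ∈ M) ∧
      f = ∑ i, C (c i) * e i + ∑ j, t j * g j)
    {f : MvPowerSeries τ R} (hf : f ∈ M) :
    ∃ c : ι → MvPowerSeries κ R, f = ∑ i, subst t (c i) * e i := by
  have hs : HasSubst t := hasSubst_of_constantCoeff_zero fun i => mem_varIdeal_iff.1 (ht i)
  -- `N k` consists of the `k`-fold iterated combinations of the `t j` with coefficients in `M`.
  -- Recording this, rather than mere membership in the `k`-th power, is what allows `hM` to be
  -- applied again to the remainders.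
  let N : ℕ → Set (MvPowerSeries τ R) := fun k => Nat.rec M
    (fun _ Q => {h | ∃ g : κ → MvPowerSeries τ R, (∀ j, g j ∈ Q) ∧ h = ∑ j, t j * g j}) k
  have hN : ∀ k h, h ∈ N k → h ∈ varIdeal τ R ^ k := by
    intro k
    induction k with
    | zero => simp
    | succ k ih =>
      rintro h ⟨g, hg, rfl⟩
      rw [pow_succ']
      exact sum_mem fun j _ => Ideal.mul_mem_mul (ht j) (ih _ (hg j))
  have step : ∀ k h, h ∈ N k → ∃ (c : ι → MvPowerSeries κ R) (h' : MvPowerSeries τ R),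
      (∀ i, c i ∈ varIdeal κ R ^ k) ∧ h' ∈ N (k + 1) ∧ h = ∑ i, subst t (c i) * e i + h' := by
    intro k
    induction k with
    | zero =>
      intro h hh
      obtain ⟨c, g, hg, rfl⟩ := hM h hh
      exact ⟨fun i => C (c i), _, by simp, ⟨g, hg, rfl⟩, by simp [subst_C]⟩
    | succ k ih =>
      rintro h ⟨g, hg, rfl⟩
      choose c g' hc hg' hcg using fun j => ih _ (hg j)
      refine ⟨fun i => ∑ j, X j * c j i, _, fun i => ?_, ⟨g', hg', rfl⟩, ?_⟩
      · rw [pow_succ']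
        exact sum_mem fun j _ => Ideal.mul_mem_mul (X_mem_varIdeal j) (hc j i)
      · simp only [← substAlgHom_apply hs, map_sum, map_mul, substAlgHom_X] at hcg ⊢
        simp_rw [Finset.sum_mul]
        rw [Finset.sum_comm, ← Finset.sum_add_distrib]
        refine Finset.sum_congr rfl fun j _ => ?_
        conv_lhs => rw [hcg j, mul_add, Finset.mul_sum]
        simp only [mul_assoc]
  choose! c r hc hr hcr using step
  let h : ℕ → MvPowerSeries τ R := fun k => Nat.rec f (fun k h => r k h) k
  have hh : ∀ k, h k ∈ N k := by
    intro k
    induction k with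
    | zero => exact hf
    | succ k ih => exact hr k _ ih
  have hsum : ∀ n, f = ∑ i, subst t (∑ k ∈ Finset.range n, c k (h k) i) * e i + h n := by
    intro n
    induction n with
    | zero =>
      simp only [Finset.range_zero, Finset.sum_empty, ← substAlgHom_apply hs, map_zero, zero_mul,
        Finset.sum_const_zero, zero_add]
      rfl
    | succ n ih =>
      conv_lhs => rw [ih, hcr n _ (hh n)]
      simp only [← substAlgHom_apply hs, Finset.sum_range_succ, map_add, add_mul,
        Finset.sum_add_distrib]
      rw [add_assoc]
  choose s hsn using fun i => exists_series_sum (fun k => c k (h k) i) fun k => hc k _ (hh k) i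
  refine ⟨s, sub_eq_zero.1 (eq_zero_of_forall_mem_varIdeal_pow fun n => ?_)⟩
  have e1 : f - ∑ i, subst t (s i) * e i =
      h n - ∑ i, subst t (s i - ∑ k ∈ Finset.range n, c k (h k) i) * e i := by
    conv_lhs => rw [hsum n]
    simp only [← substAlgHom_apply hs, map_sub, sub_mul, Finset.sum_sub_distrib]
    ring
  rw [e1]
  exact sub_mem (hN n _ (hh n))
    (sum_mem fun i _ => Ideal.mul_mem_right _ _ (subst_mem_varIdeal_pow ht (hsn i n)))

end MvPowerSeries

/-! ### Nakayama's lemma and Koszul relations. -/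

open IsLocalRing in
theorem Ideal.le_of_le_sup_maximalIdeal_mul {R : Type*} [CommRing R] [IsLocalRing R]
    {I J : Ideal R} (hI : I.FG) (h : I ≤ J ⊔ maximalIdeal R * I) : I ≤ J :=
  Submodule.le_of_le_smul_of_le_jacobson_bot hI (maximalIdeal_le_jacobson _) h

/-- A pair generating an ideal that contains a regular sequence `s, t` is itself regular. -/
theorem exists_koszul {R : Type*} [CommRing R] [IsDomain R] {p q s t : R}
    (hs : s ∈ Ideal.span {p, q}) (ht : t ∈ Ideal.span {p, q}) (hs0 : s ≠ 0)
    (hst : ∀ h h', t * h = s * h' → s ∣ h) {f g : R} (hfg : p * f + q * g = 0) :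
    ∃ h, f = q * h ∧ g = -(p * h) := by
  obtain ⟨a, b, hab⟩ := Ideal.mem_span_pair.1 hs
  obtain ⟨c, d, hcd⟩ := Ideal.mem_span_pair.1 ht
  -- If the conclusion holds with factor `w`, then this element is `s * w` and the next one is `t *
  -- w`; so `w` is recovered by dividing by `s`, which the regularity hypothesis permits.
  set h := b * f - a * g with hh
  set h' := d * f - c * g with hh'
  have e1 : s * f = q * h := by rw [← hab, hh]; linear_combination a * hfg
  have e2 : s * g = -(p * h) := by rw [← hab, hh]; linear_combination b * hfg
  have e3 : t * f = q * h' := by rw [← hcd, hh']; linear_combination c * hfg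
  have e4 : t * g = -(p * h') := by rw [← hcd, hh']; linear_combination d * hfg
  have e5 : t * h = s * h' := by
    have k1 : q * (t * h - s * h') = 0 := by linear_combination -t * e1 + s * e3
    have k2 : p * (t * h - s * h') = 0 := by linear_combination t * e2 - s * e4
    by_contra hne
    have hne' : t * h - s * h' ≠ 0 := sub_ne_zero.2 hne
    have hq : q = 0 := (mul_eq_zero.1 k1).resolve_right hne'
    have hp : p = 0 := (mul_eq_zero.1 k2).resolve_right hne'
    apply hs0
    rw [← hab, hp, hq]
    ring
  obtain ⟨h₀, hh₀⟩ := hst h h' e5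
  refine ⟨h₀, mul_left_cancel₀ hs0 ?_, mul_left_cancel₀ hs0 ?_⟩
  · rw [e1, hh₀]; ring
  · rw [e2, hh₀]; ring

/-! ### Generation of the power series ring over the two norms. -/

namespace MvPowerSeries

open IsLocalRing

theorem map_surjective {σ R S : Type*} [CommRing R] [CommRing S] {f : R →+* S}
    (hf : Function.Surjective f) : Function.Surjective (map (σ := σ) f) := by
  intro g
  choose h hh using fun n => hf (coeff n g)
  exact ⟨show MvPowerSeries σ R from h, ext fun n => by rw [coeff_map, ← hh n]; rfl⟩

theorem map_residue_eq_zero_iff {σ R : Type*} [CommRing R] [IsLocalRing R] {π : R}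
    (hπ : maximalIdeal R = Ideal.span {π}) {f : MvPowerSeries σ R} :
    map (residue R) f = 0 ↔ ∃ g, f = C π * g := by
  constructor
  · intro h
    have hc : ∀ n, ∃ c : R, coeff n f = π * c := fun n => by
      have hn := congrArg (coeff n) h
      rw [coeff_map, map_zero, residue_eq_zero_iff, hπ, Ideal.mem_span_singleton] at hn
      exact hn
    choose g hg using hc
    exact ⟨show MvPowerSeries σ R from g, ext fun n => by rw [hg n, coeff_C_mul]; rfl⟩
  · rintro ⟨g, rfl⟩
    rw [map_mul, map_C, (residue_eq_zero_iff π).2 (hπ ▸ Ideal.mem_span_singleton_self π), map_zero,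
      zero_mul]

theorem map_varIdeal {σ R S : Type*} [CommRing R] [CommRing S] (f : R →+* S) :
    (varIdeal σ R).map (map f) = varIdeal σ S := by
  rw [varIdeal, varIdeal, Ideal.map_span, ← Set.range_comp]
  congr 2
  ext i : 1
  simp

theorem map_maximalIdeal_le {σ R : Type*} [Finite σ] [CommRing R] [IsLocalRing R] :
    (maximalIdeal (MvPowerSeries σ R)).map (map (residue R)) ≤ varIdeal σ (ResidueField R) := by
  rw [Ideal.map_le_iff_le_comap]
  intro f hf
  rw [Ideal.mem_comap, mem_varIdeal_iff, ← coeff_zero_eq_constantCoeff_apply, coeff_map,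
    residue_eq_zero_iff, coeff_zero_eq_constantCoeff_apply]
  rw [mem_maximalIdeal, mem_nonunits_iff, isUnit_iff_constantCoeff] at hf
  exact hf

theorem maximalIdeal_eq_varIdeal {σ K : Type*} [Finite σ] [Field K] :
    maximalIdeal (MvPowerSeries σ K) = varIdeal σ K := by
  ext f
  rw [mem_maximalIdeal, mem_nonunits_iff, isUnit_iff_constantCoeff, mem_varIdeal_iff,
    isUnit_iff_ne_zero, not_not]

theorem C_mem_maximalIdeal {σ R : Type*} [CommRing R] [IsLocalRing R] {r : R}
    (hr : r ∈ maximalIdeal R) : (C r : MvPowerSeries σ R) ∈ maximalIdeal _ := by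
  rw [mem_maximalIdeal, mem_nonunits_iff, isUnit_iff_constantCoeff]
  simpa using hr

/-- A series without constant term whose reduction has order at least two. -/
theorem mem_maximalIdeal_mul_varIdeal {σ R : Type*} [Finite σ] [CommRing R] [IsDomain R]
    [IsLocalRing R] {π : R} (hπ : maximalIdeal R = Ideal.span {π}) {f : MvPowerSeries σ R}
    (hf : f ∈ varIdeal σ R) (hf2 : map (residue R) f ∈ varIdeal σ (ResidueField R) ^ 2) :
    f ∈ maximalIdeal (MvPowerSeries σ R) * varIdeal σ R := by
  rw [← map_varIdeal (residue R), ← Ideal.map_pow,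
    Ideal.mem_map_iff_of_surjective _ (map_surjective residue_surjective)] at hf2
  obtain ⟨f₂, hf₂, e⟩ := hf2
  obtain ⟨g, hg⟩ := (map_residue_eq_zero_iff hπ).1 (by rw [map_sub, e, sub_self] :
    map (residue R) (f - f₂) = 0)
  rw [eq_add_of_sub_eq hg]
  rw [sq] at hf₂
  refine add_mem ?_ (Ideal.mul_mono_left varIdeal_le_maximalIdeal hf₂)
  -- In the field case the multiple of π is zero. Otherwise π cancels from the constant term, so `g`
  -- itself has none.
  by_cases h0 : π = 0
  · simp [h0]
  refine Ideal.mul_mem_mul (C_mem_maximalIdeal (hπ ▸ Ideal.mem_span_singleton_self π)) ?_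
  have hm : C π * g ∈ varIdeal σ R := by
    rw [← hg]
    exact sub_mem hf (Ideal.mul_le_left hf₂)
  rw [mem_varIdeal_iff] at hm ⊢
  simpa [h0] using hm

section Four

variable {σ O : Type*} [Finite σ] [CommRing O] [IsLocalRing O]
  {p q c d x y : MvPowerSeries σ O}

/-- Among the generators p², pq, q² of the square, p² = cp - x and q² = dq - y, where cp and dq lie
in the maximal ideal times the square. Nakayama discards them. -/
theorem varIdeal_sq_le_of_quadratic (hpq : varIdeal σ O = Ideal.span {p, q})
    (hc : c ∈ maximalIdeal (MvPowerSeries σ O) * varIdeal σ O)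
    (hd : d ∈ maximalIdeal (MvPowerSeries σ O) * varIdeal σ O)
    (hx : x = c * p - p ^ 2) (hy : y = d * q - q ^ 2) :
    varIdeal σ O ^ 2 ≤ Ideal.span {p * q} ⊔ Ideal.span {x, y} := by
  have hp : p ∈ varIdeal σ O := hpq ▸ Ideal.subset_span (by simp)
  have hq : q ∈ varIdeal σ O := hpq ▸ Ideal.subset_span (by simp)
  refine Ideal.le_of_le_sup_maximalIdeal_mul varIdeal_fg.pow ?_
  have hpq' : p * q ∈ (Ideal.span {p * q} ⊔ Ideal.span {x, y}) ⊔
      maximalIdeal (MvPowerSeries σ O) * varIdeal σ O ^ 2 :=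
    Ideal.mem_sup_left (Ideal.mem_sup_left (Ideal.mem_span_singleton_self _))
  have aux : ∀ {c p}, c ∈ maximalIdeal (MvPowerSeries σ O) * varIdeal σ O → p ∈ varIdeal σ O →
      c * p ∈ maximalIdeal (MvPowerSeries σ O) * varIdeal σ O ^ 2 := by
    intro c p hc hp
    rw [sq (varIdeal σ O), ← mul_assoc]
    exact Ideal.mul_mem_mul hc hp
  conv_lhs => rw [sq, hpq, Ideal.span_pair_mul_span_pair]
  rw [Ideal.span_le]
  intro r hr
  simp only [Set.mem_insert_iff, Set.mem_singleton_iff] at hr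
  rcases hr with rfl | rfl | rfl | rfl
  · have e : p * p = -x + c * p := by rw [hx]; ring
    rw [e]
    exact add_mem (neg_mem (Ideal.mem_sup_left (Ideal.mem_sup_right
      (Ideal.subset_span (by simp))))) (Ideal.mem_sup_right (aux hc hp))
  · exact hpq'
  · rw [mul_comm q p]; exact hpq'
  · have e : q * q = -y + d * q := by rw [hy]; ring
    rw [e]
    exact add_mem (neg_mem (Ideal.mem_sup_left (Ideal.mem_sup_right
      (Ideal.subset_span (by simp))))) (Ideal.mem_sup_right (aux hd hq))

/-- By the square case only p·pq and q·pq matter. They equal -qx + c·pq and -py + d·pq, and the last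
terms are absorbed by Nakayama. -/
theorem varIdeal_cube_le_of_quadratic (hpq : varIdeal σ O = Ideal.span {p, q})
    (hc : c ∈ maximalIdeal (MvPowerSeries σ O) * varIdeal σ O)
    (hd : d ∈ maximalIdeal (MvPowerSeries σ O) * varIdeal σ O)
    (hx : x = c * p - p ^ 2) (hy : y = d * q - q ^ 2) :
    varIdeal σ O ^ 3 ≤ Ideal.span {x, y} := by
  have hp : p ∈ varIdeal σ O := hpq ▸ Ideal.subset_span (by simp)
  have hq : q ∈ varIdeal σ O := hpq ▸ Ideal.subset_span (by simp)
  have hx' : x ∈ Ideal.span {x, y} := Ideal.subset_span (by simp)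
  have hy' : y ∈ Ideal.span {x, y} := Ideal.subset_span (by simp)
  refine Ideal.le_of_le_sup_maximalIdeal_mul varIdeal_fg.pow ?_
  have aux : ∀ c ∈ maximalIdeal (MvPowerSeries σ O) * varIdeal σ O,
      c * (p * q) ∈ maximalIdeal (MvPowerSeries σ O) * varIdeal σ O ^ 3 := by
    intro c hc
    rw [pow_succ' (varIdeal σ O), ← mul_assoc (maximalIdeal (MvPowerSeries σ O)),
      sq (varIdeal σ O)]
    exact Ideal.mul_mem_mul hc (Ideal.mul_mem_mul hp hq)
  have h2 : varIdeal σ O ^ 3 ≤ varIdeal σ O * (Ideal.span {p * q} ⊔ Ideal.span {x, y}) := by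
    rw [pow_succ']
    exact Ideal.mul_mono_right (varIdeal_sq_le_of_quadratic hpq hc hd hx hy)
  refine h2.trans ?_
  rw [Ideal.mul_sup]
  refine sup_le ?_ (le_sup_of_le_left (Ideal.mul_le.2 fun _ _ _ h => Ideal.mul_mem_left _ _ h))
  have e1 : p * (p * q) = -(q * x) + c * (p * q) := by rw [hx]; ring
  have e2 : q * (p * q) = -(p * y) + d * (p * q) := by rw [hy]; ring
  have h1 : p * (p * q) ∈ Ideal.span {x, y} ⊔
      maximalIdeal (MvPowerSeries σ O) * varIdeal σ O ^ 3 := by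
    rw [e1]
    exact add_mem (neg_mem (Ideal.mem_sup_left (Ideal.mul_mem_left _ _ hx')))
      (Ideal.mem_sup_right (aux c hc))
  have h2 : q * (p * q) ∈ Ideal.span {x, y} ⊔
      maximalIdeal (MvPowerSeries σ O) * varIdeal σ O ^ 3 := by
    rw [e2]
    exact add_mem (neg_mem (Ideal.mem_sup_left (Ideal.mul_mem_left _ _ hy')))
      (Ideal.mem_sup_right (aux d hd))
  rw [Ideal.mul_le]
  intro v hv r hr
  rw [hpq] at hv
  obtain ⟨a, b, rfl⟩ := Ideal.mem_span_pair.1 hv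
  obtain ⟨w, rfl⟩ := Ideal.mem_span_singleton'.1 hr
  have e : (a * p + b * q) * (w * (p * q)) =
      (w * a) * (p * (p * q)) + (w * b) * (q * (p * q)) := by ring
  rw [e]
  exact add_mem (Ideal.mul_mem_left _ _ h1) (Ideal.mul_mem_left _ _ h2)

/-- `1, p, q, p q` generate the power series ring over `O` modulo `x, y`. -/
theorem exists_four_of_quadratic (hpq : varIdeal σ O = Ideal.span {p, q})
    (hc : c ∈ maximalIdeal (MvPowerSeries σ O) * varIdeal σ O)
    (hd : d ∈ maximalIdeal (MvPowerSeries σ O) * varIdeal σ O)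
    (hx : x = c * p - p ^ 2) (hy : y = d * q - q ^ 2) (f : MvPowerSeries σ O) :
    ∃ (r : Fin 4 → O) (g : Fin 2 → MvPowerSeries σ O),
      f = ∑ i, C (r i) * ![1, p, q, p * q] i + ∑ j, ![x, y] j * g j := by
  have hp : p ∈ varIdeal σ O := hpq ▸ Ideal.subset_span (by simp)
  have hq : q ∈ varIdeal σ O := hpq ▸ Ideal.subset_span (by simp)
  have split : ∀ f : MvPowerSeries σ O, ∃ r g h, f = C r + p * g + q * h := by
    intro f
    have h := sub_C_mem_varIdeal f
    rw [hpq, Ideal.mem_span_pair] at h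
    obtain ⟨g, h, e⟩ := h
    exact ⟨constantCoeff f, g, h, by linear_combination -e⟩
  obtain ⟨r0, f1, f2, e0⟩ := split f
  obtain ⟨r1, f11, f12, e1⟩ := split f1
  obtain ⟨r2, f21, f22, e2⟩ := split f2
  -- The quadratic remainder is a multiple of pq modulo (x, y); subtracting the constant term of its
  -- coefficient leaves a cubic error, which is already in (x, y).
  have hm : p * (p * f11 + q * f12) + q * (p * f21 + q * f22) ∈ varIdeal σ O ^ 2 := by
    rw [sq]
    exact add_mem (Ideal.mul_mem_mul hp (add_mem (Ideal.mul_mem_right _ _ hp)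
      (Ideal.mul_mem_right _ _ hq))) (Ideal.mul_mem_mul hq (add_mem (Ideal.mul_mem_right _ _ hp)
      (Ideal.mul_mem_right _ _ hq)))
  obtain ⟨_, h1, _, h2, e3⟩ := Submodule.mem_sup.1 (varIdeal_sq_le_of_quadratic hpq hc hd hx hy hm)
  obtain ⟨w, rfl⟩ := Ideal.mem_span_singleton'.1 h1
  obtain ⟨g1, g2, rfl⟩ := Ideal.mem_span_pair.1 h2
  obtain ⟨r3, w1, w2, e4⟩ := split w
  have hm' : p * q * (p * w1 + q * w2) ∈ varIdeal σ O ^ 3 := by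
    rw [pow_succ, sq]
    exact Ideal.mul_mem_mul (Ideal.mul_mem_mul hp hq) (add_mem (Ideal.mul_mem_right _ _ hp)
      (Ideal.mul_mem_right _ _ hq))
  obtain ⟨g3, g4, e5⟩ :=
    Ideal.mem_span_pair.1 (varIdeal_cube_le_of_quadratic hpq hc hd hx hy hm')
  refine ⟨![r0, r1, r2, r3], ![g1 + g3, g2 + g4], ?_⟩
  simp [Fin.sum_univ_four]
  linear_combination e0 + p * e1 + q * e2 - e3 + p * q * e4 - e5

/-- `1, p, q, p q` generate the power series ring over `O[[x, y]]`. -/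
theorem exists_subst_four_of_quadratic (hpq : varIdeal σ O = Ideal.span {p, q})
    (hc : c ∈ maximalIdeal (MvPowerSeries σ O) * varIdeal σ O)
    (hd : d ∈ maximalIdeal (MvPowerSeries σ O) * varIdeal σ O)
    (hx : x = c * p - p ^ 2) (hy : y = d * q - q ^ 2) (f : MvPowerSeries σ O) :
    ∃ r : Fin 4 → MvPowerSeries (Fin 2) O,
      f = ∑ i, subst ![x, y] (r i) * ![1, p, q, p * q] i := by
  have hp : p ∈ varIdeal σ O := hpq ▸ Ideal.subset_span (by simp)
  have hq : q ∈ varIdeal σ O := hpq ▸ Ideal.subset_span (by simp)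
  have hxy : ∀ j, ![x, y] j ∈ varIdeal σ O := by
    simp only [Fin.forall_fin_two, Matrix.cons_val_zero, Matrix.cons_val_one]
    rw [hx, hy, sq, sq]
    exact ⟨sub_mem (Ideal.mul_mem_left _ _ hp) (Ideal.mul_mem_left _ _ hp),
      sub_mem (Ideal.mul_mem_left _ _ hq) (Ideal.mul_mem_left _ _ hq)⟩
  refine exists_eq_sum_subst hxy _ Set.univ (fun f _ => ?_) (Set.mem_univ f)
  obtain ⟨r, g, h⟩ := exists_four_of_quadratic hpq hc hd hx hy f
  exact ⟨r, g, fun _ => Set.mem_univ _, h⟩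

end Four

end MvPowerSeries

/-! ### Independence of 1, u, v, uv over the two norms. -/

namespace MvPowerSeries

open IsLocalRing

instance {σ R : Type*} [CommRing R] [IsDomain R] : IsDomain (MvPowerSeries σ R) :=
  NoZeroDivisors.to_isDomain _

theorem X_pow_dvd_of_dvd_X_pow_mul {σ R : Type*} [CommRing R] {i j : σ} (hij : i ≠ j) {m n : ℕ}
    {f : MvPowerSeries σ R} (h : X i ^ m ∣ X j ^ n * f) : X i ^ m ∣ f := by
  classical
  rw [X_pow_dvd_iff] at h ⊢
  intro d hd
  have := h (Finsupp.single j n + d) (by simp [hij.symm, hd])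
  rwa [X_pow_eq, coeff_add_monomial_mul, one_mul] at this

theorem varIdeal_two {R : Type*} [CommRing R] :
    varIdeal (Fin 2) R = Ideal.span {X 0, X 1} := by
  rw [varIdeal]
  congr 1
  ext f
  simp [Fin.exists_fin_two, eq_comm]

/-- Since c and d have order at least two, the ideal of the two series lies in (u², v²) modulo
cubes. The monomials 1, u, v, uv have degree below three and do not occur there. -/
theorem eq_zero_of_sum_four {K : Type*} [CommRing K] {c d f g : MvPowerSeries (Fin 2) K}
    (hc : c ∈ varIdeal (Fin 2) K ^ 2) (hd : d ∈ varIdeal (Fin 2) K ^ 2) {k : Fin 4 → K}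
    (h : ∑ i, C (k i) * ![1, X 0, X 1, X 0 * X 1] i + (c * X 0 - X 0 ^ 2) * f +
      (d * X 1 - X 1 ^ 2) * g = 0) : k = 0 := by
  have h3 : c * X 0 * f + d * X 1 * g ∈ varIdeal (Fin 2) K ^ 3 := by
    rw [pow_succ]
    exact add_mem (Ideal.mul_mem_right _ _ (Ideal.mul_mem_mul hc (X_mem_varIdeal _)))
      (Ideal.mul_mem_right _ _ (Ideal.mul_mem_mul hd (X_mem_varIdeal _)))
  rw [mem_varIdeal_pow_iff] at h3
  have hX : ∀ (i : Fin 2) (f : MvPowerSeries (Fin 2) K) (m : Fin 2 →₀ ℕ), m i < 2 →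
      coeff m (X i ^ 2 * f) = 0 := fun i f => X_pow_dvd_iff.1 (dvd_mul_right _ f)
  have key : ∀ m : Fin 2 →₀ ℕ, m 0 < 2 → m 1 < 2 → m.degree < 3 →
      coeff m (∑ i, C (k i) * ![1, X 0, X 1, X 0 * X 1] i) = 0 := by
    intro m h0 h1 hm
    have e : ∑ i, C (k i) * ![1, X 0, X 1, X 0 * X 1] i =
        X 0 ^ 2 * f + X 1 ^ 2 * g - (c * X 0 * f + d * X 1 * g) := by
      linear_combination h
    rw [e, map_sub, map_add, hX 0 f m h0, hX 1 g m h1, h3 m hm]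
    simp
  have hXX : (X 0 * X 1 : MvPowerSeries (Fin 2) K) =
      monomial (Finsupp.single 0 1 + Finsupp.single 1 1) 1 := by
    rw [X, X, monomial_mul_monomial, one_mul]
  simp only [Fin.sum_univ_four, map_add, coeff_C_mul, Matrix.cons_val, hXX, coeff_one, coeff_X,
    coeff_monomial] at key
  ext i
  fin_cases i
  · simpa [DFunLike.ext_iff, Fin.forall_fin_two] using key 0
  · simpa [DFunLike.ext_iff, Fin.forall_fin_two] using key (Finsupp.single 0 1)
  · simpa [DFunLike.ext_iff, Fin.forall_fin_two] using key (Finsupp.single 1 1)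
  · obtain ⟨m, hm⟩ : ∃ m : Fin 2 →₀ ℕ, m = Finsupp.single 0 1 + Finsupp.single 1 1 := ⟨_, rfl⟩
    have h0 : m 0 = 1 := by rw [hm, Finsupp.add_apply]; simp
    have h1 : m 1 = 1 := by rw [hm, Finsupp.add_apply]; simp
    have h2 : m.degree < 3 := by rw [hm, map_add]; simp
    simpa [DFunLike.ext_iff, Fin.forall_fin_two, h0, h1, h2] using key m

/-- The constant terms of a relation vanish, so it reads xf + yg = 0. As (x, y) contains u³ and v³,
this is a Koszul relation: f = yh, g = -xh. Expanding h in 1, u, v, uv and moving it between the two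
halves of each coefficient leaves the coefficient unchanged and makes both halves relations, so the
orders of the coefficients grow without bound. -/
theorem eq_zero_of_sum_subst_four_field {K : Type*} [Field K] {c d x y : MvPowerSeries (Fin 2) K}
    (hc : c ∈ varIdeal (Fin 2) K ^ 2) (hd : d ∈ varIdeal (Fin 2) K ^ 2)
    (hx : x = c * X 0 - X 0 ^ 2) (hy : y = d * X 1 - X 1 ^ 2)
    {r : Fin 4 → MvPowerSeries (Fin 2) K}
    (hr : ∑ i, subst ![x, y] (r i) * ![1, X 0, X 1, X 0 * X 1] i = 0) : r = 0 := by
  have hc' : c ∈ maximalIdeal (MvPowerSeries (Fin 2) K) * varIdeal (Fin 2) K := by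
    rwa [maximalIdeal_eq_varIdeal, ← sq]
  have hd' : d ∈ maximalIdeal (MvPowerSeries (Fin 2) K) * varIdeal (Fin 2) K := by
    rwa [maximalIdeal_eq_varIdeal, ← sq]
  have hxV : x ∈ varIdeal (Fin 2) K := by
    rw [hx, sq]
    exact sub_mem (Ideal.mul_mem_left _ _ (X_mem_varIdeal _))
      (Ideal.mul_mem_left _ _ (X_mem_varIdeal _))
  have hyV : y ∈ varIdeal (Fin 2) K := by
    rw [hy, sq]
    exact sub_mem (Ideal.mul_mem_left _ _ (X_mem_varIdeal _))
      (Ideal.mul_mem_left _ _ (X_mem_varIdeal _))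
  have hs : HasSubst ![x, y] := hasSubst_of_constantCoeff_zero (by
    simp only [Fin.forall_fin_two, Matrix.cons_val_zero, Matrix.cons_val_one]
    exact ⟨mem_varIdeal_iff.1 hxV, mem_varIdeal_iff.1 hyV⟩)
  have hcube := varIdeal_cube_le_of_quadratic varIdeal_two hc' hd' hx hy
  have hX0 : (X 0 : MvPowerSeries (Fin 2) K) ^ 3 ∈ Ideal.span {x, y} :=
    hcube (Ideal.pow_mem_pow (X_mem_varIdeal _) 3)
  have hX1 : (X 1 : MvPowerSeries (Fin 2) K) ^ 3 ∈ Ideal.span {x, y} :=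
    hcube (Ideal.pow_mem_pow (X_mem_varIdeal _) 3)
  have hX00 : (X 0 : MvPowerSeries (Fin 2) K) ^ 3 ≠ 0 := pow_ne_zero _ (by
    intro h
    have := congrArg (coeff (Finsupp.single 0 1)) h
    simp at this)
  have main : ∀ n, ∀ r : Fin 4 → MvPowerSeries (Fin 2) K,
      ∑ i, subst ![x, y] (r i) * ![1, X 0, X 1, X 0 * X 1] i = 0 →
      ∀ i, r i ∈ varIdeal (Fin 2) K ^ n := by
    intro n
    induction n with
    | zero => simp
    | succ n ih =>
      intro r hr
      have hsplit : ∀ i, ∃ g h, r i = C (constantCoeff (r i)) + X 0 * g + X 1 * h := by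
        intro i
        have h := sub_C_mem_varIdeal (r i)
        rw [varIdeal_two, Ideal.mem_span_pair] at h
        obtain ⟨g, h, e⟩ := h
        exact ⟨g, h, by linear_combination -e⟩
      choose r' r'' hr' using hsplit
      set f := ∑ i, subst ![x, y] (r' i) * ![1, X 0, X 1, X 0 * X 1] i with hf
      set g := ∑ i, subst ![x, y] (r'' i) * ![1, X 0, X 1, X 0 * X 1] i with hg
      have hsub : ∀ i, subst ![x, y] (r i) = C (constantCoeff (r i)) + x * subst ![x, y] (r' i) +
          y * subst ![x, y] (r'' i) := by
        intro i
        conv_lhs => rw [hr' i]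
        simp only [subst_add hs, subst_mul hs, subst_X hs, subst_C, Matrix.cons_val_zero,
          Matrix.cons_val_one]
      have e1 : ∑ i, C (constantCoeff (r i)) * ![1, X 0, X 1, X 0 * X 1] i + x * f + y * g = 0 := by
        rw [← hr, hf, hg, Finset.mul_sum, Finset.mul_sum, ← Finset.sum_add_distrib,
          ← Finset.sum_add_distrib]
        refine Finset.sum_congr rfl fun i _ => ?_
        rw [hsub i]
        ring
      have hk := eq_zero_of_sum_four hc hd (hx ▸ hy ▸ e1)
      have hk' : ∀ i, constantCoeff (r i) = 0 := fun i => congrFun hk i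
      simp only [hk', map_zero, zero_mul, Finset.sum_const_zero, zero_add] at e1 hr'
      obtain ⟨h, h1, h2⟩ := exists_koszul hX0 hX1 hX00 (fun a b hab =>
        X_pow_dvd_of_dvd_X_pow_mul (by simp) ⟨b, hab⟩) e1
      obtain ⟨s, hs'⟩ := exists_subst_four_of_quadratic varIdeal_two hc' hd' hx hy h
      have k1 := ih (fun i => r' i - X 1 * s i) (by
        simp only [subst_sub hs, subst_mul hs, subst_X hs, sub_mul, Finset.sum_sub_distrib,
          Matrix.cons_val_one, Matrix.cons_val_fin_one]
        rw [← hf, h1, hs', Finset.mul_sum, sub_eq_zero]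
        exact Finset.sum_congr rfl fun i _ => by ring)
      have k2 := ih (fun i => r'' i + X 0 * s i) (by
        simp only [subst_add hs, subst_mul hs, subst_X hs, add_mul, Finset.sum_add_distrib,
          Matrix.cons_val_zero]
        rw [← hg, h2, hs', Finset.mul_sum, neg_add_eq_zero]
        exact Finset.sum_congr rfl fun i _ => by ring)
      intro i
      have e : r i = X 0 * (r' i - X 1 * s i) + X 1 * (r'' i + X 0 * s i) := by
        rw [hr' i]; ring
      rw [e, pow_succ']
      exact add_mem (Ideal.mul_mem_mul (X_mem_varIdeal _) (k1 i))
        (Ideal.mul_mem_mul (X_mem_varIdeal _) (k2 i))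
  exact funext fun i => eq_zero_of_forall_mem_varIdeal_pow fun n => main n r hr i

theorem eq_zero_of_forall_exists_C_pow_mul {σ O : Type*} [CommRing O] [IsLocalRing O]
    [IsNoetherianRing O] {π : O} (hπ : maximalIdeal O = Ideal.span {π}) {f : MvPowerSeries σ O}
    (h : ∀ n, ∃ g, f = C (π ^ n) * g) : f = 0 := by
  ext d
  have hm : coeff d f ∈ ⨅ n : ℕ, maximalIdeal O ^ n := by
    rw [Submodule.mem_iInf]
    intro n
    obtain ⟨g, hg⟩ := h n
    rw [hg, coeff_C_mul, hπ, Ideal.span_singleton_pow]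
    exact Ideal.mul_mem_right _ _ (Ideal.mem_span_singleton_self _)
  rw [Ideal.iInf_pow_eq_bot_of_isLocalRing _ (maximalIdeal.isMaximal O).ne_top] at hm
  simpa using hm

/-- `1, u, v, u v` are independent over `O[[x, y]]`. -/
theorem eq_zero_of_sum_subst_four {O : Type*} [CommRing O] [IsDomain O] [IsLocalRing O]
    [IsNoetherianRing O] {π : O} (hπ : maximalIdeal O = Ideal.span {π})
    {c d x y : MvPowerSeries (Fin 2) O}
    (hc : c ∈ maximalIdeal (MvPowerSeries (Fin 2) O) * varIdeal (Fin 2) O)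
    (hd : d ∈ maximalIdeal (MvPowerSeries (Fin 2) O) * varIdeal (Fin 2) O)
    (hx : x = c * X 0 - X 0 ^ 2) (hy : y = d * X 1 - X 1 ^ 2)
    {r : Fin 4 → MvPowerSeries (Fin 2) O}
    (hr : ∑ i, subst ![x, y] (r i) * ![1, X 0, X 1, X 0 * X 1] i = 0) : r = 0 := by
  have hxV : x ∈ varIdeal (Fin 2) O := by
    rw [hx, sq]
    exact sub_mem (Ideal.mul_mem_left _ _ (X_mem_varIdeal _))
      (Ideal.mul_mem_left _ _ (X_mem_varIdeal _))
  have hyV : y ∈ varIdeal (Fin 2) O := by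
    rw [hy, sq]
    exact sub_mem (Ideal.mul_mem_left _ _ (X_mem_varIdeal _))
      (Ideal.mul_mem_left _ _ (X_mem_varIdeal _))
  have hs : HasSubst ![x, y] := hasSubst_of_constantCoeff_zero (by
    simp only [Fin.forall_fin_two, Matrix.cons_val_zero, Matrix.cons_val_one]
    exact ⟨mem_varIdeal_iff.1 hxV, mem_varIdeal_iff.1 hyV⟩)
  -- Modulo π the maximal ideal becomes the ideal of the variables, so c and d acquire order two, as
  -- the field case requires.
  have hred : ∀ c ∈ maximalIdeal (MvPowerSeries (Fin 2) O) * varIdeal (Fin 2) O,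
      map (residue O) c ∈ varIdeal (Fin 2) (ResidueField O) ^ 2 := by
    intro c hc
    have := Ideal.mem_map_of_mem (map (residue O)) hc
    rw [Ideal.map_mul, map_varIdeal] at this
    rw [sq]
    exact Ideal.mul_mono_left map_maximalIdeal_le this
  have step : ∀ r : Fin 4 → MvPowerSeries (Fin 2) O,
      ∑ i, subst ![x, y] (r i) * ![1, X 0, X 1, X 0 * X 1] i = 0 →
      ∀ i, map (residue O) (r i) = 0 := by
    intro r hr i
    have h := congrArg (map (residue O)) hr
    have e : (fun i => map (residue O) (![x, y] i)) =
        ![map (residue O) x, map (residue O) y] := by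
      ext i : 1; fin_cases i <;> rfl
    simp only [map_sum, map_mul, map_subst hs, map_zero, e] at h
    refine congrFun (eq_zero_of_sum_subst_four_field (hred c hc) (hred d hd)
      (x := map (residue O) x) (y := map (residue O) y) (by simp [hx]) (by simp [hy])
      (r := fun i => map (residue O) (r i)) ?_) i
    rw [← h]
    refine Finset.sum_congr rfl fun i _ => ?_
    congr 1
    fin_cases i <;> simp
  by_cases h0 : π = 0
  · ext1 i
    obtain ⟨g, hg⟩ := (map_residue_eq_zero_iff hπ).1 (step r hr i)
    rw [hg, h0]
    simp
  -- All coefficients of a relation are divisible by π, and the quotients again form a relation.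
  -- Krull's intersection theorem then finishes.
  have main : ∀ n, ∀ r : Fin 4 → MvPowerSeries (Fin 2) O,
      ∑ i, subst ![x, y] (r i) * ![1, X 0, X 1, X 0 * X 1] i = 0 →
      ∀ i, ∃ g, r i = C (π ^ n) * g := by
    intro n
    induction n with
    | zero => intro r _ i; exact ⟨r i, by simp⟩
    | succ n ih =>
      intro r hr i
      choose s hs' using fun i => (map_residue_eq_zero_iff hπ).1 (step r hr i)
      have hC : (C π : MvPowerSeries (Fin 2) O) ≠ 0 := by
        rwa [Ne, ← map_zero C, C_injective.eq_iff]
      obtain ⟨g, hg⟩ := ih s (by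
        refine mul_left_cancel₀ hC ?_
        rw [mul_zero, ← hr, Finset.mul_sum]
        refine Finset.sum_congr rfl fun i _ => ?_
        rw [hs' i, subst_mul hs, subst_C, mul_assoc]) i
      exact ⟨g, by rw [hs' i, hg, pow_succ', map_mul, mul_assoc]⟩
  exact funext fun i => eq_zero_of_forall_exists_C_pow_mul hπ fun n => main n r hr i

end MvPowerSeries

/-! ### Algebra of an action of a length-two group scheme. -/

namespace TateOortAction

section General

variable {O : Type*} [CommRing O] {α β : O} {h : α * β = 2}
variable {S : Type*} [CommRing S] [Algebra O S] (A : TateOortAction α β h S)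

theorem mem_invariants_iff {s : S} : s ∈ A.invariants ↔ A.δ s = 0 := by
  have e : s ∈ A.invariants ↔ A.coact s = 1 ⊗ₜ s := Iff.rfl
  rw [e, coact_eq, add_eq_left]
  refine ⟨fun h0 => ?_, fun h0 => by rw [h0, TensorProduct.tmul_zero]⟩
  have := congrArg (fun t => TensorProduct.lid O S
    (LinearMap.rTensor S (TateOort.coordX α β h) t)) h0
  simpa [TateOort.coordX_gen] using this

theorem δ_mul' (s t : S) : A.δ (s * t) =
    A.δ s * t + s * A.δ t + algebraMap O S α * (A.δ s * A.δ t) := by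
  rw [δ_mul, Algebra.smul_def]

theorem δ_δ' (s : S) : A.δ (A.δ s) = -(algebraMap O S β * A.δ s) := by
  rw [δ_δ, Algebra.smul_def]

theorem δ_mul_of_δ_eq_zero {r : S} (hr : A.δ r = 0) (s : S) : A.δ (r * s) = r * A.δ s := by
  rw [δ_mul', hr]; ring

theorem δ_algebraMap (r : O) : A.δ (algebraMap O S r) = 0 := by
  rw [Algebra.algebraMap_eq_smul_one, map_smul, δ_one, smul_zero]

theorem δ_algebraMap_mul (r : O) (s : S) :
    A.δ (algebraMap O S r * s) = algebraMap O S r * A.δ s :=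
  A.δ_mul_of_δ_eq_zero (A.δ_algebraMap r) s

/-- The involution `s ↦ s + α δ s` given by the point `X = α` of `G_{α,β}`. -/
def conj (s : S) : S := s + algebraMap O S α * A.δ s

/-- The trace-like map `s ↦ β s + δ s` to the invariants. -/
def trace : S →ₗ[O] S := β • LinearMap.id + A.δ

theorem trace_apply (s : S) : A.trace s = algebraMap O S β * s + A.δ s := by
  rw [← Algebra.smul_def]; rfl

theorem δ_trace (s : S) : A.δ (A.trace s) = 0 := by
  rw [trace_apply, map_add, δ_algebraMap_mul, δ_δ']; ring

theorem trace_mul_of_δ_eq_zero {r : S} (hr : A.δ r = 0) (s : S) :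
    A.trace (r * s) = r * A.trace s := by
  rw [trace_apply, trace_apply, δ_mul_of_δ_eq_zero A hr]; ring

include h in
theorem algebraMap_mul_algebraMap : algebraMap O S α * algebraMap O S β = 2 := by
  rw [← map_mul, h, map_ofNat]

theorem δ_conj (s : S) : A.δ (A.conj s) = -A.δ s := by
  rw [conj, map_add, δ_algebraMap_mul, δ_δ']
  linear_combination -A.δ s * algebraMap_mul_algebraMap (S := S) (h := h)

theorem trace_conj (s : S) : A.trace (A.conj s) = A.trace s := by
  rw [trace_apply, trace_apply, δ_conj, conj]
  linear_combination A.δ s * algebraMap_mul_algebraMap (S := S) (h := h)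

theorem trace_one : A.trace 1 = algebraMap O S β := by
  rw [trace_apply, δ_one]; ring

theorem δ_mul_conj (s : S) : A.δ (s * A.conj s) = 0 := by
  rw [δ_mul', δ_conj, conj]
  ring

/-- Because αβ = 2, s + conj s equals α·`A.trace s`. Hence s and conj s are the two roots of a
quadratic with invariant coefficients; the primed version below is the other root. -/
theorem mul_conj_eq (s : S) :
    s * A.conj s = algebraMap O S α * A.trace s * s - s ^ 2 := by
  rw [conj, trace_apply]
  linear_combination (-s ^ 2) * algebraMap_mul_algebraMap (S := S) (h := h)

theorem mul_conj_eq' (s : S) :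
    s * A.conj s = algebraMap O S α * A.trace s * A.conj s - A.conj s ^ 2 := by
  rw [conj, trace_apply]
  linear_combination (-s ^ 2 - algebraMap O S α * A.δ s * s) *
    algebraMap_mul_algebraMap (S := S) (h := h)

theorem trace_mul_conj (s t : S) :
    A.trace (s * A.conj t) = algebraMap O S β * (s * t) + A.δ s * t + s * A.δ t := by
  rw [trace_apply, δ_mul', δ_conj, conj]
  linear_combination s * A.δ t * algebraMap_mul_algebraMap (S := S) (h := h)

theorem trace_mul_conj_eq (s t : S) : A.trace (s * A.conj t) =
    A.trace s * t + A.trace t * s - algebraMap O S β * (s * t) := by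
  rw [trace_mul_conj, trace_apply, trace_apply]; ring

/-- Once the norms and the mixed trace are written through s, t and their traces, the identity holds
with the two traces treated as free variables; αβ = 2 is the only relation needed. -/
theorem equation (s t : S) :
    A.trace (s * A.conj t) ^ 2
      - algebraMap O S α * (A.trace s * A.trace t * A.trace (s * A.conj t))
      + A.trace s ^ 2 * (t * A.conj t) + A.trace t ^ 2 * (s * A.conj s)
      - algebraMap O S β ^ 2 * ((s * A.conj s) * (t * A.conj t)) = 0 := by
  rw [mul_conj_eq, mul_conj_eq, trace_mul_conj_eq]
  have h2 := algebraMap_mul_algebraMap (S := S) (h := h)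
  set a := A.trace s
  set b := A.trace t
  set c := algebraMap O S α
  set d := algebraMap O S β
  linear_combination (-a * b * s * t * (c * d + 1) + d * a * s * t ^ 2 + d * b * s ^ 2 * t) * h2

/-- An invariant that is a combination of `1, s, t, s t` with invariant coefficients is, up to an
invariant coefficient, a trace. -/
theorem exists_eq_add_trace [IsDomain S] {s t : S}
    (hk : ∀ f g, A.δ s * f + A.δ t * g = 0 → ∃ w, f = A.δ t * w ∧ g = -(A.δ s * w))
    (hne : A.δ s ≠ 0 ∨ A.δ t ≠ 0) {c₀ c₁ c₂ c₃ f : S} (h₀ : A.δ c₀ = 0) (h₁ : A.δ c₁ = 0)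
    (h₂ : A.δ c₂ = 0) (h₃ : A.δ c₃ = 0) (hf : f = c₀ + c₁ * s + c₂ * t + c₃ * (s * t))
    (hδ : A.δ f = 0) : ∃ w, f = c₀ + A.trace (w * (s * A.conj t)) := by
  have e1 : A.δ s * (c₁ + c₃ * t) + A.δ t * (c₂ + c₃ * A.conj s) = 0 := by
    rw [← hδ, hf, map_add, map_add, map_add, h₀, δ_mul_of_δ_eq_zero A h₁,
      δ_mul_of_δ_eq_zero A h₂, δ_mul_of_δ_eq_zero A h₃, δ_mul', conj]
    ring
  obtain ⟨w, hw1, hw2⟩ := hk _ _ e1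
  have h2 := algebraMap_mul_algebraMap (S := S) (h := h)
  -- Applying δ to the first Koszul equation kills c₁ and leaves c₃·δt = -(trace w)·δt; the second
  -- equation gives the same with δs, and one of the two can be cancelled.
  have k1 : (c₃ + A.trace w) * A.δ t = 0 := by
    have := congrArg A.δ hw1
    rw [map_add, h₁, δ_mul_of_δ_eq_zero A h₃, δ_mul', δ_δ'] at this
    rw [trace_apply]
    linear_combination this - A.δ w * A.δ t * h2
  have k2 : (c₃ + A.trace w) * A.δ s = 0 := by
    have := congrArg A.δ hw2
    rw [map_add, h₂, δ_mul_of_δ_eq_zero A h₃, δ_conj, map_neg, δ_mul', δ_δ'] at this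
    rw [trace_apply]
    linear_combination -this - A.δ w * A.δ s * h2
  have h3 : c₃ = -A.trace w := by
    rcases hne with hne | hne
    · exact eq_neg_of_add_eq_zero_left ((mul_eq_zero.1 k2).resolve_right hne)
    · exact eq_neg_of_add_eq_zero_left ((mul_eq_zero.1 k1).resolve_right hne)
  refine ⟨w, ?_⟩
  have e2 : f = c₀ + w * (A.δ t * s - A.δ s * t) - c₃ * t * A.conj s := by
    rw [hf]; linear_combination s * hw1 + t * hw2
  rw [e2, h3, trace_apply, trace_apply, δ_mul', δ_mul', δ_conj, conj, conj]
  linear_combination (w * A.δ s * t - w * A.δ t * s) * h2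

end General

end TateOortAction

/-! ### Actions on power series rings and their linear part at an isolated fixed point. -/

open MvPowerSeries IsLocalRing

theorem MvPowerSeries.exists_eq_C_add_sum {κ R : Type*} [Fintype κ] [CommRing R]
    (f : MvPowerSeries κ R) : ∃ (r : R) (g : κ → MvPowerSeries κ R), f = C r + ∑ j, X j * g j := by
  have h := sub_C_mem_varIdeal f
  rw [← pow_one (varIdeal κ R), varIdeal_pow_eq] at h
  obtain ⟨g, _, hg⟩ := exists_eq_sum_X_mul h
  exact ⟨constantCoeff f, g, by rw [← hg]; ring⟩

theorem MvPowerSeries.subst_C_add_sum {κ τ R : Type*} [Fintype κ] [CommRing R]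
    {t : κ → MvPowerSeries τ R} (ht : HasSubst t) (r : R) (g : κ → MvPowerSeries κ R) :
    subst t (C r + ∑ j, X j * g j) = C r + ∑ j, t j * subst t (g j) := by
  rw [subst_add ht, subst_C, ← substAlgHom_apply ht, map_sum]
  simp only [map_mul, substAlgHom_apply, subst_X ht]

namespace TateOortAction

section Local

variable {O : Type*} [CommRing O] {α β : O} {h : α * β = 2} {τ : Type*}
  (A : TateOortAction α β h (MvPowerSeries τ O))

/-- Continuity of δ is not assumed. Linearity over the invariant `t j` replaces it: pulling out one
factor `t j` at a time puts δ of the substituted series in every power of the ideal of the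
variables. -/
theorem δ_subst [Finite τ] {κ : Type*} [Finite κ]
    {t : κ → MvPowerSeries τ O} (ht : ∀ j, t j ∈ varIdeal τ O) (hδ : ∀ j, A.δ (t j) = 0)
    (f : MvPowerSeries κ O) : A.δ (subst t f) = 0 := by
  have := Fintype.ofFinite κ
  have hs : HasSubst t := hasSubst_of_constantCoeff_zero fun i => mem_varIdeal_iff.1 (ht i)
  refine eq_zero_of_forall_mem_varIdeal_pow fun n => ?_
  induction n generalizing f with
  | zero => simp
  | succ n ih =>
    obtain ⟨r, g, rfl⟩ := exists_eq_C_add_sum f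
    rw [subst_C_add_sum hs, map_add, map_sum, pow_succ']
    have : A.δ (C r) = 0 := A.δ_algebraMap r
    rw [this, zero_add]
    refine sum_mem fun j _ => ?_
    rw [δ_mul_of_δ_eq_zero A (hδ j)]
    exact Ideal.mul_mem_mul (ht j) (ih (g j))

theorem conj_mem_varIdeal (hA : ∀ f, A.δ f ∈ varIdeal τ O) {f : MvPowerSeries τ O}
    (hf : f ∈ varIdeal τ O) : A.conj f ∈ varIdeal τ O :=
  add_mem hf (Ideal.mul_mem_left _ _ (hA f))

theorem trace_mem_varIdeal (hA : ∀ f, A.δ f ∈ varIdeal τ O) {f : MvPowerSeries τ O}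
    (hf : f ∈ varIdeal τ O) : A.trace f ∈ varIdeal τ O := by
  rw [trace_apply]
  exact add_mem (Ideal.mul_mem_left _ _ hf) (hA f)

/-- Modulo high powers of the ideal of the variables, the ideal of the fixed locus is generated by
the `δ` of generators of that ideal. -/
theorem δ_mem_sup [Finite τ] {w t : MvPowerSeries τ O}
    (hwt : varIdeal τ O = Ideal.span {w, t}) (f : MvPowerSeries τ O) (n : ℕ) :
    A.δ f ∈ Ideal.span {A.δ w, A.δ t} ⊔ varIdeal τ O ^ n := by
  induction n generalizing f with
  | zero => simp
  | succ n ih =>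
    have hw : w ∈ varIdeal τ O := hwt ▸ Ideal.subset_span (by simp)
    have ht : t ∈ varIdeal τ O := hwt ▸ Ideal.subset_span (by simp)
    have hm : ∀ {v g}, v ∈ varIdeal τ O → A.δ g ∈ Ideal.span {A.δ w, A.δ t} ⊔ varIdeal τ O ^ n →
        v * A.δ g ∈ Ideal.span {A.δ w, A.δ t} ⊔ varIdeal τ O ^ (n + 1) := by
      intro v g hv hg
      obtain ⟨i, hi, j, hj, e⟩ := Submodule.mem_sup.1 hg
      rw [← e, mul_add, pow_succ']
      exact Submodule.add_mem_sup (Ideal.mul_mem_left _ _ hi) (Ideal.mul_mem_mul hv hj)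
    have hf := sub_C_mem_varIdeal f
    rw [hwt, Ideal.mem_span_pair] at hf
    obtain ⟨g, k, e⟩ := hf
    have e1 : f = C (constantCoeff f) + (w * g + t * k) := by linear_combination -e
    have hC : A.δ (C (constantCoeff f)) = 0 := A.δ_algebraMap _
    rw [e1, map_add, hC, map_add, zero_add, δ_mul', δ_mul']
    have hw' : A.δ w ∈ Ideal.span {A.δ w, A.δ t} ⊔ varIdeal τ O ^ (n + 1) :=
      Ideal.mem_sup_left (Ideal.subset_span (by simp))
    have ht' : A.δ t ∈ Ideal.span {A.δ w, A.δ t} ⊔ varIdeal τ O ^ (n + 1) :=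
      Ideal.mem_sup_left (Ideal.subset_span (by simp))
    exact add_mem (add_mem (add_mem (Ideal.mul_mem_right _ _ hw') (hm hw (ih g)))
        (Ideal.mul_mem_left _ _ (Ideal.mul_mem_right _ _ hw')))
      (add_mem (add_mem (Ideal.mul_mem_right _ _ ht') (hm ht (ih k)))
        (Ideal.mul_mem_left _ _ (Ideal.mul_mem_right _ _ ht')))

end Local

/-- Over a field, if the origin is an isolated fixed point then `β + δ` vanishes on the cotangent
space. -/
theorem trace_mem_varIdeal_sq {K : Type*} [Field K] {α β : K} {h : α * β = 2}
    (A : TateOortAction α β h (MvPowerSeries (Fin 2) K))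
    (hA : ∀ f, A.δ f ∈ varIdeal (Fin 2) K) {N : ℕ} (hN : varIdeal (Fin 2) K ^ N ≤ A.fixedIdeal)
    (i : Fin 2) : A.trace (X i) ∈ varIdeal (Fin 2) K ^ 2 := by
  by_contra hw
  set w := A.trace (X i) with hw'
  have hwV : w ∈ varIdeal (Fin 2) K := trace_mem_varIdeal A hA (X_mem_varIdeal i)
  -- A trace with nonzero linear part can replace one of the two variables as a coordinate.
  have hgen : ∃ j : Fin 2, varIdeal (Fin 2) K = Ideal.span {w, X j} := by
    have hw1 := hwV
    rw [varIdeal_two, Ideal.mem_span_pair] at hw1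
    obtain ⟨g, k, e⟩ := hw1
    have hg := sub_C_mem_varIdeal g
    have hk := sub_C_mem_varIdeal k
    have e2 : w = C (constantCoeff g) * X 0 + C (constantCoeff k) * X 1 +
        ((g - C (constantCoeff g)) * X 0 + (k - C (constantCoeff k)) * X 1) := by
      linear_combination -e
    have hm : (g - C (constantCoeff g)) * X 0 + (k - C (constantCoeff k)) * X 1 ∈
        varIdeal (Fin 2) K ^ 2 := by
      rw [sq]
      exact add_mem (Ideal.mul_mem_mul hg (X_mem_varIdeal _))
        (Ideal.mul_mem_mul hk (X_mem_varIdeal _))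
    set m := (g - C (constantCoeff g)) * X 0 + (k - C (constantCoeff k)) * X 1
    have aux : ∀ {i j : Fin 2} {a b : K}, varIdeal (Fin 2) K = Ideal.span {X i, X j} → a ≠ 0 →
        w = C a * X i + C b * X j + m → varIdeal (Fin 2) K = Ideal.span {w, X j} := by
      intro i j a b hij ha e
      refine le_antisymm (Ideal.le_of_le_sup_maximalIdeal_mul varIdeal_fg ?_) ?_
      · rw [maximalIdeal_eq_varIdeal, ← sq]
        conv_lhs => rw [hij]
        rw [Ideal.span_le]
        have hXj : (X j : MvPowerSeries (Fin 2) K) ∈ Ideal.span {w, X j} :=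
          Ideal.subset_span (by simp)
        have hwm : w ∈ Ideal.span {w, X j} := Ideal.subset_span (by simp)
        intro r hr
        simp only [Set.mem_insert_iff, Set.mem_singleton_iff] at hr
        rcases hr with rfl | rfl
        · have hC : C a⁻¹ * C a = (1 : MvPowerSeries (Fin 2) K) := by
            rw [← map_mul, inv_mul_cancel₀ ha, map_one]
          have e3 : X i = (C a⁻¹ * w - C a⁻¹ * C b * X j) + -(C a⁻¹ * m) := by
            rw [e]; linear_combination (-X i) * hC
          rw [e3]
          exact Submodule.add_mem_sup (sub_mem (Ideal.mul_mem_left _ _ hwm)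
            (Ideal.mul_mem_left _ _ hXj)) (neg_mem (Ideal.mul_mem_left _ _ hm))
        · exact Ideal.mem_sup_left hXj
      · rw [Ideal.span_le]
        intro r hr
        simp only [Set.mem_insert_iff, Set.mem_singleton_iff] at hr
        rcases hr with rfl | rfl
        · exact hwV
        · exact X_mem_varIdeal _
    by_cases h0 : constantCoeff g = 0
    · by_cases h1 : constantCoeff k = 0
      · exfalso
        apply hw
        rw [e2, h0, h1]
        simpa using hm
      · exact ⟨0, aux (by rw [varIdeal_two, Set.pair_comm]) h1 (by rw [e2]; ring)⟩
    · exact ⟨1, aux varIdeal_two h0 e2⟩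
  obtain ⟨j, hj⟩ := hgen
  -- The new coordinate `w` is invariant, so up to higher order the fixed ideal is generated by the
  -- single element `A.δ (X j)`. The two powers of the variables then have it as a common divisor,
  -- which makes it a unit, although it has no constant term.
  have hle : varIdeal (Fin 2) K ^ N ≤ Ideal.span {A.δ (X j)} := by
    refine Ideal.le_of_le_sup_maximalIdeal_mul varIdeal_fg.pow ?_
    rw [maximalIdeal_eq_varIdeal, ← pow_succ']
    refine hN.trans ?_
    rw [fixedIdeal, Ideal.span_le]
    rintro _ ⟨f, rfl⟩
    have := δ_mem_sup A hj f (N + 1)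
    rwa [hw', δ_trace, Ideal.span_insert_zero] at this
  obtain ⟨g, hg⟩ := Ideal.mem_span_singleton.1 (hle (Ideal.pow_mem_pow (X_mem_varIdeal 0) N))
  obtain ⟨k, hk⟩ := Ideal.mem_span_singleton.1 (hle (Ideal.pow_mem_pow (X_mem_varIdeal 1) N))
  have hX0 : (X 0 : MvPowerSeries (Fin 2) K) ^ N ≠ 0 := pow_ne_zero _ (by
    intro h
    have := congrArg (coeff (Finsupp.single 0 1)) h
    simp at this)
  obtain ⟨g', hg'⟩ : (X 0 : MvPowerSeries (Fin 2) K) ^ N ∣ g := by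
    refine X_pow_dvd_of_dvd_X_pow_mul (j := 1) (n := N) (by simp) ⟨k, ?_⟩
    rw [hg, hk]; ring
  have hu : A.δ (X j) * g' = 1 := by
    refine mul_left_cancel₀ hX0 ?_
    conv_rhs => rw [hg, hg']
    ring
  have hone : (1 : MvPowerSeries (Fin 2) K) ∈ varIdeal (Fin 2) K :=
    hu ▸ Ideal.mul_mem_right _ _ (hA _)
  rw [mem_varIdeal_iff] at hone
  simp at hone

end TateOortAction

/-- Every series in three variables is the sum of a series in the first two variables and a
multiple of the third. -/
theorem MvPowerSeries.exists_eq_subst_add_X_mul {R : Type*} [CommRing R]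
    (f : MvPowerSeries (Fin 3) R) :
    ∃ (r : MvPowerSeries (Fin 2) R) (q : MvPowerSeries (Fin 3) R),
      f = subst ![X 0, X 1] r + X 2 * q := by
  set e : Fin 2 ↪ Fin 3 := Fin.castSuccEmb with he
  have hdvd : X 2 ∣ f - rename e (killCompl e f) := by
    rw [X_dvd_iff]
    intro m hm
    obtain ⟨m', rfl⟩ : ∃ m', Finsupp.embDomain e m' = m := by
      refine ⟨m.comapDomain e e.injective.injOn, ?_⟩
      rw [Finsupp.embDomain_comapDomain]
      intro i hi
      fin_cases i
      · exact ⟨0, rfl⟩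
      · exact ⟨1, rfl⟩
      · simp [hm] at hi
    rw [map_sub, coeff_embDomain_rename]
    exact sub_self _
  obtain ⟨q, hq⟩ := hdvd
  refine ⟨killCompl e f, q, ?_⟩
  have e1 : (![X 0, X 1] : Fin 2 → MvPowerSeries (Fin 3) R) = fun i => X (e i) := by
    ext i : 1; fin_cases i <;> rfl
  rw [← hq, rename_eq_subst, e1]
  change f = subst (X ∘ e) (killCompl e f) + (f - subst (X ∘ e) (killCompl e f))
  ring

/-! ### Structure of the ring over the norms for an action fixing the origin. -/

namespace TateOortAction

variable {O : Type*} [CommRing O] {α β : O} {h : α * β = 2}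

/-- The two norms `u (u + α δ u)` and `v (v + α δ v)`. -/
def norms (A : TateOortAction α β h (MvPowerSeries (Fin 2) O)) :
    Fin 2 → MvPowerSeries (Fin 2) O :=
  ![X 0 * A.conj (X 0), X 1 * A.conj (X 1)]

theorem norms_mem (A : TateOortAction α β h (MvPowerSeries (Fin 2) O)) (j : Fin 2) :
    A.norms j ∈ varIdeal (Fin 2) O := by
  fin_cases j
  · exact Ideal.mul_mem_right _ _ (X_mem_varIdeal _)
  · exact Ideal.mul_mem_right _ _ (X_mem_varIdeal _)

theorem hasSubst_norms (A : TateOortAction α β h (MvPowerSeries (Fin 2) O)) :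
    HasSubst A.norms :=
  hasSubst_of_constantCoeff_zero fun i => mem_varIdeal_iff.1 (A.norms_mem i)

theorem δ_subst_norms (A : TateOortAction α β h (MvPowerSeries (Fin 2) O))
    (f : MvPowerSeries (Fin 2) O) : A.δ (subst A.norms f) = 0 := by
  refine δ_subst A A.norms_mem (fun j => ?_) f
  fin_cases j
  · exact A.δ_mul_conj _
  · exact A.δ_mul_conj _

/-- The two norms and the trace of `u (v + α δ v)`. -/
def invTriple (A : TateOortAction α β h (MvPowerSeries (Fin 2) O)) :
    Fin 3 → MvPowerSeries (Fin 2) O :=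
  ![X 0 * A.conj (X 0), X 1 * A.conj (X 1), A.trace (X 0 * A.conj (X 1))]

/-- The algebraic consequences of `u = v = 0` being an isolated fixed point of the special fiber
and contained in the fixed locus. -/
structure FixesOrigin [IsLocalRing O] (A : TateOortAction α β h (MvPowerSeries (Fin 2) O)) :
    Prop where
  δ_mem : ∀ f, A.δ f ∈ varIdeal (Fin 2) O
  trace_mem : ∀ i, A.trace (X i) ∈ maximalIdeal (MvPowerSeries (Fin 2) O) * varIdeal (Fin 2) O
  pow_le : ∃ N, varIdeal (Fin 2) (ResidueField O) ^ N ≤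
    (Ideal.span {A.δ (X 0), A.δ (X 1)}).map (map (residue O))

namespace FixesOrigin

variable [IsLocalRing O] {A : TateOortAction α β h (MvPowerSeries (Fin 2) O)}
  (hA : A.FixesOrigin)

include hA

theorem invTriple_mem (j : Fin 3) : A.invTriple j ∈ varIdeal (Fin 2) O := by
  fin_cases j
  · exact Ideal.mul_mem_right _ _ (X_mem_varIdeal _)
  · exact Ideal.mul_mem_right _ _ (X_mem_varIdeal _)
  · exact trace_mem_varIdeal A hA.δ_mem (Ideal.mul_mem_right _ _ (X_mem_varIdeal _))

theorem hasSubst_invTriple : HasSubst A.invTriple :=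
  hasSubst_of_constantCoeff_zero fun i => mem_varIdeal_iff.1 (hA.invTriple_mem i)

theorem δ_subst_invTriple (f : MvPowerSeries (Fin 3) O) : A.δ (subst A.invTriple f) = 0 := by
  refine δ_subst A hA.invTriple_mem (fun j => ?_) f
  fin_cases j
  · exact A.δ_mul_conj _
  · exact A.δ_mul_conj _
  · exact A.δ_trace _

theorem smul_trace_mem (i : Fin 2) : algebraMap O (MvPowerSeries (Fin 2) O) α * A.trace (X i) ∈
    maximalIdeal (MvPowerSeries (Fin 2) O) * varIdeal (Fin 2) O :=
  Ideal.mul_mem_left _ _ (hA.trace_mem i)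

theorem exists_eq_sum (f : MvPowerSeries (Fin 2) O) : ∃ r : Fin 4 → MvPowerSeries (Fin 2) O,
    f = ∑ i, subst A.norms (r i) * ![1, X 0, X 1, X 0 * X 1] i :=
  exists_subst_four_of_quadratic varIdeal_two (hA.smul_trace_mem 0) (hA.smul_trace_mem 1)
    (A.mul_conj_eq _) (A.mul_conj_eq _) f

/-- The sum u + conj u = α·trace u is negligible for Nakayama, so conj u can replace u. The
resulting basis 1, conj u, v, (conj u)v is the one whose products with u·conj v have computable
traces. -/
theorem varIdeal_eq_span_conj : varIdeal (Fin 2) O = Ideal.span {A.conj (X 0), X 1} := by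
  refine le_antisymm (Ideal.le_of_le_sup_maximalIdeal_mul varIdeal_fg ?_) ?_
  · have e : X 0 = -A.conj (X 0) + algebraMap O _ α * A.trace (X 0) := by
      rw [conj, trace_apply]
      linear_combination -X 0 * algebraMap_mul_algebraMap (S := MvPowerSeries (Fin 2) O) (h := h)
    conv_lhs => rw [varIdeal_two]
    rw [Ideal.span_le]
    intro r hr
    simp only [Set.mem_insert_iff, Set.mem_singleton_iff] at hr
    rcases hr with rfl | rfl
    · have hm := Submodule.add_mem_sup (neg_mem (Ideal.subset_span (by simp) :
        A.conj (X 0) ∈ Ideal.span {A.conj (X 0), X 1})) (hA.smul_trace_mem 0)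
      rwa [← e] at hm
    · exact Ideal.mem_sup_left (Ideal.subset_span (by simp))
  · rw [Ideal.span_le]
    intro r hr
    simp only [Set.mem_insert_iff, Set.mem_singleton_iff] at hr
    rcases hr with rfl | rfl
    · exact conj_mem_varIdeal A hA.δ_mem (X_mem_varIdeal _)
    · exact X_mem_varIdeal _

theorem exists_eq_sum_conj (f : MvPowerSeries (Fin 2) O) :
    ∃ r : Fin 4 → MvPowerSeries (Fin 2) O,
      f = ∑ i, subst A.norms (r i) * ![1, A.conj (X 0), X 1, A.conj (X 0) * X 1] i :=
  exists_subst_four_of_quadratic hA.varIdeal_eq_span_conj (hA.smul_trace_mem 0)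
    (hA.smul_trace_mem 1) (A.mul_conj_eq' _) (A.mul_conj_eq _) f

/-- δ is linear over series in the norms, so only δ of 1, u, v, uv contributes; the product rule
handles uv. -/
theorem fixedIdeal_eq : A.fixedIdeal = Ideal.span {A.δ (X 0), A.δ (X 1)} := by
  refine le_antisymm ?_ (Ideal.span_mono (by rintro _ (rfl | rfl) <;> exact ⟨_, rfl⟩))
  rw [fixedIdeal, Ideal.span_le]
  rintro _ ⟨f, rfl⟩
  obtain ⟨r, rfl⟩ := hA.exists_eq_sum f
  have h0 : A.δ (X 0) ∈ Ideal.span {A.δ (X 0), A.δ (X 1)} := Ideal.subset_span (by simp)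
  have h1 : A.δ (X 1) ∈ Ideal.span {A.δ (X 0), A.δ (X 1)} := Ideal.subset_span (by simp)
  rw [map_sum]
  refine sum_mem fun i _ => ?_
  rw [δ_mul_of_δ_eq_zero A (A.δ_subst_norms _)]
  refine Ideal.mul_mem_left _ _ ?_
  fin_cases i
  · simp [δ_one]
  · exact h0
  · exact h1
  · change A.δ (X 0 * X 1) ∈ _
    rw [δ_mul']
    exact add_mem (add_mem (Ideal.mul_mem_right _ _ h0) (Ideal.mul_mem_left _ _ h1))
      (Ideal.mul_mem_left _ _ (Ideal.mul_mem_right _ _ h0))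

end FixesOrigin

end TateOortAction

/-! ### Koszul relations of the fixed ideal and generation of the invariants by 1 and z. -/

/-- Lifts of powers of the variables over the residue field form a regular sequence. -/
theorem MvPowerSeries.dvd_of_map_eq_X_pow {O : Type*} [CommRing O] [IsDomain O] [IsLocalRing O]
    [IsNoetherianRing O] {π : O} (hπ : maximalIdeal O = Ideal.span {π}) {N : ℕ}
    {s t : MvPowerSeries (Fin 2) O} (hs : map (residue O) s = X 0 ^ N)
    (ht : map (residue O) t = X 1 ^ N) (a b : MvPowerSeries (Fin 2) O) (hab : t * a = s * b) :
    s ∣ a := by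
  set H : Ideal (MvPowerSeries (Fin 2) O) := 
    Submodule.comap (LinearMap.mulLeft (MvPowerSeries (Fin 2) O) t) (Ideal.span {s}) with hH
  have mem_H : ∀ a, a ∈ H ↔ ∃ b, t * a = s * b := fun a => by
    rw [hH, Submodule.mem_comap, Ideal.mem_span_singleton]; rfl
  have hX0 : (X 0 : MvPowerSeries (Fin 2) (ResidueField O)) ^ N ≠ 0 := pow_ne_zero _ (by
    intro h
    have := congrArg (coeff (Finsupp.single 0 1)) h
    simp at this)
  -- `H` is the colon ideal (s) : t. Modulo π its elements are multiples of s, because distinct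
  -- variable powers are coprime; the remainder is π times an element that is again in `H`, so
  -- Nakayama applies to this ideal, finitely generated by Noetherianity.
  have hle : H ≤ Ideal.span {s} := by
    refine Ideal.le_of_le_sup_maximalIdeal_mul (IsNoetherian.noetherian H) ?_
    intro a ha
    obtain ⟨b, hb⟩ := (mem_H a).1 ha
    have e := congrArg (map (residue O)) hb
    rw [map_mul, map_mul, hs, ht] at e
    obtain ⟨g, hg⟩ := X_pow_dvd_of_dvd_X_pow_mul (by simp) ⟨_, e⟩
    obtain ⟨g, rfl⟩ := map_surjective residue_surjective g
    obtain ⟨a', ha'⟩ := (map_residue_eq_zero_iff hπ).1 (show map (residue O) (a - s * g) = 0 by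
      rw [map_sub, map_mul, hs, hg, sub_self])
    have e1 : a = s * g + C π * a' := by linear_combination ha'
    rw [e1]
    refine Submodule.add_mem_sup (Ideal.mul_mem_right _ _ (Ideal.mem_span_singleton_self s)) ?_
    by_cases h0 : π = 0
    · simp [h0]
    have hC : (C π : MvPowerSeries (Fin 2) O) ≠ 0 := by
      rwa [Ne, ← map_zero C, C_injective.eq_iff]
    refine Ideal.mul_mem_mul (C_mem_maximalIdeal (hπ ▸ Ideal.mem_span_singleton_self π)) ?_
    have e2 : s * (b - t * g) = C π * (t * a') := by linear_combination -hb + t * e1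
    obtain ⟨b', hb'⟩ := (map_residue_eq_zero_iff hπ).1 (show map (residue O) (b - t * g) = 0 by
      refine (mul_eq_zero.1 ?_).resolve_left hX0
      rw [← hs, ← map_mul, e2]
      exact (map_residue_eq_zero_iff hπ).2 ⟨_, rfl⟩)
    refine (mem_H _).2 ⟨b', mul_left_cancel₀ hC ?_⟩
    rw [← e2, hb']
    ring
  exact Ideal.mem_span_singleton.1 (hle ((mem_H a).2 ⟨b, hab⟩))

namespace TateOortAction.FixesOrigin

variable {O : Type*} [CommRing O] {α β : O} {h : α * β = 2} [IsDomain O] [IsPrincipalIdealRing O]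
  [IsLocalRing O] {A : TateOortAction α β h (MvPowerSeries (Fin 2) O)} (hA : A.FixesOrigin)

omit [IsDomain O] in
theorem _root_.IsLocalRing.exists_maximalIdeal_eq_span :
    ∃ π : O, maximalIdeal O = Ideal.span {π} :=
  (IsPrincipalIdealRing.principal (maximalIdeal O)).principal

include hA

/-- The fixed ideal reduces to one containing u^N and v^N; lifts of these inside it are the regular
pair. Only this pair, not δu and δv themselves, is visibly regular, and `exists_koszul` transfers
the property. -/
theorem exists_regular : ∃ s ∈ Ideal.span {A.δ (X 0), A.δ (X 1)},
    ∃ t ∈ Ideal.span {A.δ (X 0), A.δ (X 1)}, s ≠ 0 ∧ ∀ a b, t * a = s * b → s ∣ a := by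
  obtain ⟨π, hπ⟩ := exists_maximalIdeal_eq_span (O := O)
  obtain ⟨N, hN⟩ := hA.pow_le
  obtain ⟨s, hs, es⟩ := (Ideal.mem_map_iff_of_surjective _ (map_surjective residue_surjective)).1
    (hN (Ideal.pow_mem_pow (X_mem_varIdeal 0) N))
  obtain ⟨t, ht, et⟩ := (Ideal.mem_map_iff_of_surjective _ (map_surjective residue_surjective)).1
    (hN (Ideal.pow_mem_pow (X_mem_varIdeal 1) N))
  refine ⟨s, hs, t, ht, ?_, dvd_of_map_eq_X_pow hπ es et⟩
  rintro rfl
  have h0 : (X 0 : MvPowerSeries (Fin 2) (ResidueField O)) ^ N ≠ 0 := pow_ne_zero _ (by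
    intro h
    have := congrArg (coeff (Finsupp.single 0 1)) h
    simp at this)
  exact h0 (by rw [← es, map_zero])

theorem δ_ne_zero : A.δ (X 0) ≠ 0 ∨ A.δ (X 1) ≠ 0 := by
  by_contra! h0
  obtain ⟨s, hs, t, ht, hs0, -⟩ := hA.exists_regular
  rw [h0.1, h0.2] at hs
  simp at hs
  exact hs0 hs

theorem koszul {f g : MvPowerSeries (Fin 2) O} (hfg : A.δ (X 0) * f + A.δ (X 1) * g = 0) :
    ∃ w, f = A.δ (X 1) * w ∧ g = -(A.δ (X 0) * w) := by
  obtain ⟨s, hs, t, ht, hs0, hst⟩ := hA.exists_regular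
  exact exists_koszul hs ht hs0 hst hfg

theorem eq_zero_of_sum {r : Fin 4 → MvPowerSeries (Fin 2) O}
    (hr : ∑ i, subst A.norms (r i) * ![1, X 0, X 1, X 0 * X 1] i = 0) : r = 0 := by
  obtain ⟨π, hπ⟩ := exists_maximalIdeal_eq_span (O := O)
  exact eq_zero_of_sum_subst_four hπ (hA.smul_trace_mem 0) (hA.smul_trace_mem 1)
    (A.mul_conj_eq _) (A.mul_conj_eq _) hr

/-- An invariant is c₀ + T(w·u·conj v), where T is the trace. With w expanded in 1, conj u, v, (conj
u)v, the four products are u·conj v, x·conj v, y·u and xy, with traces z, xb, ya and βxy. So modulo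
(x, y) times invariants only constants and multiples of z remain. -/
theorem exists_eq_add_mul_trace {f : MvPowerSeries (Fin 2) O} (hf : A.δ f = 0) :
    ∃ r₀ r₁ : MvPowerSeries (Fin 2) O,
      f = subst A.norms r₀ + subst A.norms r₁ * A.trace (X 0 * A.conj (X 1)) := by
  suffices hs : ∃ r : Fin 2 → MvPowerSeries (Fin 2) O,
      f = ∑ i, subst A.norms (r i) * ![1, A.trace (X 0 * A.conj (X 1))] i by
    obtain ⟨r, hr⟩ := hs
    exact ⟨r 0, r 1, by rw [hr]; simp⟩
  -- The approximation runs inside the set of invariants, so the coefficients of x and y produced at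
  -- each stage must be checked to be invariant.
  refine exists_eq_sum_subst A.norms_mem _ {f | A.δ f = 0} (fun f hf => ?_) hf
  obtain ⟨r, hr⟩ := hA.exists_eq_sum f
  simp only [Fin.sum_univ_four, Matrix.cons_val, mul_one] at hr
  obtain ⟨w, hw⟩ := A.exists_eq_add_trace (fun _ _ => hA.koszul) hA.δ_ne_zero
    (A.δ_subst_norms _) (A.δ_subst_norms _) (A.δ_subst_norms _) (A.δ_subst_norms _) hr hf
  obtain ⟨s, hs⟩ := hA.exists_eq_sum_conj w
  simp only [Fin.sum_univ_four, Matrix.cons_val, mul_one] at hs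
  obtain ⟨k, g, hk⟩ := exists_eq_C_add_sum (r 0)
  obtain ⟨l, m, hl⟩ := exists_eq_C_add_sum (s 0)
  set z := A.trace (X 0 * A.conj (X 1)) with hz
  have hT := fun c f => A.trace_mul_of_δ_eq_zero (A.δ_subst_norms c) f
  have hT' : ∀ (c : MvPowerSeries (Fin 2) O) (i : Fin 2) f,
      A.trace (subst A.norms c * (A.norms i * f)) = subst A.norms c * (A.norms i * A.trace f) := by
    intro c i f
    rw [hT, trace_mul_of_δ_eq_zero]
    fin_cases i
    · exact A.δ_mul_conj _
    · exact A.δ_mul_conj _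
  have e : w * (X 0 * A.conj (X 1)) = subst A.norms (s 0) * (X 0 * A.conj (X 1)) +
      subst A.norms (s 1) * (A.norms 0 * A.conj (X 1)) +
      subst A.norms (s 2) * (A.norms 1 * X 0) +
      subst A.norms (s 3) * (A.norms 0 * (A.norms 1 * 1)) := by
    rw [hs]
    simp only [norms, Matrix.cons_val_zero, Matrix.cons_val_one]
    ring
  have e2 : A.trace (subst A.norms (s 3) * (A.norms 0 * (A.norms 1 * 1))) =
      subst A.norms (s 3) * (A.norms 0 * (A.norms 1 * C β)) := by
    have : A.δ (A.norms 1) = 0 := A.δ_mul_conj _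
    rw [hT', trace_mul_of_δ_eq_zero A this, trace_one]
    rfl
  rw [e, map_add, map_add, map_add, hT, hT', hT', e2, trace_conj, ← hz, hk, hl,
    subst_C_add_sum A.hasSubst_norms, subst_C_add_sum A.hasSubst_norms] at hw
  refine ⟨![k, l], ![subst A.norms (g 0) + subst A.norms (m 0) * z +
      subst A.norms (s 1) * A.trace (X 1) + subst A.norms (s 3) * (A.norms 1 * C β),
    subst A.norms (g 1) + subst A.norms (m 1) * z + subst A.norms (s 2) * A.trace (X 0)], ?_, ?_⟩
  · have hd := A.δ_subst_norms
    have hn : A.δ (A.norms 1) = 0 := A.δ_mul_conj _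
    have hC : A.δ (C β) = 0 := A.δ_algebraMap _
    rw [Fin.forall_fin_two]
    constructor
    · simp [δ_mul', hd, hn, hC, hz, δ_trace]
    · simp [δ_mul', hd, hz, δ_trace]
  · rw [hw]
    simp [Fin.sum_univ_two]
    ring

end TateOortAction.FixesOrigin

/-! ### Division by the equation and the presentation of the invariant ring. -/

/-- Division with remainder by the equation of the quotient. -/
theorem MvPowerSeries.exists_eq_add_equation_mul {O : Type*} [CommRing O] (α β : O)
    {a b F : MvPowerSeries (Fin 3) O} (ha : a ∈ varIdeal (Fin 3) O) (hb : b ∈ varIdeal (Fin 3) O)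
    (hF : F = X 2 ^ 2 - C α * (a * b * X 2) + a ^ 2 * X 1 + b ^ 2 * X 0 -
      C β ^ 2 * (X 0 * X 1)) (f : MvPowerSeries (Fin 3) O) :
    ∃ (r₀ r₁ : MvPowerSeries (Fin 2) O) (q : MvPowerSeries (Fin 3) O),
      f = subst ![X 0, X 1] r₀ + subst ![X 0, X 1] r₁ * X 2 + F * q := by
  have hsplit : ∀ f : MvPowerSeries (Fin 3) O, ∃ r f₀ f₁ f₂,
      f = C r + X 0 * f₀ + X 1 * f₁ + X 2 * f₂ := by
    intro f
    obtain ⟨r, g, hg⟩ := exists_eq_C_add_sum f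
    exact ⟨r, g 0, g 1, g 2, by rw [hg, Fin.sum_univ_three]; ring⟩
  obtain ⟨ra, a₀, a₁, a₂, ea⟩ := hsplit a
  obtain ⟨rb, b₀, b₁, b₂, eb⟩ := hsplit b
  have hra : ra = 0 := by
    rw [mem_varIdeal_iff, ea] at ha; simpa using ha
  have hrb : rb = 0 := by
    rw [mem_varIdeal_iff, eb] at hb; simpa using hb
  rw [hra, map_zero, zero_add] at ea
  rw [hrb, map_zero, zero_add] at eb
  obtain ⟨w, hw⟩ : ∃ w, (1 - C α * a₂ * b₂ * X 2) * w = 1 := by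
    refine IsUnit.exists_right_inv ?_
    rw [isUnit_iff_constantCoeff]
    simp
  set p := -(C α * X 2 * (a₀ * b + X 2 * a₂ * b₀)) + b ^ 2 - C β ^ 2 * X 1 with hp
  set q := -(C α * X 2 * (a₁ * b + X 2 * a₂ * b₁)) + a ^ 2 with hq
  have hF' : F = X 2 ^ 2 * (1 - C α * a₂ * b₂ * X 2) + X 0 * p + X 1 * q := by
    rw [hF, hp, hq]
    linear_combination (-C α * b * X 2) * ea - C α * X 2 ^ 2 * a₂ * eb
  have hFm : F ∈ varIdeal (Fin 3) O := by
    rw [hF', sq, mul_assoc]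
    exact add_mem (add_mem (Ideal.mul_mem_right _ _ (X_mem_varIdeal _))
      (Ideal.mul_mem_right _ _ (X_mem_varIdeal _))) (Ideal.mul_mem_right _ _ (X_mem_varIdeal _))
  have ht : ∀ j : Fin 3, ![X 0, X 1, F] j ∈ varIdeal (Fin 3) O := by
    simp [Fin.forall_fin_succ, X_mem_varIdeal, hFm]
  have ht2 : ∀ j : Fin 2, ![X 0, X 1] j ∈ varIdeal (Fin 3) O := by
    simp [Fin.forall_fin_succ, X_mem_varIdeal]
  have hs : HasSubst ![X 0, X 1, F] :=
    hasSubst_of_constantCoeff_zero fun i => mem_varIdeal_iff.1 (ht i)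
  obtain ⟨c, hc⟩ := exists_eq_sum_subst ht ![1, X 2] Set.univ (f := f) (fun g _ => by
    obtain ⟨r, g₀, g₁, g₂, eg⟩ := hsplit g
    obtain ⟨s, k₀, k₁, k₂, ek⟩ := hsplit g₂
    refine ⟨![r, s], ![g₀ + X 2 * k₀ - w * p * k₂, g₁ + X 2 * k₁ - w * q * k₂, w * k₂],
      fun _ => Set.mem_univ _, ?_⟩
    simp [Fin.sum_univ_two, Fin.sum_univ_three]
    linear_combination eg + X 2 * ek - w * k₂ * hF' - X 2 ^ 2 * k₂ * hw) (Set.mem_univ f)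
  have hred : ∀ c : MvPowerSeries (Fin 3) O, ∃ (r : MvPowerSeries (Fin 2) O)
      (q : MvPowerSeries (Fin 3) O), subst ![X 0, X 1, F] c = subst ![X 0, X 1] r + F * q := by
    intro c
    obtain ⟨r, q, hrq⟩ := exists_eq_subst_add_X_mul c
    refine ⟨r, subst ![X 0, X 1, F] q, ?_⟩
    have hs2 : HasSubst (![X 0, X 1] : Fin 2 → MvPowerSeries (Fin 3) O) :=
      hasSubst_of_constantCoeff_zero fun i => mem_varIdeal_iff.1 (ht2 i)
    conv_lhs => rw [hrq, subst_add hs, subst_mul hs, subst_X hs, subst_comp_subst_apply hs2 hs]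
    congr 2
    ext i : 1
    fin_cases i
    · exact subst_X hs 0
    · exact subst_X hs 1
  obtain ⟨r₀, q₀, h₀⟩ := hred (c 0)
  obtain ⟨r₁, q₁, h₁⟩ := hred (c 1)
  refine ⟨r₀, r₁, q₀ + q₁ * X 2, ?_⟩
  rw [hc]
  simp only [Fin.sum_univ_two, Matrix.cons_val_zero, Matrix.cons_val_one, h₀, h₁]
  simp
  ring

namespace TateOortAction.FixesOrigin

variable {O : Type*} [CommRing O] {α β : O} {h : α * β = 2}
  [IsLocalRing O] {A : TateOortAction α β h (MvPowerSeries (Fin 2) O)} (hA : A.FixesOrigin)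

include hA

theorem subst_invTriple_subst (r : MvPowerSeries (Fin 2) O) :
    subst A.invTriple (subst (![X 0, X 1] : Fin 2 → MvPowerSeries (Fin 3) O) r) =
      subst A.norms r := by
  have hs2 : HasSubst (![X 0, X 1] : Fin 2 → MvPowerSeries (Fin 3) O) :=
    hasSubst_of_constantCoeff_zero (by simp [Fin.forall_fin_two])
  rw [subst_comp_subst_apply hs2 hA.hasSubst_invTriple]
  congr 1
  ext i : 1
  fin_cases i
  · exact subst_X hA.hasSubst_invTriple 0
  · exact subst_X hA.hasSubst_invTriple 1

/-- Substitution preserves constant terms. This guarantees that arbitrary lifts of the two traces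
have none, as the division by the equation requires. -/
theorem mem_varIdeal_of_subst_mem {f : MvPowerSeries (Fin 3) O}
    (hf : subst A.invTriple f ∈ varIdeal (Fin 2) O) : f ∈ varIdeal (Fin 3) O := by
  obtain ⟨r, g, rfl⟩ := exists_eq_C_add_sum f
  have h1 : ∑ j, A.invTriple j * subst A.invTriple (g j) ∈ varIdeal (Fin 2) O :=
    sum_mem fun j _ => Ideal.mul_mem_right _ _ (hA.invTriple_mem j)
  rw [subst_C_add_sum hA.hasSubst_invTriple] at hf
  have h2 := sub_mem hf h1
  rw [add_sub_cancel_right, mem_varIdeal_iff, constantCoeff_C] at h2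
  rw [h2, map_zero, zero_add]
  exact sum_mem fun j _ => Ideal.mul_mem_right _ _ (X_mem_varIdeal j)

theorem subst_equation {a b F : MvPowerSeries (Fin 3) O}
    (ha : subst A.invTriple a = A.trace (X 0)) (hb : subst A.invTriple b = A.trace (X 1))
    (hF : F = X 2 ^ 2 - C α * (a * b * X 2) + a ^ 2 * X 1 + b ^ 2 * X 0 -
      C β ^ 2 * (X 0 * X 1)) : subst A.invTriple F = 0 := by
  have hs := hA.hasSubst_invTriple
  rw [hF]
  simp only [subst_sub hs, subst_add hs, subst_mul hs, subst_pow hs, subst_X hs, subst_C, ha, hb]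
  exact A.equation (X 0) (X 1)

theorem exists_eq_add_equation_mul {a b F : MvPowerSeries (Fin 3) O}
    (ha : subst A.invTriple a = A.trace (X 0)) (hb : subst A.invTriple b = A.trace (X 1))
    (hF : F = X 2 ^ 2 - C α * (a * b * X 2) + a ^ 2 * X 1 + b ^ 2 * X 0 -
      C β ^ 2 * (X 0 * X 1)) (f : MvPowerSeries (Fin 3) O) :
    ∃ (r₀ r₁ : MvPowerSeries (Fin 2) O) (q : MvPowerSeries (Fin 3) O),
      f = subst ![X 0, X 1] r₀ + subst ![X 0, X 1] r₁ * X 2 + F * q :=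
  MvPowerSeries.exists_eq_add_equation_mul α β
    (hA.mem_varIdeal_of_subst_mem (ha ▸ trace_mem_varIdeal A hA.δ_mem (X_mem_varIdeal _)))
    (hA.mem_varIdeal_of_subst_mem (hb ▸ trace_mem_varIdeal A hA.δ_mem (X_mem_varIdeal _))) hF f

variable [IsDomain O] [IsPrincipalIdealRing O]

theorem eq_zero_of_subst_norms_eq_zero {r : MvPowerSeries (Fin 2) O}
    (hr : subst A.norms r = 0) : r = 0 := by
  have hz : subst A.norms (0 : MvPowerSeries (Fin 2) O) = 0 := by
    rw [← substAlgHom_apply A.hasSubst_norms, map_zero]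
  have := hA.eq_zero_of_sum (r := ![r, 0, 0, 0]) (by simp [Fin.sum_univ_four, hr, hz])
  exact congrFun this 0

/-- `1` and `z` are independent over `O[[x, y]]`. -/
theorem eq_zero_of_add_mul_trace {r₀ r₁ : MvPowerSeries (Fin 2) O}
    (hr : subst A.norms r₀ + subst A.norms r₁ * A.trace (X 0 * A.conj (X 1)) = 0) :
    r₀ = 0 ∧ r₁ = 0 := by
  have hs := A.hasSubst_norms
  suffices h1 : r₁ = 0 by
    refine ⟨hA.eq_zero_of_subst_norms_eq_zero ?_, h1⟩
    rw [← hr, h1, ← substAlgHom_apply hs, ← substAlgHom_apply hs, map_zero, zero_mul, add_zero]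
  by_contra h1
  have h1' : subst A.norms r₁ ≠ 0 := fun h0 => h1 (hA.eq_zero_of_subst_norms_eq_zero h0)
  obtain ⟨a₀, a₁, ea⟩ := hA.exists_eq_add_mul_trace (A.δ_trace (X 0))
  obtain ⟨b₀, b₁, eb⟩ := hA.exists_eq_add_mul_trace (A.δ_trace (X 1))
  set z := A.trace (X 0 * A.conj (X 1)) with hz
  -- The supposed relation says r₁z = -r₀, so multiplication by r₁ carries the trace into the series
  -- in x and y.
  have ea' : subst A.norms r₁ * A.trace (X 0) = subst A.norms (r₁ * a₀ - a₁ * r₀) := by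
    rw [subst_sub hs, subst_mul hs, subst_mul hs]
    linear_combination subst A.norms r₁ * ea + subst A.norms a₁ * hr
  have eb' : subst A.norms r₁ * A.trace (X 1) = subst A.norms (r₁ * b₀ - b₁ * r₀) := by
    rw [subst_sub hs, subst_mul hs, subst_mul hs]
    linear_combination subst A.norms r₁ * eb + subst A.norms b₁ * hr
  have hz' : z = A.trace (X 0) * X 1 + A.trace (X 1) * X 0 - C β * (X 0 * X 1) :=
    A.trace_mul_conj_eq _ _
  -- Substituting z = av + bu - βuv gives a relation among 1, u, v, uv over the norms. Its vanishing
  -- forces β = a = b = 0, hence δu = δv = 0, a contradiction.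
  have key := hA.eq_zero_of_sum (r := ![r₀, r₁ * b₀ - b₁ * r₀, r₁ * a₀ - a₁ * r₀, -(C β * r₁)]) (by
    simp only [Fin.sum_univ_four, Matrix.cons_val]
    rw [← ea', ← eb', ← neg_mul, subst_mul hs, ← map_neg, subst_C, map_neg]
    linear_combination hr - subst A.norms r₁ * hz')
  have k1 : r₁ * b₀ - b₁ * r₀ = 0 := congrFun key 1
  have k2 : r₁ * a₀ - a₁ * r₀ = 0 := congrFun key 2
  have k3 : -(C β * r₁) = 0 := congrFun key 3
  have hβ : (C β : MvPowerSeries (Fin 2) O) = 0 :=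
    (mul_eq_zero.1 (neg_eq_zero.1 k3)).resolve_right h1
  have hzero : subst A.norms (0 : MvPowerSeries (Fin 2) O) = 0 := by
    rw [← substAlgHom_apply hs, map_zero]
  rw [k1, hzero] at eb'
  rw [k2, hzero] at ea'
  have hβ' : algebraMap O (MvPowerSeries (Fin 2) O) β = 0 := hβ
  have t0 := (mul_eq_zero.1 ea').resolve_left h1'
  have t1 := (mul_eq_zero.1 eb').resolve_left h1'
  rw [trace_apply, hβ', zero_mul, zero_add] at t0 t1
  rcases hA.δ_ne_zero with h0 | h0
  · exact h0 t0
  · exact h0 t1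

theorem exists_subst_invTriple_eq {f : MvPowerSeries (Fin 2) O} (hf : A.δ f = 0) :
    ∃ g : MvPowerSeries (Fin 3) O, subst A.invTriple g = f := by
  obtain ⟨r₀, r₁, rfl⟩ := hA.exists_eq_add_mul_trace hf
  have hs := hA.hasSubst_invTriple
  refine ⟨subst ![X 0, X 1] r₀ + subst ![X 0, X 1] r₁ * X 2, ?_⟩
  rw [subst_add hs, subst_mul hs, subst_X hs, hA.subst_invTriple_subst, hA.subst_invTriple_subst]
  rfl

theorem range_subst_invTriple :
    Set.range (fun f : MvPowerSeries (Fin 3) O => subst A.invTriple f) =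
      (A.invariants : Set (MvPowerSeries (Fin 2) O)) := by
  ext f
  rw [SetLike.mem_coe, mem_invariants_iff]
  constructor
  · rintro ⟨g, rfl⟩
    exact hA.δ_subst_invTriple g
  · exact hA.exists_subst_invTriple_eq

/-- Division by `F` leaves a remainder linear in the third variable, which the independence of 1 and
z kills. -/
theorem subst_invTriple_eq_zero_iff {a b F : MvPowerSeries (Fin 3) O}
    (ha : subst A.invTriple a = A.trace (X 0)) (hb : subst A.invTriple b = A.trace (X 1))
    (hF : F = X 2 ^ 2 - C α * (a * b * X 2) + a ^ 2 * X 1 + b ^ 2 * X 0 -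
      C β ^ 2 * (X 0 * X 1)) {f : MvPowerSeries (Fin 3) O} :
    subst A.invTriple f = 0 ↔ F ∣ f := by
  have hs := hA.hasSubst_invTriple
  have hF0 := hA.subst_equation ha hb hF
  constructor
  · intro hf
    obtain ⟨r₀, r₁, q, rfl⟩ := hA.exists_eq_add_equation_mul ha hb hF f
    rw [subst_add hs, subst_add hs, subst_mul hs, subst_mul hs, hF0, subst_X hs, zero_mul,
      add_zero, hA.subst_invTriple_subst, hA.subst_invTriple_subst] at hf
    obtain ⟨rfl, rfl⟩ := hA.eq_zero_of_add_mul_trace hf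
    have hs2 : HasSubst (![X 0, X 1] : Fin 2 → MvPowerSeries (Fin 3) O) :=
      hasSubst_of_constantCoeff_zero (by simp [Fin.forall_fin_two])
    rw [← substAlgHom_apply hs2, map_zero, zero_mul, zero_add, zero_add]
    exact dvd_mul_right _ _
  · rintro ⟨q, rfl⟩
    rw [subst_mul hs, hF0, zero_mul]

/-- The presentation of the ring of invariants. -/
theorem exists_quotient_equiv {a b F : MvPowerSeries (Fin 3) O}
    (ha : subst A.invTriple a = A.trace (X 0)) (hb : subst A.invTriple b = A.trace (X 1))
    (hF : F = X 2 ^ 2 - C α * (a * b * X 2) + a ^ 2 * X 1 + b ^ 2 * X 0 -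
      C β ^ 2 * (X 0 * X 1)) :
    ∃ e : (MvPowerSeries (Fin 3) O ⧸ Ideal.span {F}) ≃ₐ[O] A.invariants,
      ∀ f : MvPowerSeries (Fin 3) O,
        (e (Ideal.Quotient.mk _ f) : MvPowerSeries (Fin 2) O) = subst A.invTriple f := by
  have hs := hA.hasSubst_invTriple
  let φ : MvPowerSeries (Fin 3) O →ₐ[O] A.invariants := (substAlgHom hs).codRestrict _ fun f => by
    rw [mem_invariants_iff, substAlgHom_apply]
    exact hA.δ_subst_invTriple f
  have hφ : ∀ f, (φ f : MvPowerSeries (Fin 2) O) = subst A.invTriple f := fun f =>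
    substAlgHom_apply hs f
  have hker : ∀ f, φ f = 0 ↔ f ∈ Ideal.span {F} := fun f => by
    rw [Ideal.mem_span_singleton, ← hA.subst_invTriple_eq_zero_iff ha hb hF, ← hφ,
      ZeroMemClass.coe_eq_zero]
  let ψ := Ideal.Quotient.liftₐ (Ideal.span {F}) φ fun f hf => (hker f).2 hf
  have hψ : ∀ f, ψ (Ideal.Quotient.mk _ f) = φ f := fun f => rfl
  have hbij : Function.Bijective ψ := by
    constructor
    · rw [injective_iff_map_eq_zero]
      intro f hf
      obtain ⟨f, rfl⟩ := Ideal.Quotient.mk_surjective f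
      rw [Ideal.Quotient.eq_zero_iff_mem, ← hker, ← hψ, hf]
    · rintro ⟨f, hf⟩
      obtain ⟨g, rfl⟩ := hA.exists_subst_invTriple_eq (A.mem_invariants_iff.1 hf)
      exact ⟨Ideal.Quotient.mk _ g, Subtype.ext (hφ g)⟩
  exact ⟨AlgEquiv.ofBijective ψ hbij, fun f => hφ f⟩

end TateOortAction.FixesOrigin

/-! ### From conditions on fixed loci to algebra, and passage to the special fiber. -/

namespace MvPowerSeries

theorem varIdeal_isPrime {σ R : Type*} [Finite σ] [CommRing R] [IsDomain R] :
    (varIdeal σ R).IsPrime := by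
  have e : varIdeal σ R = RingHom.ker (constantCoeff (σ := σ) (R := R)) := by
    ext f
    rw [mem_varIdeal_iff, RingHom.mem_ker]
  rw [e]
  exact RingHom.ker_isPrime _

end MvPowerSeries

namespace TateOortAction

/-- Over a domain the ideal of the variables is prime, hence itself a point of the zero locus;
evaluating the inclusion at that point suffices. -/
theorem δ_mem_varIdeal_of_zeroLocus_subset {O : Type*} [CommRing O] [IsDomain O] {α β : O}
    {h : α * β = 2} {A : TateOortAction α β h (MvPowerSeries (Fin 2) O)}
    (hfix : PrimeSpectrum.zeroLocus {X 0, X 1} ⊆ A.fixedLocus) (f : MvPowerSeries (Fin 2) O) :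
    A.δ f ∈ varIdeal (Fin 2) O := by
  have hm : (⟨varIdeal (Fin 2) O, varIdeal_isPrime⟩ : PrimeSpectrum _) ∈
      PrimeSpectrum.zeroLocus {(X 0 : MvPowerSeries (Fin 2) O), X 1} := by
    rw [PrimeSpectrum.mem_zeroLocus]
    rintro _ (rfl | rfl) <;> exact X_mem_varIdeal _
  have := hfix hm
  rw [fixedLocus, PrimeSpectrum.mem_zeroLocus] at this
  exact this (Ideal.subset_span ⟨f, rfl⟩)

theorem exists_varIdeal_pow_le {O : Type*} [CommRing O] {α β : O}
    {h : α * β = 2} {A : TateOortAction α β h (MvPowerSeries (Fin 2) O)}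
    (hfix : A.fixedLocus ⊆ PrimeSpectrum.zeroLocus {X 0, X 1}) :
    ∃ N, varIdeal (Fin 2) O ^ N ≤ A.fixedIdeal := by
  refine Ideal.exists_pow_le_of_le_radical_of_fg ?_ varIdeal_fg
  rw [fixedLocus, ← PrimeSpectrum.zeroLocus_span {X 0, X 1},
    PrimeSpectrum.zeroLocus_subset_zeroLocus_iff, ← varIdeal_two] at hfix
  exact hfix

theorem varIdeal_pow_le_span {K : Type*} [Field K] {α β : K} {h : α * β = 2}
    {A : TateOortAction α β h (MvPowerSeries (Fin 2) K)} {N : ℕ}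
    (hN : varIdeal (Fin 2) K ^ N ≤ A.fixedIdeal) :
    varIdeal (Fin 2) K ^ N ≤ Ideal.span {A.δ (X 0), A.δ (X 1)} := by
  refine Ideal.le_of_le_sup_maximalIdeal_mul varIdeal_fg.pow ?_
  rw [maximalIdeal_eq_varIdeal, ← pow_succ']
  refine hN.trans ?_
  rw [fixedIdeal, Ideal.span_le]
  rintro _ ⟨f, rfl⟩
  exact δ_mem_sup A varIdeal_two f (N + 1)

theorem fixesOrigin_of_field {K : Type*} [Field K] {α β : K} {h : α * β = 2}
    {A : TateOortAction α β h (MvPowerSeries (Fin 2) K)}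
    (hA : ∀ f, A.δ f ∈ varIdeal (Fin 2) K) {N : ℕ} (hN : varIdeal (Fin 2) K ^ N ≤ A.fixedIdeal) :
    A.FixesOrigin where
  δ_mem := hA
  trace_mem i := by
    rw [maximalIdeal_eq_varIdeal, ← sq]
    exact trace_mem_varIdeal_sq A hA hN i
  pow_le := ⟨N, by
    rw [← map_varIdeal (residue K), ← Ideal.map_pow]
    exact Ideal.map_mono (varIdeal_pow_le_span hN)⟩

variable {O : Type*} [CommRing O] [IsDomain O] [IsPrincipalIdealRing O] [IsLocalRing O]
  {α β : O} {h : α * β = 2} {A : TateOortAction α β h (MvPowerSeries (Fin 2) O)}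

theorem specialFiber_trace_map (f : MvPowerSeries (Fin 2) O) :
    A.specialFiber.trace (map (residue O) f) = map (residue O) (A.trace f) := by
  rw [trace_apply, trace_apply, map_add, map_mul (map (residue O)), specialFiber_δ_map]
  congr 2
  exact (map_C (f := residue O) β).symm

theorem specialFiber_conj_map (f : MvPowerSeries (Fin 2) O) :
    A.specialFiber.conj (map (residue O) f) = map (residue O) (A.conj f) := by
  rw [conj, conj, map_add, map_mul (map (residue O)), specialFiber_δ_map]
  congr 2
  exact (map_C (f := residue O) α).symm

theorem map_span_δ : (Ideal.span {A.δ (X 0), A.δ (X 1)}).map (map (residue O)) =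
    Ideal.span {A.specialFiber.δ (X 0), A.specialFiber.δ (X 1)} := by
  rw [Ideal.map_span, Set.image_pair, ← specialFiber_δ_map, ← specialFiber_δ_map, map_X, map_X]

theorem fixesOrigin_of_specialFiber (hA : ∀ f, A.δ f ∈ varIdeal (Fin 2) O)
    (hAk : ∀ f, A.specialFiber.δ f ∈ varIdeal (Fin 2) (ResidueField O)) {N : ℕ}
    (hN : varIdeal (Fin 2) (ResidueField O) ^ N ≤ A.specialFiber.fixedIdeal) :
    A.FixesOrigin where
  δ_mem := hA
  trace_mem i := by
    obtain ⟨π, hπ⟩ := exists_maximalIdeal_eq_span (O := O)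
    refine mem_maximalIdeal_mul_varIdeal hπ (trace_mem_varIdeal A hA (X_mem_varIdeal _)) ?_
    rw [← specialFiber_trace_map, map_X]
    exact trace_mem_varIdeal_sq _ hAk hN i
  pow_le := ⟨N, by
    rw [map_span_δ]
    exact varIdeal_pow_le_span hN⟩

theorem map_invTriple (i : Fin 3) :
    map (residue O) (A.invTriple i) = A.specialFiber.invTriple i := by
  fin_cases i
  · simp [invTriple, ← specialFiber_conj_map]
  · simp [invTriple, ← specialFiber_conj_map]
  · simp [invTriple, ← specialFiber_conj_map, ← specialFiber_trace_map]

theorem FixesOrigin.map_subst_invTriple (hA : A.FixesOrigin) (f : MvPowerSeries (Fin 3) O) :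
    subst A.specialFiber.invTriple (map (residue O) f) =
      map (residue O) (subst A.invTriple f) := by
  rw [map_subst hA.hasSubst_invTriple]
  congr 1
  ext i : 1
  exact (map_invTriple i).symm

end TateOortAction

/-! ### Bases of quotients of power series rings. -/

namespace MvPowerSeries

variable {σ ι R : Type*} [CommRing R] [Fintype ι]

/-- The classes of the `e i` form a basis of the quotient of the power series ring by `I`. -/
def IsBasisMod (I : Ideal (MvPowerSeries σ R)) (e : ι → MvPowerSeries σ R) : Prop :=
  (∀ f, ∃ c : ι → R, f - ∑ i, C (c i) * e i ∈ I) ∧ ∀ c : ι → R, ∑ i, C (c i) * e i ∈ I → c = 0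

theorem IsBasisMod.exists_equiv {I : Ideal (MvPowerSeries σ R)} {e : ι → MvPowerSeries σ R}
    (he : IsBasisMod I e) : Nonempty ((ι → R) ≃ₗ[R] (MvPowerSeries σ R ⧸ I)) := by
  let φ : (ι → R) →ₗ[R] (MvPowerSeries σ R ⧸ I) :=
    (Ideal.Quotient.mkₐ R I).toLinearMap ∘ₗ Fintype.linearCombination R e
  have hφ : ∀ c, φ c = Ideal.Quotient.mk I (∑ i, C (c i) * e i) := fun c => by
    simp only [φ, LinearMap.comp_apply, Fintype.linearCombination_apply, smul_eq_C_mul]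
    rfl
  refine ⟨LinearEquiv.ofBijective φ ⟨?_, ?_⟩⟩
  · rw [injective_iff_map_eq_zero]
    intro c hc
    rw [hφ, Ideal.Quotient.eq_zero_iff_mem] at hc
    exact he.2 c hc
  · intro f
    obtain ⟨f, rfl⟩ := Ideal.Quotient.mk_surjective f
    obtain ⟨c, hc⟩ := he.1 f
    exact ⟨c, by rw [hφ, eq_comm, Ideal.Quotient.eq]; exact hc⟩

theorem IsBasisMod.finite {I : Ideal (MvPowerSeries σ R)} {e : ι → MvPowerSeries σ R}
    (he : IsBasisMod I e) : Module.Finite R (MvPowerSeries σ R ⧸ I) :=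
  Module.Finite.equiv he.exists_equiv.some

theorem IsBasisMod.finrank_eq [Nontrivial R] {I : Ideal (MvPowerSeries σ R)}
    {e : ι → MvPowerSeries σ R} (he : IsBasisMod I e) :
    Module.finrank R (MvPowerSeries σ R ⧸ I) = Fintype.card ι := by
  rw [← he.exists_equiv.some.finrank_eq, Module.finrank_fintype_fun_eq_card]

theorem exists_isBasisMod {K : Type*} [Field K] (I : Ideal (MvPowerSeries σ K))
    [Module.Finite K (MvPowerSeries σ K ⧸ I)] :
    ∃ e : Fin (Module.finrank K (MvPowerSeries σ K ⧸ I)) → MvPowerSeries σ K,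
      IsBasisMod I e := by
  let b := Module.finBasis K (MvPowerSeries σ K ⧸ I)
  choose e he using fun i => Ideal.Quotient.mk_surjective (b i)
  have hmk : ∀ c : _ → K, Ideal.Quotient.mk I (∑ i, C (c i) * e i) = ∑ i, c i • b i := by
    intro c
    rw [map_sum]
    refine Finset.sum_congr rfl fun i _ => ?_
    rw [← smul_eq_C_mul, ← he i]
    rfl
  refine ⟨e, fun f => ⟨b.repr (Ideal.Quotient.mk I f), ?_⟩, fun c hc => ?_⟩
  · rw [← Ideal.Quotient.eq, hmk, b.sum_repr]
  · rw [← Ideal.Quotient.eq_zero_iff_mem, hmk] at hc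
    exact funext fun i => Fintype.linearIndependent_iff.1 b.linearIndependent c hc i

theorem finite_quotient_of_varIdeal_pow_le {K : Type*} [Field K] [Finite σ]
    {I : Ideal (MvPowerSeries σ K)} {N : ℕ} (hN : varIdeal σ K ^ N ≤ I) :
    Module.Finite K (MvPowerSeries σ K ⧸ I) := by
  have := Fintype.ofFinite σ
  have key : ∀ n, ∃ W : Submodule K (MvPowerSeries σ K), W.FG ∧
      ∀ f, ∃ w ∈ W, f - w ∈ varIdeal σ K ^ n := by
    intro n
    induction n with
    | zero => exact ⟨⊥, Submodule.fg_bot, fun f => ⟨0, Submodule.zero_mem _, by simp⟩⟩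
    | succ n ih =>
      obtain ⟨W, hW, h⟩ := ih
      refine ⟨Submodule.span K {1} ⊔ ⨆ i, W.map (LinearMap.mulLeft K (X i)),
        (Submodule.fg_span_singleton _).sup (Submodule.fg_iSup _ fun i => hW.map _), fun f => ?_⟩
      obtain ⟨r, g, rfl⟩ := exists_eq_C_add_sum f
      choose w hw hgw using fun i => h (g i)
      refine ⟨r • 1 + ∑ i, X i * w i, Submodule.add_mem_sup
        (Submodule.smul_mem _ _ (Submodule.mem_span_singleton_self _)) (sum_mem fun i _ =>
          Submodule.mem_iSup_of_mem i ⟨w i, hw i, rfl⟩), ?_⟩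
      rw [smul_eq_C_mul, mul_one, add_sub_add_left_eq_sub, ← Finset.sum_sub_distrib, pow_succ']
      refine sum_mem fun i _ => ?_
      rw [← mul_sub]
      exact Ideal.mul_mem_mul (X_mem_varIdeal i) (hgw i)
  obtain ⟨W, hW, h⟩ := key N
  have := Module.Finite.iff_fg.2 hW
  refine Module.Finite.of_surjective ((Ideal.Quotient.mkₐ K I).toLinearMap ∘ₗ W.subtype) ?_
  intro f
  obtain ⟨f, rfl⟩ := Ideal.Quotient.mk_surjective f
  obtain ⟨w, hw, hfw⟩ := h f
  exact ⟨⟨w, hw⟩, (Ideal.Quotient.eq.2 (hN hfw)).symm⟩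

end MvPowerSeries

namespace MvPowerSeries

/-- `L` may be infinite over `K`, as happens for Frobenius on an imperfect field. Spanning follows
by descending induction on the order, which stops because `I` contains a power of the ideal of the
variables. For independence, a `K`-linear functional on `L`, applied coefficientwise, sends the
extended ideal back into `I`. -/
theorem IsBasisMod.map_algebraMap {σ ι K L : Type*} [Finite σ] [Fintype ι] [Field K] [Field L]
    [Algebra K L] {I : Ideal (MvPowerSeries σ K)} {e : ι → MvPowerSeries σ K}
    (he : IsBasisMod I e) {N : ℕ} (hN : varIdeal σ K ^ N ≤ I) :
    IsBasisMod (I.map (map (algebraMap K L))) fun i => map (algebraMap K L) (e i) := by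
  have := Fintype.ofFinite σ
  set J := I.map (map (σ := σ) (algebraMap K L)) with hJ
  constructor
  · have key : ∀ n m, N ≤ m + n → ∀ g ∈ varIdeal σ K ^ m, ∀ f : MvPowerSeries σ L,
        ∃ c : ι → L, map (algebraMap K L) g * f -
          ∑ i, C (c i) * map (algebraMap K L) (e i) ∈ J := by
      intro n
      induction n with
      | zero =>
        intro m hm g hg f
        refine ⟨0, ?_⟩
        simp only [Pi.zero_apply, map_zero, zero_mul, Finset.sum_const_zero, sub_zero]
        exact Ideal.mul_mem_right _ _ (Ideal.mem_map_of_mem _ (hN (Ideal.pow_le_pow_right hm hg)))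
      | succ n ih =>
        intro m hm g hg f
        obtain ⟨r, f', rfl⟩ := exists_eq_C_add_sum f
        obtain ⟨c, hc⟩ := he.1 g
        choose d hd using fun j => ih (m + 1) (by omega) (g * X j)
          (by rw [pow_succ]; exact Ideal.mul_mem_mul hg (X_mem_varIdeal j)) (f' j)
        refine ⟨fun i => r * algebraMap K L (c i) + ∑ j, d j i, ?_⟩
        have h1 := Ideal.mul_mem_left J (C r) (Ideal.mem_map_of_mem (map (algebraMap K L)) hc)
        have h2 := J.sum_mem (t := Finset.univ) fun j _ => hd j
        convert add_mem h1 h2 using 1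
        simp only [map_add, map_sub, map_mul, map_sum, map_C, map_X, Finset.sum_sub_distrib,
          add_mul, Finset.sum_add_distrib, mul_add, mul_sub, Finset.mul_sum, Finset.sum_mul]
        rw [Finset.sum_comm]
        simp only [mul_assoc]
        ring
    intro f
    obtain ⟨c, hc⟩ := key N 0 (by omega) 1 (by simp) f
    exact ⟨c, by simpa using hc⟩
  · intro c hc
    let Λ (l : L →ₗ[K] K) : MvPowerSeries σ L →+ MvPowerSeries σ K :=
      { toFun := fun f n => l (coeff n f)
        map_zero' := by ext n; exact l.map_zero
        map_add' := fun f g => by ext n; exact l.map_add _ _ }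
    have hΛ : ∀ l f n, coeff n (Λ l f) = l (coeff n f) := fun _ _ _ => rfl
    have hmul : ∀ l f a, Λ l (f * map (algebraMap K L) a) = Λ l f * a := by
      classical
      intro l f a
      ext n
      rw [hΛ, coeff_mul, coeff_mul, map_sum]
      refine Finset.sum_congr rfl fun p _ => ?_
      rw [hΛ, coeff_map, mul_comm, ← Algebra.smul_def, map_smul, smul_eq_mul, mul_comm]
    have hmem : ∀ l, ∀ f ∈ J, ∀ g, Λ l (g * f) ∈ I := by
      intro l f hf
      induction hf using Submodule.span_induction with
      | mem f hf =>
        obtain ⟨a, ha, rfl⟩ := hf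
        intro g
        rw [hmul]
        exact Ideal.mul_mem_left _ _ ha
      | zero => intro g; rw [mul_zero, map_zero]; exact zero_mem _
      | add f f' _ _ h h' => intro g; rw [mul_add, map_add]; exact add_mem (h g) (h' g)
      | smul r f _ h => intro g; rw [smul_eq_mul, ← mul_assoc]; exact h _
    have hC : ∀ l r, Λ l (C r) = C (l r) := by
      classical
      intro l r
      ext n
      rw [hΛ, coeff_C, coeff_C, apply_ite l, map_zero]
    funext i
    refine (Module.forall_dual_apply_eq_zero_iff K (c i)).1 fun l => ?_
    have := hmem l _ hc 1
    rw [one_mul, map_sum] at this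
    simp only [hmul, hC] at this
    exact congrFun (he.2 (fun i => l (c i)) this) i

theorem IsBasisMod.map_ringHom {σ ι K L : Type*} [Finite σ] [Fintype ι] [Field K] [Field L]
    (φ : K →+* L) {I : Ideal (MvPowerSeries σ K)} {e : ι → MvPowerSeries σ K}
    (he : IsBasisMod I e) {N : ℕ} (hN : varIdeal σ K ^ N ≤ I) :
    IsBasisMod (I.map (map φ)) fun i => map φ (e i) :=
  letI := φ.toAlgebra
  he.map_algebraMap hN

/-! ### The Tyurina ideal in characteristic two. -/

theorem charP_two_eq_zero {σ K : Type*} [CommRing K] [CharP K 2] : (2 : MvPowerSeries σ K) = 0 := by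
  rw [← map_ofNat C 2, CharTwo.two_eq_zero, map_zero]

theorem pderiv_sq {σ K : Type*} [CommRing K] [CharP K 2] (i : σ) (f : MvPowerSeries σ K) :
    pderiv K i (f ^ 2) = 0 := by
  rw [Derivation.leibniz_pow, two_smul, ← two_mul, charP_two_eq_zero, zero_mul]

/-- Squares have zero derivative, so a² and b² behave as constants and the derivative in the third
variable vanishes. -/
theorem tyurinaIdeal_equation {K : Type*} [Field K] [CharP K 2] {β : K}
    {a b F : MvPowerSeries (Fin 3) K}
    (hF : F = X 2 ^ 2 + a ^ 2 * X 1 + b ^ 2 * X 0 - C β ^ 2 * (X 0 * X 1)) :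
    tyurinaIdeal F = Ideal.span {F, b ^ 2 - C β ^ 2 * X 1, a ^ 2 - C β ^ 2 * X 0} := by
  have hD : ∀ i, pderiv K i F = a ^ 2 * pderiv K i (X 1) + b ^ 2 * pderiv K i (X 0) -
      C β ^ 2 * (X 0 * pderiv K i (X 1) + X 1 * pderiv K i (X 0)) := by
    intro i
    rw [hF]
    simp only [map_add, map_sub, Derivation.leibniz, pderiv_sq, smul_eq_mul, mul_zero, add_zero,
      zero_add]
  have h0 : pderiv K 0 F = b ^ 2 - C β ^ 2 * X 1 := by
    rw [hD, pderiv_X_self, pderiv_X_of_ne (by decide)]; ring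
  have h1 : pderiv K 1 F = a ^ 2 - C β ^ 2 * X 0 := by
    rw [hD, pderiv_X_self, pderiv_X_of_ne (by decide)]; ring
  have h2 : pderiv K 2 F = 0 := by
    rw [hD, pderiv_X_of_ne (by decide), pderiv_X_of_ne (by decide)]; ring
  rw [tyurinaIdeal]
  apply le_antisymm <;> rw [Ideal.span_le]
  · rintro _ (rfl | ⟨i, rfl⟩)
    · exact Ideal.subset_span (by simp)
    · fin_cases i
      · exact Ideal.subset_span (by simp [h0])
      · exact Ideal.subset_span (by simp [h1])
      · simp [h2]
  · rintro _ (rfl | rfl | rfl)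
    · exact Ideal.subset_span (by simp)
    · exact Ideal.subset_span (Or.inr ⟨0, h0⟩)
    · exact Ideal.subset_span (Or.inr ⟨1, h1⟩)

end MvPowerSeries

theorem TateOortAction.subst_norms_map_frobenius {K : Type*} [Field K] [CharP K 2] {α β : K}
    {h : α * β = 2} (A : TateOortAction α β h (MvPowerSeries (Fin 2) K)) (hα : α = 0)
    (f : MvPowerSeries (Fin 2) K) :
    subst A.norms (map (frobenius K 2) f) = f ^ 2 := by
  have e : A.norms = fun i => X i ^ 2 := by
    ext i : 1
    fin_cases i <;> simp [norms, conj, hα, sq]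
  have : ExpChar K 2 := ExpChar.prime Nat.prime_two
  rw [e, ← map_frobenius_expand 2 two_ne_zero, map_expand, expand, substAlgHom_apply]

namespace TateOortAction.FixesOrigin

variable {K : Type*} [Field K] [CharP K 2] {α β : K} {h : α * β = 2}
  {A : TateOortAction α β h (MvPowerSeries (Fin 2) K)} (hA : A.FixesOrigin)
include hA

/-- The ideal is (F, a², b²), and modulo F the squares of a = δu and b = δv become their Frobenius
twists as series in x, y. Since the invariants are free on 1, z over k[[x,y]], the Tyurina algebra
is two copies of k[[x,y]] modulo the twisted fixed ideal, and twisting carries a basis to a basis.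
-/
theorem isBasisMod_tyurinaIdeal_of_eq_zero (hα : α = 0) (hβ : β = 0)
    {a b F : MvPowerSeries (Fin 3) K}
    (ha : subst A.invTriple a = A.trace (X 0)) (hb : subst A.invTriple b = A.trace (X 1))
    (hF : F = X 2 ^ 2 - C α * (a * b * X 2) + a ^ 2 * X 1 + b ^ 2 * X 0 -
      C β ^ 2 * (X 0 * X 1)) {ι : Type*} [Fintype ι] {e : ι → MvPowerSeries (Fin 2) K}
    (he : IsBasisMod A.fixedIdeal e) {N : ℕ} (hN : varIdeal (Fin 2) K ^ N ≤ A.fixedIdeal) :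
    IsBasisMod (tyurinaIdeal F) (Sum.elim
      (fun i => subst ![X 0, X 1] (map (frobenius K 2) (e i)))
      fun i => subst ![X 0, X 1] (map (frobenius K 2) (e i)) * X 2) := by
  have hs := hA.hasSubst_invTriple
  have hs2 : HasSubst (![X 0, X 1] : Fin 2 → MvPowerSeries (Fin 3) K) :=
    hasSubst_of_constantCoeff_zero (by simp [Fin.forall_fin_two])
  have hz := hA.subst_equation ha hb hF
  have hJ : tyurinaIdeal F = Ideal.span {F, b ^ 2, a ^ 2} := by
    rw [tyurinaIdeal_equation (β := β) (a := a) (b := b) (by rw [hF, hα]; simp)]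
    simp [hβ]
  have htr : ∀ f, A.trace f = A.δ f := fun f => by simp [trace_apply, hβ]
  rw [htr] at ha hb
  set I := A.fixedIdeal.map (map (frobenius K 2)) with hI
  have hI' : I = Ideal.span {map (frobenius K 2) (A.δ (X 0)), map (frobenius K 2) (A.δ (X 1))} := by
    rw [hI, hA.fixedIdeal_eq, Ideal.map_span, Set.image_pair]
  set s := fun f : MvPowerSeries (Fin 2) K =>
    (subst (![X 0, X 1] : Fin 2 → MvPowerSeries (Fin 3) K) f) with hsd
  have hsub : ∀ f, subst A.invTriple (s f) = subst A.norms f := fun f => hA.subst_invTriple_subst f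
  have hsalg : ∀ f, s f = substAlgHom hs2 f := fun f => (substAlgHom_apply hs2 f).symm
  have key : ∀ (c : MvPowerSeries (Fin 3) K) (f : MvPowerSeries (Fin 2) K),
      subst A.invTriple c = f → F ∣ s (map (frobenius K 2) f) - c ^ 2 := by
    intro c f hc
    rw [← hA.subst_invTriple_eq_zero_iff (by rw [ha, htr]) (by rw [hb, htr]) hF,
      subst_sub hs, subst_pow hs, hsub, A.subst_norms_map_frobenius hα, hc, sub_self]
  have hsI : ∀ f ∈ I, s f ∈ tyurinaIdeal F := by
    have hle : I ≤ (tyurinaIdeal F).comap (substAlgHom hs2) := by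
      rw [hI', Ideal.span_le]
      rintro _ (rfl | rfl)
      · obtain ⟨q, hq⟩ := key _ _ ha
        rw [sub_eq_iff_eq_add] at hq
        change substAlgHom hs2 _ ∈ tyurinaIdeal F
        rw [← hsalg, hq, hJ]
        exact add_mem (Ideal.mul_mem_right _ _ (Ideal.subset_span (by simp)))
          (Ideal.subset_span (by simp))
      · obtain ⟨q, hq⟩ := key _ _ hb
        rw [sub_eq_iff_eq_add] at hq
        change substAlgHom hs2 _ ∈ tyurinaIdeal F
        rw [← hsalg, hq, hJ]
        exact add_mem (Ideal.mul_mem_right _ _ (Ideal.subset_span (by simp)))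
          (Ideal.subset_span (by simp))
    intro f hf
    rw [hsalg]
    exact hle hf
  have hsJ : ∀ r₀ r₁, s r₀ + s r₁ * X 2 ∈ tyurinaIdeal F → r₀ ∈ I ∧ r₁ ∈ I := by
    intro r₀ r₁ hr
    rw [hJ, Ideal.mem_span_insert] at hr
    obtain ⟨p, f, hf, hr⟩ := hr
    obtain ⟨q, q', rfl⟩ := Ideal.mem_span_pair.1 hf
    obtain ⟨p₀, p₁, p₂, rfl⟩ := hA.exists_eq_add_equation_mul
      (ha.trans (htr _).symm) (hb.trans (htr _).symm) hF q
    obtain ⟨p₀', p₁', p₂', rfl⟩ := hA.exists_eq_add_equation_mul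
      (ha.trans (htr _).symm) (hb.trans (htr _).symm) hF q'
    have h1 := congrArg (subst A.invTriple) hr
    simp only [subst_add hs, subst_mul hs, subst_pow hs, subst_X hs, hsub, hz, zero_mul,
      mul_zero, add_zero, zero_add, ha, hb, hA.subst_invTriple_subst,
      ← A.subst_norms_map_frobenius hα] at h1
    have hn := A.hasSubst_norms
    have h2 := hA.eq_zero_of_add_mul_trace
      (r₀ := r₀ - (p₀ * map (frobenius K 2) (A.δ (X 1)) + p₀' * map (frobenius K 2) (A.δ (X 0))))
      (r₁ := r₁ - (p₁ * map (frobenius K 2) (A.δ (X 1)) + p₁' * map (frobenius K 2) (A.δ (X 0)))) (by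
        simp only [subst_add hn, subst_mul hn, subst_sub hn]
        have h3 : A.invTriple 2 = A.trace (X 0 * A.conj (X 1)) := rfl
        rw [h3] at h1
        linear_combination h1)
    rw [sub_eq_zero, sub_eq_zero] at h2
    have h3 : ∀ p p' : MvPowerSeries (Fin 2) K, p * map (frobenius K 2) (A.δ (X 1)) +
        p' * map (frobenius K 2) (A.δ (X 0)) ∈ I := fun p p' => by
      rw [hI']
      exact add_mem (Ideal.mul_mem_left _ _ (Ideal.subset_span (by simp)))
        (Ideal.mul_mem_left _ _ (Ideal.subset_span (by simp)))
    exact ⟨h2.1 ▸ h3 _ _, h2.2 ▸ h3 _ _⟩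
  have he' := he.map_ringHom (frobenius K 2) hN
  have hsum : ∀ c : ι → K, s (∑ i, C (c i) * map (frobenius K 2) (e i)) =
      ∑ i, C (c i) * s (map (frobenius K 2) (e i)) := by
    intro c
    rw [hsalg, map_sum]
    refine Finset.sum_congr rfl fun i _ => ?_
    rw [← smul_eq_C_mul, ← smul_eq_C_mul, map_smul, hsalg]
  constructor
  · intro f
    obtain ⟨r₀, r₁, q, rfl⟩ := hA.exists_eq_add_equation_mul
      (ha.trans (htr _).symm) (hb.trans (htr _).symm) hF f
    obtain ⟨c₀, hc₀⟩ := he'.1 r₀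
    obtain ⟨c₁, hc₁⟩ := he'.1 r₁
    refine ⟨Sum.elim c₀ c₁, ?_⟩
    have h0 := hsI _ hc₀
    have h1 := Ideal.mul_mem_right (X 2) _ (hsI _ hc₁)
    rw [hsalg, map_sub, ← hsalg, ← hsalg, hsum] at h0 h1
    have h2 : F * q ∈ tyurinaIdeal F :=
      Ideal.mul_mem_right _ _ (Ideal.subset_span (Set.mem_insert _ _))
    convert add_mem (add_mem h0 h1) h2 using 1
    simp only [Fintype.sum_sum_type, Sum.elim_inl, Sum.elim_inr, ← mul_assoc, ← Finset.sum_mul,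
      hsd]
    ring
  · intro c hc
    simp only [Fintype.sum_sum_type, Sum.elim_inl, Sum.elim_inr, ← mul_assoc, ← Finset.sum_mul]
      at hc
    have h1 := hsJ (∑ i, C (c (Sum.inl i)) * map (frobenius K 2) (e i))
      (∑ i, C (c (Sum.inr i)) * map (frobenius K 2) (e i)) (by rw [hsum, hsum]; exact hc)
    have h2 := he'.2 _ h1.1
    have h3 := he'.2 _ h1.2
    ext i
    cases i with
    | inl i => exact congrFun h2 i
    | inr i => exact congrFun h3 i

/-- As β is invertible, the derivatives put X 0 and X 1 in the ideal up to second order, and `F`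
then does the same for X 2² up to third order. Nakayama shows that the ideal contains all
second-order terms, so only 1 and X 2 survive. -/
theorem isBasisMod_tyurinaIdeal_of_ne_zero (hα : α = 0) (hβ : β ≠ 0)
    {a b F : MvPowerSeries (Fin 3) K}
    (ha : subst A.invTriple a = A.trace (X 0)) (hb : subst A.invTriple b = A.trace (X 1))
    (hF : F = X 2 ^ 2 - C α * (a * b * X 2) + a ^ 2 * X 1 + b ^ 2 * X 0 -
      C β ^ 2 * (X 0 * X 1)) :
    IsBasisMod (tyurinaIdeal F) ![1, X 2] := by
  have hF' : F = X 2 ^ 2 + a ^ 2 * X 1 + b ^ 2 * X 0 - C β ^ 2 * (X 0 * X 1) := by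
    rw [hF, hα]; simp
  have hJ := tyurinaIdeal_equation hF'
  set V := varIdeal (Fin 3) K
  set J := tyurinaIdeal F
  have ha' : a ∈ V :=
    hA.mem_varIdeal_of_subst_mem (ha ▸ trace_mem_varIdeal A hA.δ_mem (X_mem_varIdeal _))
  have hb' : b ∈ V :=
    hA.mem_varIdeal_of_subst_mem (hb ▸ trace_mem_varIdeal A hA.δ_mem (X_mem_varIdeal _))
  have hX : ∀ i, X i ∈ V := X_mem_varIdeal
  have hunit : C β⁻¹ ^ 2 * C β ^ 2 = (1 : MvPowerSeries (Fin 3) K) := by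
    rw [← mul_pow, ← map_mul, inv_mul_cancel₀ hβ, map_one, one_pow]
  have h0 : X 0 ∈ J ⊔ V ^ 2 := by
    have : X 0 = C β⁻¹ ^ 2 * -(a ^ 2 - C β ^ 2 * X 0) + C β⁻¹ ^ 2 * a ^ 2 := by
      linear_combination -(X 0) * hunit
    rw [this]
    refine Submodule.add_mem_sup (Ideal.mul_mem_left _ _ (neg_mem ?_))
      (Ideal.mul_mem_left _ _ (Ideal.pow_mem_pow ha' 2))
    rw [hJ]
    exact Ideal.subset_span (by simp)
  have h1 : X 1 ∈ J ⊔ V ^ 2 := by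
    have : X 1 = C β⁻¹ ^ 2 * -(b ^ 2 - C β ^ 2 * X 1) + C β⁻¹ ^ 2 * b ^ 2 := by
      linear_combination -(X 1) * hunit
    rw [this]
    refine Submodule.add_mem_sup (Ideal.mul_mem_left _ _ (neg_mem ?_))
      (Ideal.mul_mem_left _ _ (Ideal.pow_mem_pow hb' 2))
    rw [hJ]
    exact Ideal.subset_span (by simp)
  have hFJ : F ∈ J := Ideal.subset_span (Set.mem_insert _ _)
  have hmul : ∀ f ∈ J ⊔ V ^ 2, ∀ g ∈ V, f * g ∈ J ⊔ V ^ 3 := by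
    intro f hf g hg
    obtain ⟨p, hp, q, hq, rfl⟩ := Submodule.mem_sup.1 hf
    rw [add_mul]
    exact Submodule.add_mem_sup (Ideal.mul_mem_right _ _ hp)
      (by rw [pow_succ]; exact Ideal.mul_mem_mul hq hg)
  have hV2 : V ^ 2 ≤ J := by
    refine Ideal.le_of_le_sup_maximalIdeal_mul varIdeal_fg.pow ?_
    rw [maximalIdeal_eq_varIdeal, ← pow_succ', sq, show V = Ideal.span (Set.range X) from rfl,
      Ideal.span_mul_span', Ideal.span_le]
    rintro _ ⟨_, ⟨i, rfl⟩, _, ⟨j, rfl⟩, rfl⟩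
    change X i * X j ∈ J ⊔ V ^ 3
    by_cases hi : i = 2
    · by_cases hj : j = 2
      · have e : (X i * X j : MvPowerSeries (Fin 3) K) =
            F + (C β ^ 2 * (X 0 * X 1) - (a ^ 2 * X 1 + b ^ 2 * X 0)) := by
          rw [hF', hi, hj]; ring
        rw [e]
        refine add_mem (Ideal.mem_sup_left hFJ) (sub_mem (Ideal.mul_mem_left _ _
          (hmul _ h0 _ (hX 1))) (Ideal.mem_sup_right (add_mem ?_ ?_)))
        · rw [pow_succ]; exact Ideal.mul_mem_mul (Ideal.pow_mem_pow ha' 2) (hX 1)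
        · rw [pow_succ]; exact Ideal.mul_mem_mul (Ideal.pow_mem_pow hb' 2) (hX 0)
      · rw [mul_comm]
        obtain rfl | rfl : j = 0 ∨ j = 1 := by omega
        · exact hmul _ h0 _ (hX i)
        · exact hmul _ h1 _ (hX i)
    · obtain rfl | rfl : i = 0 ∨ i = 1 := by omega
      · exact hmul _ h0 _ (hX j)
      · exact hmul _ h1 _ (hX j)
  rw [sup_of_le_left hV2] at h0 h1
  have hle : J ≤ Ideal.span {X 0, X 1} ⊔ V ^ 2 := by
    rw [hJ, Ideal.span_le]
    have e0 : X 0 ∈ Ideal.span {X 0, X 1} ⊔ V ^ 2 :=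
      Ideal.mem_sup_left (Ideal.subset_span (by simp))
    have e1 : X 1 ∈ Ideal.span {X 0, X 1} ⊔ V ^ 2 :=
      Ideal.mem_sup_left (Ideal.subset_span (by simp))
    rintro _ (rfl | rfl | rfl)
    · rw [hF']
      exact sub_mem (add_mem (add_mem (Ideal.mem_sup_right (Ideal.pow_mem_pow (hX 2) 2))
        (Ideal.mul_mem_left _ _ e1)) (Ideal.mul_mem_left _ _ e0))
        (Ideal.mul_mem_left _ _ (Ideal.mul_mem_left _ _ e1))
    · exact sub_mem (Ideal.mem_sup_right (Ideal.pow_mem_pow hb' 2)) (Ideal.mul_mem_left _ _ e1)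
    · exact sub_mem (Ideal.mem_sup_right (Ideal.pow_mem_pow ha' 2)) (Ideal.mul_mem_left _ _ e0)
  constructor
  · intro f
    obtain ⟨r, g, rfl⟩ := exists_eq_C_add_sum f
    refine ⟨![r, constantCoeff (g 2)], ?_⟩
    have e : C r + ∑ j, X j * g j - ∑ i, C ((![r, constantCoeff (g 2)] : Fin 2 → K) i) *
        (![1, X 2] : Fin 2 → MvPowerSeries (Fin 3) K) i =
        X 0 * g 0 + X 1 * g 1 + X 2 * (g 2 - C (constantCoeff (g 2))) := by
      simp [Fin.sum_univ_two, Fin.sum_univ_three]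
      ring
    rw [e]
    refine add_mem (add_mem (Ideal.mul_mem_right _ _ h0) (Ideal.mul_mem_right _ _ h1)) (hV2 ?_)
    rw [sq]
    exact Ideal.mul_mem_mul (hX 2) (sub_C_mem_varIdeal _)
  · intro c hc
    obtain ⟨f, hf, g, hg, e⟩ := Submodule.mem_sup.1 (hle hc)
    obtain ⟨p, q, rfl⟩ := Ideal.mem_span_pair.1 hf
    rw [mem_varIdeal_pow_iff] at hg
    simp only [Fin.sum_univ_two, Matrix.cons_val_zero, Matrix.cons_val_one, mul_one] at e
    rw [mul_comm p, mul_comm q, mul_comm (C (c 1))] at e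
    have e0 := congrArg (coeff 0) e
    have e1 := congrArg (coeff (Finsupp.single 2 1)) e
    classical
    simp only [map_add, coeff_X_mul', hg 0 (by simp)] at e0
    simp only [map_add, coeff_X_mul', hg (Finsupp.single 2 1) (by simp)] at e1
    simp [coeff_C] at e0 e1
    ext i
    fin_cases i
    · exact e0.symm
    · exact e1.symm

end TateOortAction.FixesOrigin

/-! ### The fixed locus for invertible β, and the generic fiber. -/

namespace TateOortAction.FixesOrigin

variable {O : Type*} [CommRing O] [IsLocalRing O]
  {α β : O} {h : α * β = 2} {A : TateOortAction α β h (MvPowerSeries (Fin 2) O)}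
  (hA : A.FixesOrigin)
include hA

/-- Up to the unit β, a variable is its trace minus its δ, and the trace is negligible for Nakayama.
-/
theorem fixedIdeal_eq_varIdeal (hβ : IsUnit β) : A.fixedIdeal = varIdeal (Fin 2) O := by
  apply le_antisymm
  · rw [fixedIdeal, Ideal.span_le]
    rintro _ ⟨f, rfl⟩
    exact hA.δ_mem f
  · refine Ideal.le_of_le_sup_maximalIdeal_mul varIdeal_fg ?_
    rw [varIdeal, Ideal.span_le]
    rintro _ ⟨i, rfl⟩
    obtain ⟨γ, hγ⟩ := hβ.exists_left_inv
    have e : X i = C γ * -A.δ (X i) + C γ * A.trace (X i) := by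
      have h1 : C γ * C β = (1 : MvPowerSeries (Fin 2) O) := by rw [← map_mul, hγ, map_one]
      have h2 : A.trace (X i) = C β * X i + A.δ (X i) := trace_apply ..
      rw [h2]
      linear_combination -(X i) * h1
    rw [e]
    exact Submodule.add_mem_sup (Ideal.mul_mem_left _ _ (neg_mem (Ideal.subset_span ⟨_, rfl⟩)))
      (Ideal.mul_mem_left _ _ (hA.trace_mem i))

theorem isBasisMod_fixedIdeal_of_isUnit (hβ : IsUnit β) :
    IsBasisMod A.fixedIdeal fun _ : Unit => 1 := by
  rw [hA.fixedIdeal_eq_varIdeal hβ]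
  refine ⟨fun f => ⟨fun _ => constantCoeff f, by simpa using sub_C_mem_varIdeal f⟩, fun c hc => ?_⟩
  ext
  simpa [mem_varIdeal_iff] using hc

end TateOortAction.FixesOrigin

namespace TateOortAction

variable {O : Type*} [CommRing O] {α β : O} {h : α * β = 2}

theorem genericFiber_fixedIdeal {σ : Type*} (A : TateOortAction α β h (MvPowerSeries σ O)) :
    A.genericFiber.fixedIdeal = A.fixedIdeal.map
      (Algebra.TensorProduct.includeRight (R := O) (A := FractionRing O)) := by
  have hδ : A.genericFiber.δ = A.δ.baseChange (FractionRing O) := by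
    simp only [genericFiber, baseChange, δ_ofDelta]
  rw [fixedIdeal, fixedIdeal, Ideal.map_span, hδ]
  apply le_antisymm <;> rw [Ideal.span_le]
  · rintro _ ⟨t, rfl⟩
    induction t with
    | zero => rw [map_zero]; exact zero_mem _
    | add s t hs ht => rw [map_add]; exact add_mem hs ht
    | tmul c f =>
      have e : c ⊗ₜ[O] A.δ f = (c ⊗ₜ[O] 1) * (1 ⊗ₜ[O] A.δ f) := by simp
      rw [LinearMap.baseChange_tmul, e]
      exact Ideal.mul_mem_left _ _ (Ideal.subset_span ⟨A.δ f, ⟨f, rfl⟩, rfl⟩)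
  · rintro _ ⟨_, ⟨f, rfl⟩, rfl⟩
    exact Ideal.subset_span ⟨1 ⊗ₜ f, LinearMap.baseChange_tmul ..⟩

theorem genericFiber_quotient_of_isBasisMod [IsDomain O] {σ ι : Type*} [Fintype ι]
    {A : TateOortAction α β h (MvPowerSeries σ O)} {e : ι → MvPowerSeries σ O}
    (he : IsBasisMod A.fixedIdeal e) :
    Module.Finite (FractionRing O)
        ((FractionRing O ⊗[O] MvPowerSeries σ O) ⧸ A.genericFiber.fixedIdeal) ∧
      Module.finrank (FractionRing O)
        ((FractionRing O ⊗[O] MvPowerSeries σ O) ⧸ A.genericFiber.fixedIdeal) =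
          Fintype.card ι := by
  have hfin := he.finite
  have hrank := he.finrank_eq
  have hfree : Module.Free O (MvPowerSeries σ O ⧸ A.fixedIdeal) :=
    Module.Free.of_equiv he.exists_equiv.some
  rw [genericFiber_fixedIdeal]
  let E := (Algebra.TensorProduct.tensorQuotientEquiv (R := O) (FractionRing O)
    (MvPowerSeries σ O) (FractionRing O) A.fixedIdeal).toLinearEquiv
  exact ⟨Module.Finite.equiv E, by rw [← E.finrank_eq, Module.finrank_baseChange, hrank]⟩

end TateOortAction

/-! ### Lifting a basis from the special fiber by adic completeness. -/

theorem IsAdicComplete.exists_sum_pow_mul {O : Type*} [CommRing O] {I : Ideal O}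
    [IsAdicComplete I O] {π : O} (hπ : I = Ideal.span {π}) (a : ℕ → O) :
    ∃ L, ∀ n, ∃ r, L = ∑ m ∈ Finset.range n, π ^ m * a m + π ^ n * r := by
  obtain ⟨L, hL⟩ := IsPrecomplete.prec (I := I) (M := O) inferInstance
    (f := fun n => ∑ m ∈ Finset.range n, π ^ m * a m) (by
      intro m n hmn
      rw [SModEq.sub_mem, ← neg_mem_iff, neg_sub, ← Finset.sum_range_add_sum_Ico _ hmn,
        add_sub_cancel_left]
      refine sum_mem fun j hj => ?_
      rw [smul_eq_mul, Ideal.mul_top, hπ, Ideal.span_singleton_pow]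
      exact Ideal.mul_mem_right _ _
        (Ideal.mem_span_singleton.2 (pow_dvd_pow π (Finset.mem_Ico.1 hj).1)))
  refine ⟨L, fun n => ?_⟩
  have := hL n
  rw [SModEq.sub_mem, ← neg_mem_iff, neg_sub, smul_eq_mul, Ideal.mul_top, hπ,
    Ideal.span_singleton_pow, Ideal.mem_span_singleton] at this
  obtain ⟨r, hr⟩ := this
  exact ⟨r, by rw [← hr, add_sub_cancel]⟩

theorem MvPowerSeries.exists_sum_C_pow_mul {O σ : Type*} [CommRing O] {I : Ideal O}
    [IsAdicComplete I O] {π : O} (hπ : I = Ideal.span {π}) (a : ℕ → MvPowerSeries σ O) :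
    ∃ L, ∀ n, ∃ r, L = ∑ m ∈ Finset.range n, C (π ^ m) * a m + C (π ^ n) * r := by
  choose L r h using fun d => IsAdicComplete.exists_sum_pow_mul hπ fun n => coeff d (a n)
  refine ⟨L, fun n => ?_⟩
  obtain ⟨R, hR⟩ : ∃ R : MvPowerSeries σ O, ∀ d, coeff d R = r d n := ⟨fun d => r d n, fun _ => rfl⟩
  refine ⟨R, ?_⟩
  ext d
  rw [map_add, map_sum]
  simp only [coeff_C_mul, hR]
  exact h d n

namespace TateOortAction.FixesOrigin

variable {O : Type*} [CommRing O] [IsDomain O] [IsPrincipalIdealRing O] [IsLocalRing O]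
  {α β : O} {h : α * β = 2} {A : TateOortAction α β h (MvPowerSeries (Fin 2) O)}

/-- Spanning is π-adic approximation: completeness sums the coefficients as well as the multipliers
of δu and δv. Independence amounts to π being a nonzerodivisor modulo the fixed ideal, which follows
from the Koszul property on the special fiber. -/
theorem isBasisMod_fixedIdeal [IsAdicComplete (maximalIdeal O) O] (hA : A.FixesOrigin)
    (hAk : A.specialFiber.FixesOrigin) {ι : Type*} [Fintype ι]
    {e : ι → MvPowerSeries (Fin 2) O}
    (he : IsBasisMod A.specialFiber.fixedIdeal fun i => map (residue O) (e i)) :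
    IsBasisMod A.fixedIdeal e := by
  obtain ⟨π, hπ⟩ := exists_maximalIdeal_eq_span (O := O)
  have hsurj := map_surjective (σ := Fin 2) (residue_surjective (R := O))
  have hIk := hAk.fixedIdeal_eq
  rw [← map_X (f := residue O) (σ := Fin 2), ← map_X (f := residue O) (σ := Fin 2),
    specialFiber_δ_map, specialFiber_δ_map] at hIk
  have hI := hA.fixedIdeal_eq
  have hmap : ∀ c : ι → O, map (residue O) (∑ i, C (c i) * e i) =
      ∑ i, C (residue O (c i)) * map (residue O) (e i) := by
    intro c
    simp only [map_sum, map_mul, map_C]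
  constructor
  · have step : ∀ f, ∃ (c : ι → O) (p q f' : MvPowerSeries (Fin 2) O),
        f = ∑ i, C (c i) * e i + p * A.δ (X 0) + q * A.δ (X 1) + C π * f' := by
      intro f
      obtain ⟨ck, hck⟩ := he.1 (map (residue O) f)
      choose c hc using fun i => residue_surjective (ck i)
      rw [hIk, Ideal.mem_span_pair] at hck
      obtain ⟨pk, qk, hpq⟩ := hck
      obtain ⟨p, rfl⟩ := hsurj pk
      obtain ⟨q, rfl⟩ := hsurj qk
      obtain ⟨f', hf'⟩ := (map_residue_eq_zero_iff hπ
        (f := f - ∑ i, C (c i) * e i - (p * A.δ (X 0) + q * A.δ (X 1)))).1 (by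
        rw [map_sub, map_sub, hmap, map_add, map_mul, map_mul, hpq]
        simp only [hc, sub_self])
      exact ⟨c, p, q, f', by rw [← hf']; ring⟩
    choose c p q g hg using step
    intro f
    let G : ℕ → MvPowerSeries (Fin 2) O := fun n => g^[n] f
    have hG : ∀ n, G (n + 1) = g (G n) := fun n => Function.iterate_succ_apply' g n f
    choose c' rc hc' using fun i => IsAdicComplete.exists_sum_pow_mul hπ fun n => c (G n) i
    obtain ⟨p', hp'⟩ := exists_sum_C_pow_mul hπ fun n => p (G n)
    obtain ⟨q', hq'⟩ := exists_sum_C_pow_mul hπ fun n => q (G n)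
    have hsum : ∀ n, f = ∑ i, C (∑ m ∈ Finset.range n, π ^ m * c (G m) i) * e i +
        (∑ m ∈ Finset.range n, C (π ^ m) * p (G m)) * A.δ (X 0) +
        (∑ m ∈ Finset.range n, C (π ^ m) * q (G m)) * A.δ (X 1) + C (π ^ n) * G n := by
      intro n
      induction n with
      | zero => simp [G]
      | succ n ih =>
        refine ih.trans ?_
        have e1 := hg (G n)
        rw [← hG] at e1
        simp only [Finset.sum_range_succ, map_add, map_mul, add_mul, Finset.sum_add_distrib,
          mul_assoc, ← Finset.mul_sum, pow_succ]
        linear_combination C (π ^ n) * e1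
    refine ⟨c', ?_⟩
    have : f - ∑ i, C (c' i) * e i = p' * A.δ (X 0) + q' * A.δ (X 1) := by
      rw [← sub_eq_zero]
      refine eq_zero_of_forall_exists_C_pow_mul hπ fun n => ?_
      obtain ⟨rp, hrp⟩ := hp' n
      obtain ⟨rq, hrq⟩ := hq' n
      refine ⟨G n - ∑ i, C (rc i n) * e i - rp * A.δ (X 0) - rq * A.δ (X 1), ?_⟩
      have hc2 : ∑ i, C (c' i) * e i = ∑ i, C (∑ m ∈ Finset.range n, π ^ m * c (G m) i) * e i +
          C (π ^ n) * ∑ i, C (rc i n) * e i := by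
        rw [Finset.mul_sum, ← Finset.sum_add_distrib]
        refine Finset.sum_congr rfl fun i _ => ?_
        conv_lhs => rw [hc' i n]
        rw [map_add, map_mul, add_mul, mul_assoc]
      rw [hc2, hrp, hrq]
      linear_combination hsum n
    rw [this, hI]
    exact Ideal.mem_span_pair.2 ⟨_, _, rfl⟩
  · have step : ∀ c : ι → O, ∑ i, C (c i) * e i ∈ A.fixedIdeal →
        ∃ c' : ι → O, (∀ i, c i = π * c' i) ∧ ∑ i, C (c' i) * e i ∈ A.fixedIdeal := by
      intro c hc
      rw [hI] at hc
      obtain ⟨p, q, hpq⟩ := Ideal.mem_span_pair.1 hc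
      have h0 := he.2 (fun i => residue O (c i)) (by
        rw [← hmap, ← hpq, hIk, map_add, map_mul, map_mul]
        exact Ideal.mem_span_pair.2 ⟨_, _, rfl⟩)
      have h1 : ∀ i, ∃ c', c i = π * c' := by
        intro i
        have := congrFun h0 i
        rw [Pi.zero_apply, residue_eq_zero_iff, hπ, Ideal.mem_span_singleton] at this
        exact this
      choose c' hc' using h1
      by_cases hπ0 : π = 0
      · exact ⟨0, fun i => by rw [hc', hπ0, zero_mul, zero_mul], by simp⟩
      refine ⟨c', hc', ?_⟩
      have h2 : ∑ i, C (c i) * e i = C π * ∑ i, C (c' i) * e i := by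
        rw [Finset.mul_sum]
        exact Finset.sum_congr rfl fun i _ => by rw [hc', map_mul, mul_assoc]
      have hCπ : map (residue O) (C (σ := Fin 2) π) = 0 :=
        (map_residue_eq_zero_iff hπ).2 ⟨1, by rw [mul_one]⟩
      -- The combination is divisible by π, so its multipliers reduce to a Koszul relation.
      -- Subtracting a lift of that relation leaves multipliers divisible by π, and π can be
      -- cancelled.
      have h3 : A.specialFiber.δ (X 0) * map (residue O) p +
          A.specialFiber.δ (X 1) * map (residue O) q = 0 := by
        rw [← map_X (f := residue O), ← map_X (f := residue O), specialFiber_δ_map,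
          specialFiber_δ_map, mul_comm, mul_comm (map (residue O) (A.δ (X 1))), ← map_mul,
          ← map_mul, ← map_add, hpq, h2, map_mul, hCπ, zero_mul]
      obtain ⟨wk, hw0, hw1⟩ := hAk.koszul h3
      obtain ⟨w, rfl⟩ := hsurj wk
      rw [← map_X (f := residue O), specialFiber_δ_map] at hw0 hw1
      obtain ⟨p', hp'⟩ := (map_residue_eq_zero_iff hπ (f := p - A.δ (X 1) * w)).1 (by
        rw [map_sub, map_mul, hw0, sub_self])
      obtain ⟨q', hq'⟩ := (map_residue_eq_zero_iff hπ (f := q + A.δ (X 0) * w)).1 (by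
        rw [map_add, map_mul, hw1, neg_add_cancel])
      have h4 : C π * ∑ i, C (c' i) * e i = C π * (p' * A.δ (X 0) + q' * A.δ (X 1)) := by
        linear_combination A.δ (X 0) * hp' + A.δ (X 1) * hq' - h2 - hpq
      have hC0 : C (σ := Fin 2) π ≠ 0 := fun h0 => hπ0 (C_injective (h0.trans (map_zero C).symm))
      rw [mul_left_cancel₀ hC0 h4, hI]
      exact Ideal.mem_span_pair.2 ⟨_, _, rfl⟩
    have iter : ∀ n, ∀ c : ι → O, ∑ i, C (c i) * e i ∈ A.fixedIdeal →
        ∀ i, ∃ r, c i = π ^ n * r := by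
      intro n
      induction n with
      | zero => exact fun c _ i => ⟨c i, by simp⟩
      | succ n ih =>
        intro c hc i
        obtain ⟨c', hcc, hc'⟩ := step c hc
        obtain ⟨r, hr⟩ := ih c' hc' i
        exact ⟨r, by rw [hcc, hr]; ring⟩
    intro c hc
    funext i
    refine C_injective (σ := Fin 2) ?_
    rw [Pi.zero_apply, map_zero]
    refine eq_zero_of_forall_exists_C_pow_mul hπ fun n => ?_
    obtain ⟨r, hr⟩ := iter n c hc i
    exact ⟨C r, by rw [hr, map_mul]⟩

end TateOortAction.FixesOrigin

/-! ### Recognizing α₂ and μ₂ from the parameters. -/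

namespace TateOort

variable {k : Type*} [Field k] {α β : k} {h : α * β = 2}

theorem gen_ne_zero : gen α β h ≠ 0 := fun h0 => by
  have := coordX_gen α β h
  rw [h0, map_zero] at this
  exact zero_ne_one this

theorem eq_zero_of_mul_self_eq_zero (hα : α ≠ 0) {r : TateOort α β h} (hr : r * r = 0) :
    r = 0 := by
  have hc : Coalgebra.counit (R := k) r = 0 := by
    rw [← mul_self_eq_zero, ← Bialgebra.counit_mul, hr, map_zero]
  have e := eq_counit_add_coordX α β h r
  rw [hc, zero_smul, zero_add] at e
  rw [e, smul_mul_smul_comm, gen_mul_gen, smul_smul] at hr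
  have := congrArg (coordX α β h) hr
  rw [map_smul, coordX_gen, map_zero, smul_eq_mul, mul_one, mul_eq_zero, mul_self_eq_zero] at this
  rw [e, this.resolve_right hα, zero_smul]

/-- For r = 1 + dX, comparing the coefficients of X ⊗ X in the comultiplication gives -βd = d². -/
theorem isGroupLikeElem_iff {r : TateOort α β h} : IsGroupLikeElem k r ↔
    Coalgebra.counit (R := k) r = 1 ∧ coordX α β h r * (coordX α β h r + β) = 0 := by
  have e := eq_counit_add_coordX α β h r
  set d := coordX α β h r
  constructor
  · intro hr
    refine ⟨hr.counit_eq_one, ?_⟩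
    rw [hr.counit_eq_one, one_smul] at e
    have h1 := hr.comul_eq_tmul_self
    have h2 := congrArg ((TensorProduct.lid k k).toLinearMap ∘ₗ
      TensorProduct.map (coordX α β h) (coordX α β h)) h1
    rw [e] at h2
    simp [comul_gen, coordX_gen, coordX_one, Algebra.TensorProduct.one_def] at h2
    linear_combination -h2
  · rintro ⟨hc, hd⟩
    refine ⟨hc, ?_⟩
    rw [hc, one_smul] at e
    rw [e]
    have hd' : d * β = -(d * d) := by linear_combination hd
    simp only [map_add, Bialgebra.comul_one, map_smul, comul_gen, smul_sub, smul_add, smul_smul,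
      hd', TensorProduct.add_tmul, TensorProduct.tmul_add, Algebra.TensorProduct.one_def,
      TensorProduct.tmul_smul, ← TensorProduct.smul_tmul']
    module

theorem eq_one_of_isGroupLikeElem (hβ : β = 0) {r : TateOort α β h}
    (hr : IsGroupLikeElem k r) : r = 1 := by
  have e := eq_counit_add_coordX α β h r
  obtain ⟨hc, hd⟩ := isGroupLikeElem_iff.1 hr
  have hd0 : coordX α β h r = 0 := by
    rw [← mul_self_eq_zero]
    linear_combination hd - coordX α β h r * hβ
  rw [e, hc, hd0, one_smul, zero_smul, add_zero]

end TateOort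

open TateOort

/-- The coordinate ring of α₂ has a nonzero element of square zero, impossible for α ≠ 0. Its only
group-like element is 1, whereas 1 - βX is group-like for all parameters. -/
theorem IsAlphaTwo.eq_zero {k : Type*} [Field k] {α β : k} {h : α * β = 2}
    (H : IsAlphaTwo k (TateOort α β h)) : α = 0 ∧ β = 0 := by
  obtain ⟨h0, ⟨e⟩⟩ := H
  constructor
  · by_contra hα
    refine gen_ne_zero (h := h0) ((map_eq_zero_iff e.symm e.symm.injective).1
      (eq_zero_of_mul_self_eq_zero hα ?_))
    rw [← map_mul, gen_mul_gen, zero_smul, map_zero]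
  · have h1 : IsGroupLikeElem k (1 - β • gen α β h) := by
      refine isGroupLikeElem_iff.2 ⟨?_, ?_⟩
      · rw [map_sub, map_smul, Bialgebra.counit_one, counit_gen, smul_zero, sub_zero]
      · rw [map_sub, map_smul, coordX_gen, coordX_one, smul_eq_mul]
        ring
    have h2 := e.injective ((eq_one_of_isGroupLikeElem rfl (h1.map e)).trans (map_one e).symm)
    have h3 := congrArg (coordX α β h) h2
    simpa [coordX_gen, coordX_one] using h3

/-- For the generator g of the group, (g - 1)² = 0 in characteristic two, which forces α = 0. A
group-like element other than 1 exists, which excludes β = 0. -/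
theorem IsMuTwo.eq_zero_and_ne_zero {k : Type*} [Field k] [CharP k 2] {α β : k} {h : α * β = 2}
    (H : IsMuTwo k (TateOort α β h)) : α = 0 ∧ β ≠ 0 := by
  obtain ⟨e⟩ := H
  set g : MonoidAlgebra k (Multiplicative (ZMod 2)) :=
    MonoidAlgebra.of k _ (Multiplicative.ofAdd 1) with hg
  have hg1 : g ≠ 1 := fun h1 => by
    rw [← map_one (MonoidAlgebra.of k (Multiplicative (ZMod 2)))] at h1
    exact absurd (MonoidAlgebra.of_injective h1) (by decide)
  have hgg : g * g = 1 := by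
    rw [hg, ← map_mul]
    exact map_one _
  constructor
  · by_contra hα
    refine hg1 (sub_eq_zero.1 ((map_eq_zero_iff e.symm e.symm.injective).1
      (eq_zero_of_mul_self_eq_zero hα ?_)))
    have h2 : (2 : MonoidAlgebra k (Multiplicative (ZMod 2))) = 0 := by
      have h2' := map_ofNat (algebraMap k (MonoidAlgebra k (Multiplicative (ZMod 2)))) 2
      exact h2'.symm.trans ((congrArg _ (CharTwo.two_eq_zero (R := k))).trans (map_zero _))
    have : (g - 1) * (g - 1) = 0 := by linear_combination hgg + (1 - g) * h2
    rw [← map_mul, this, map_zero]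
  · intro hβ
    have h1 : IsGroupLikeElem k g := MonoidAlgebra.isGroupLikeElem_of ..
    exact hg1 (e.symm.injective
      ((eq_one_of_isGroupLikeElem hβ (h1.map e.symm)).trans (map_one e.symm).symm))

end

/-! ### Assembly of the main theorem. -/

theorem mainTheorem3 {O : Type*} [CommRing O] [IsDomain O] [IsPrincipalIdealRing O]
    [IsLocalRing O] (α β : O) (hαβ : α * β = 2)
    (A : TateOortAction α β hαβ (MvPowerSeries (Fin 2) O))
    (u v x y z a b : MvPowerSeries (Fin 2) O)
    (hu : u = MvPowerSeries.X 0) (hv : v = MvPowerSeries.X 1)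
    (hfix : PrimeSpectrum.zeroLocus {u, v} ⊆ A.fixedLocus)
    (hfixk : A.specialFiber.fixedLocus =
      PrimeSpectrum.zeroLocus {MvPowerSeries.X 0, MvPowerSeries.X 1})
    (hx : x = u * (u + α • A.δ u)) (ha : a = β • u + A.δ u)
    (hy : y = v * (v + α • A.δ v)) (hb : b = β • v + A.δ v)
    (hz : z = β • (u * v) + A.δ u * v + u * A.δ v) :
    (x ∈ A.invariants ∧ y ∈ A.invariants ∧ z ∈ A.invariants ∧
      a ∈ A.invariants ∧ b ∈ A.invariants) ∧
    MvPowerSeries.HasSubst ![x, y, z] ∧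
    Set.range (fun f : MvPowerSeries (Fin 3) O => MvPowerSeries.subst ![x, y, z] f) =
      (A.invariants : Set (MvPowerSeries (Fin 2) O)) ∧
    ∀ a' b' F : MvPowerSeries (Fin 3) O,
      MvPowerSeries.subst ![x, y, z] a' = a →
      MvPowerSeries.subst ![x, y, z] b' = b →
      F = MvPowerSeries.X 2 ^ 2 - α • (a' * b' * MvPowerSeries.X 2)
        + a' ^ 2 * MvPowerSeries.X 1 + b' ^ 2 * MvPowerSeries.X 0
        - β ^ 2 • (MvPowerSeries.X 0 * MvPowerSeries.X 1) →
      (∃ e : (MvPowerSeries (Fin 3) O ⧸ Ideal.span {F}) ≃ₐ[O] A.invariants,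
        ∀ f : MvPowerSeries (Fin 3) O,
          (e (Ideal.Quotient.mk _ f) : MvPowerSeries (Fin 2) O) =
            MvPowerSeries.subst ![x, y, z] f) ∧
      (CharZero (FractionRing O) → CharP (IsLocalRing.ResidueField O) 2 →
        (IsAlphaTwo (IsLocalRing.ResidueField O)
            (TateOort (algebraMap O (IsLocalRing.ResidueField O) α)
              (algebraMap O (IsLocalRing.ResidueField O) β)
              (by rw [← map_mul, hαβ, map_ofNat])) →
          Module.Finite (IsLocalRing.ResidueField O)
            (MvPowerSeries (Fin 3) (IsLocalRing.ResidueField O) ⧸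
              tyurinaIdeal (MvPowerSeries.map (IsLocalRing.residue O) F)) ∧
          Module.Finite (IsLocalRing.ResidueField O)
            (MvPowerSeries (Fin 2) (IsLocalRing.ResidueField O) ⧸
              A.specialFiber.fixedIdeal) ∧
          tyurinaNumber (MvPowerSeries.map (IsLocalRing.residue O) F) =
            2 * Module.finrank (IsLocalRing.ResidueField O)
              (MvPowerSeries (Fin 2) (IsLocalRing.ResidueField O) ⧸
                A.specialFiber.fixedIdeal) ∧
          (IsAdicComplete (IsLocalRing.maximalIdeal O) O →
            Module.Finite (FractionRing O)
              ((FractionRing O ⊗[O] MvPowerSeries (Fin 2) O) ⧸ A.genericFiber.fixedIdeal) ∧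
            tyurinaNumber (MvPowerSeries.map (IsLocalRing.residue O) F) =
              2 * Module.finrank (FractionRing O)
                ((FractionRing O ⊗[O] MvPowerSeries (Fin 2) O) ⧸
                  A.genericFiber.fixedIdeal))) ∧
        (IsMuTwo (IsLocalRing.ResidueField O)
            (TateOort (algebraMap O (IsLocalRing.ResidueField O) α)
              (algebraMap O (IsLocalRing.ResidueField O) β)
              (by rw [← map_mul, hαβ, map_ofNat])) →
          tyurinaNumber (MvPowerSeries.map (IsLocalRing.residue O) F) = 2 ∧
          Module.finrank (IsLocalRing.ResidueField O)
            (MvPowerSeries (Fin 2) (IsLocalRing.ResidueField O) ⧸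
              A.specialFiber.fixedIdeal) = 1 ∧
          Module.finrank (FractionRing O)
            ((FractionRing O ⊗[O] MvPowerSeries (Fin 2) O) ⧸
              A.genericFiber.fixedIdeal) = 1)) := by
  open MvPowerSeries IsLocalRing in
  subst hu hv
  have hNe : ∃ N, varIdeal (Fin 2) (ResidueField O) ^ N ≤ A.specialFiber.fixedIdeal :=
    TateOortAction.exists_varIdeal_pow_le hfixk.le
  obtain ⟨N, hN⟩ := hNe
  have hδ := TateOortAction.δ_mem_varIdeal_of_zeroLocus_subset hfix
  have hδk := TateOortAction.δ_mem_varIdeal_of_zeroLocus_subset hfixk.ge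
  have hA := TateOortAction.fixesOrigin_of_specialFiber hδ hδk hN
  have hAk := TateOortAction.fixesOrigin_of_field hδk hN
  have ha' : a = A.trace (X 0) := by rw [ha, TateOortAction.trace_apply, Algebra.smul_def]
  have hb' : b = A.trace (X 1) := by rw [hb, TateOortAction.trace_apply, Algebra.smul_def]
  have hxyz : ![x, y, z] = A.invTriple := by
    rw [TateOortAction.invTriple, TateOortAction.trace_mul_conj, TateOortAction.conj,
      TateOortAction.conj, hx, hy, hz]
    simp only [Algebra.smul_def]
  have hinv : ∀ i, ![x, y, z] i ∈ A.invariants := fun i => by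
    rw [hxyz, TateOortAction.mem_invariants_iff, ← subst_X hA.hasSubst_invTriple (R := O) i]
    exact hA.δ_subst_invTriple _
  rw [hxyz]
  refine ⟨⟨hinv 0, hinv 1, hinv 2, ?_, ?_⟩, hA.hasSubst_invTriple, hA.range_subst_invTriple, ?_⟩
  · rw [ha', TateOortAction.mem_invariants_iff, TateOortAction.δ_trace]
  · rw [hb', TateOortAction.mem_invariants_iff, TateOortAction.δ_trace]
  intro a' b' F haF hbF hF
  rw [ha'] at haF
  rw [hb'] at hbF
  rw [smul_eq_C_mul, smul_eq_C_mul, map_pow] at hF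
  refine ⟨hA.exists_quotient_equiv haF hbF hF, fun _ _ => ?_⟩
  have haFk : subst A.specialFiber.invTriple (map (residue O) a') = A.specialFiber.trace (X 0) := by
    rw [hA.map_subst_invTriple, haF, ← TateOortAction.specialFiber_trace_map, map_X]
  have hbFk : subst A.specialFiber.invTriple (map (residue O) b') = A.specialFiber.trace (X 1) := by
    rw [hA.map_subst_invTriple, hbF, ← TateOortAction.specialFiber_trace_map, map_X]
  have hFk : map (residue O) F = X 2 ^ 2 - C (algebraMap O (ResidueField O) α) *
      (map (residue O) a' * map (residue O) b' * X 2) + map (residue O) a' ^ 2 * X 1 +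
      map (residue O) b' ^ 2 * X 0 - C (algebraMap O (ResidueField O) β) ^ 2 * (X 0 * X 1) := by
    rw [hF]
    simp only [map_sub, map_add, map_mul, map_pow, map_X, map_C]
    rfl
  constructor
  · intro hα₂
    obtain ⟨hα, hβ⟩ := hα₂.eq_zero
    have hfin := finite_quotient_of_varIdeal_pow_le hN
    obtain ⟨ek, hek⟩ := exists_isBasisMod A.specialFiber.fixedIdeal
    have hT := hAk.isBasisMod_tyurinaIdeal_of_eq_zero hα hβ haFk hbFk hFk hek hN
    have hτ : tyurinaNumber (map (residue O) F) = 2 * Module.finrank (ResidueField O)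
        (MvPowerSeries (Fin 2) (ResidueField O) ⧸ A.specialFiber.fixedIdeal) := by
      rw [tyurinaNumber, hT.finrank_eq, Fintype.card_sum, Fintype.card_fin, two_mul]
    refine ⟨hT.finite, hfin, hτ, fun _ => ?_⟩
    -- Arbitrary lifts of the special-fiber basis form a basis over `O`, so both fibers have the
    -- same degree.
    choose e he using fun i => map_surjective (σ := Fin 2) (residue_surjective (R := O)) (ek i)
    obtain rfl : (fun i => map (residue O) (e i)) = ek := funext he
    obtain ⟨h1, h2⟩ := TateOortAction.genericFiber_quotient_of_isBasisMod
      (hA.isBasisMod_fixedIdeal hAk hek)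
    exact ⟨h1, by rw [h2, hτ, Fintype.card_fin]⟩
  · intro hμ₂
    obtain ⟨hα, hβ⟩ := hμ₂.eq_zero_and_ne_zero
    refine ⟨?_, ?_, ?_⟩
    · rw [tyurinaNumber,
        (hAk.isBasisMod_tyurinaIdeal_of_ne_zero hα hβ haFk hbFk hFk).finrank_eq, Fintype.card_fin]
    · rw [(hAk.isBasisMod_fixedIdeal_of_isUnit hβ.isUnit).finrank_eq, Fintype.card_unit]
    -- β is already a unit in `O`, so the fixed ideal is that of the origin over `O` and no
    -- completeness is needed.
    · have hu : IsUnit β := (residue_ne_zero_iff_isUnit β).1 hβ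
      rw [(TateOortAction.genericFiber_quotient_of_isBasisMod
        (hA.isBasisMod_fixedIdeal_of_isUnit hu)).2, Fintype.card_unit]
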